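/- Let $d\ge 1$, and let $a=a(\mathbf w,\boldsymbol\xi)$ be a smooth ($C^\infty$) complex-valued function on $\mathbb R^d\times\mathbb R^d$. For $\alpha>0$ and $t\in[0,1]$ let $$(\mathrm{op}_{\alpha,t}(a)u)(\mathbf x)=\Bigl(\frac{\alpha}{2\pi}\Bigr)^d\iint e^{i\alpha(\mathbf x-\mathbf y)\cdot\boldsymbol\xi}\,a\bigl((1-t)\mathbf x+t\mathbf y,\boldsymbol\xi\bigr)\,u(\mathbf y)\,d\mathbf y\,d\boldsymbol\xi ,$$ where the integral is understood as an oscillatory integral, i.e. as the limit for $\varepsilon\to0+$ of the integrals with the additional factor $\chi(\varepsilon\boldsymbol\xi)$, the same for every $\chi\in C_c^\infty(\mathbb R^d)$ with $\chi(0)=1$ (if the integral converges absolutely, this is its value). For functions $h_1,h_2$ on $\mathbb R^d$, $h_1\,\mathrm{op}_{\alpha,t}(a)\,h_2$ denotes the bounded operator on $L^2(\mathbb R^d)$, unique if it exists, that acts on test functions $u\in C_c^\infty(\mathbb R^d)$ by $u\mapsto h_1\,\mathrm{op}_{\alpha,t}(a)(h_2u)$, almost everywhere (where $h_1(\mathbf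 x)=0$ the value is $0$). Let $\mathfrak S_1$ be the set of compact operators with summable singular values $s_k$, $\|A\|_{\mathfrak S_1}=\sum_k s_k(A)$. For measurable $h$ put $$|||h|||_{2,\infty}=\sup_{\mathbf u\in\mathbb R^d}\Bigl(\int_{\mathcal C_{\mathbf u}}|h(\mathbf x)|^2d\mathbf x\Bigr)^{1/2},$$ where $\mathcal C_{\mathbf u}$ is the cube with edges of unit length centred at $\mathbf u$. Write $|\nabla^k_{\mathbf w}\nabla^l_{\boldsymbol\xi}a|$ for the (operator) norm of the tensor of mixed derivatives of order $k$ in $\mathbf w$ and $l$ in $\boldsymbol\xi$. Then the following holds. (1) There is a constant $C>0$ depending only on $d$ such that, for all $h_1,h_2$ with $|||h_j|||_{2,\infty}<\infty$, all $\alpha\ge1$, all $t\in[0,1]$ and all smooth $a$ with $\sum_{k,l=0}^{d+1}|\nabla_{\mathbf w}^k\nabla_{\boldsymbol\xi}^l a|\in L^1(\mathbb R^{2d})$, the operator $h_1\,\mathrm{op}_{\alpha,t}(a)\,h_2$ exists, belongs to $\mathfrak S_1$, and $$\|h_1\,\mathrm{op}_{\alpha,t}(a)\,h_2\|_{\mathfrak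 S_1}\le C\alpha^d\,|||h_1|||_{2,\infty}\,|||h_2|||_{2,\infty}\sum_{k,l=0}^{d+1}\iint|\nabla_{\mathbf w}^k\nabla_{\boldsymbol\xi}^l a(\mathbf w,\boldsymbol\xi)|\,d\mathbf w\,d\boldsymbol\xi .$$ (2) For every integer $m\ge d+1$ there is a constant $C_m>0$ depending only on $d$ and $m$ such that, for all $h_1,h_2$ with $|||h_j|||_{2,\infty}<\infty$ whose (essential) supports are at a distance at least $r\ge1$ from each other, all $\alpha\ge1$, all $t\in[0,1]$ and all smooth $a$ with $\sum_{k=0}^{d+1}|\nabla_{\mathbf w}^k\nabla_{\boldsymbol\xi}^m a|\in L^1(\mathbb R^{2d})$, the operator $h_1\,\mathrm{op}_{\alpha,t}(a)\,h_2$ exists, belongs to $\mathfrak S_1$, and $$\|h_1\,\mathrm{op}_{\alpha,t}(a)\,h_2\|_{\mathfrak S_1}\le C_m(\alpha r)^{d-m}\,|||h_1|||_{2,\infty}\,|||h_2|||_{2,\infty}\sum_{k=0}^{d+1}\iint|\nabla_{\mathbf w}^k\nabla_{\boldsymbol\xi}^m a(\mathbf w,\boldsymbol\xi)|\,d\mathbf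 w\,d\boldsymbol\xi .$$ -/

import Mathlib

open MeasureTheory Filter Topology
open scoped ENNReal ContDiff

noncomputable section

namespace TraceClassPDO

/-- The Euclidean space `ℝ^d`. -/
abbrev E (d : ℕ) : Type := EuclideanSpace ℝ (Fin d)

/-- The complex Hilbert space `L²(ℝ^d)`. -/
abbrev L2 (d : ℕ) : Type := Lp ℂ 2 (volume : Measure (E d))

section Ideals

variable {H : Type*} [NormedAddCommGroup H] [InnerProductSpace ℂ H]

/-- The singular value `s_{k+1}(A)` (the enumeration starts at `k = 0`), as the distance in the
operator norm from `A` to the operators of rank at most `k`. -/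
def singularValue (A : H →L[ℂ] H) (k : ℕ) : ℝ≥0∞ :=
  ⨅ (F : H →L[ℂ] H) (_ : LinearMap.rank (F : H →ₗ[ℂ] H) ≤ (k : Cardinal)), ‖A - F‖ₑ

/-- The trace norm: the sum of all singular values. -/
def traceNorm (A : H →L[ℂ] H) : ℝ≥0∞ := ∑' k : ℕ, singularValue A k

/-- The trace class: the compact operators with summable singular values. -/
def IsTraceClass (A : H →L[ℂ] H) : Prop := IsCompactOperator A ∧ traceNorm A < ⊤

end Ideals

variable {d : ℕ}

/-- The cube with edges of unit length centred at `u`. -/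
def unitCube (u : E d) : Set (E d) := {x | ∀ i, |x i - u i| ≤ 1 / 2}

/-- The lattice norm: the supremum over `u ∈ ℝ^d` of the `L²`-norm of `h` over the unit cube
centred at `u`. -/
def latticeNorm (h : E d → ℂ) : ℝ≥0∞ :=
  ⨆ u : E d, (∫⁻ x in unitCube u, ‖h x‖ₑ ^ 2) ^ (1 / 2 : ℝ)

/-- `h` belongs to `ℓ^∞(L²)(ℝ^d)`. -/
def MemLatticeL2 (h : E d → ℂ) : Prop :=
  AEStronglyMeasurable h volume ∧ latticeNorm h < ⊤

/-- The support of a function that is defined up to sets of measure zero. -/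
def essSupport (h : E d → ℂ) : Set (E d) :=
  {x | ∀ U ∈ 𝓝 x, 0 < volume (U ∩ {y | h y ≠ 0})}

/-- The norm `|∇_w^k ∇_ξ^l a(w, ξ)|` of the tensor of the mixed derivatives of orders `k`, `l`. -/
def mixedDeriv (a : E d → E d → ℂ) (k l : ℕ) (w ξ : E d) : ℝ :=
  ‖iteratedFDeriv ℝ k (fun w' => iteratedFDeriv ℝ l (fun ξ' => a w' ξ') ξ) w‖

/-- `F°_{n,m}(w, ξ; a) = ∑_{k ≤ n} |∇_w^k ∇_ξ^m a(w, ξ)|`. -/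
def symbolFCirc (n m : ℕ) (a : E d → E d → ℂ) (w ξ : E d) : ℝ :=
  ∑ k ∈ Finset.range (n + 1), mixedDeriv a k m w ξ

/-- `F_{n,m}(w, ξ; a) = ∑_{l ≤ m} F°_{n,l}(w, ξ; a)`. -/
def symbolF (n m : ℕ) (a : E d → E d → ℂ) (w ξ : E d) : ℝ :=
  ∑ l ∈ Finset.range (m + 1), symbolFCirc n l a w ξ

/-- `∬ |∇_w^k ∇_ξ^l a(w, ξ)| dw dξ`. -/
def mixedDerivL1 (a : E d → E d → ℂ) (k l : ℕ) : ℝ≥0∞ :=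
  ∫⁻ p : E d × E d, ENNReal.ofReal (mixedDeriv a k l p.1 p.2)

/-- The regularized quantization integral
`(α/2π)^d ∬ χ(εξ) e^{iα(x-y)·ξ} a((1-t)x + ty, ξ) v(y) dy dξ`. -/
def regularizedOp (α t : ℝ) (a : E d → E d → ℂ) (χ : E d → ℂ) (ε : ℝ) (v : E d → ℂ) (x : E d) : ℂ :=
  (((α / (2 * Real.pi)) ^ d : ℝ) : ℂ) * ∫ p : E d × E d,
    χ (ε • p.2) * Complex.exp (Complex.I * ((α * inner ℝ (x - p.1) p.2 : ℝ) : ℂ)) *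
      a ((1 - t) • x + t • p.1) p.2 * v p.1

/-- `(op_{α,t}(a) v)(x) = L`, with the double integral understood as an oscillatory integral: its
regularizations by cut-off functions `χ(εξ)`, `χ ∈ C_c^∞`, `χ(0) = 1`, tend to `L` as `ε → 0+`,
whatever `χ` is. (If the double integral is absolutely convergent, then `L` is its value.) -/
def HasOpValue (α t : ℝ) (a : E d → E d → ℂ) (v : E d → ℂ) (x : E d) (L : ℂ) : Prop :=
  ∀ χ : E d → ℂ, ContDiff ℝ ∞ χ → HasCompactSupport χ → χ 0 = 1 →
    Tendsto (fun ε : ℝ => regularizedOp α t a χ ε v x) (𝓝[>] 0) (𝓝 L)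

/-- The bounded operator `T` on `L²(ℝ^d)` is `h₁ op_{α,t}(a) h₂`: on the dense set of the test
functions `u ∈ C_c^∞(ℝ^d)` it acts as `(T u)(x) = h₁(x) (op_{α,t}(a) (h₂ u))(x)` for a.e. `x`, where
the value `(op_{α,t}(a) (h₂ u))(x)` is needed only where `h₁(x) ≠ 0`. At most one bounded `T` has
this property. -/
def IsWeightedOp (h₁ h₂ : E d → ℂ) (α t : ℝ) (a : E d → E d → ℂ) (T : L2 d →L[ℂ] L2 d) : Prop :=
  ∀ u : L2 d, ∀ φ : E d → ℂ, ContDiff ℝ ∞ φ → HasCompactSupport φ → u =ᵐ[volume] φ →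
    ∀ᵐ x ∂(volume : Measure (E d)), ∃ L : ℂ,
      (h₁ x ≠ 0 → HasOpValue α t a (fun y => h₂ y * φ y) x L) ∧ T u x = h₁ x * L

end TraceClassPDO

end

/-!
The trace norm is estimated through sums over orthonormal systems. If
`∑ |⟨f_l, T e_l⟩| ≤ M` for all finite orthonormal systems `e`, `f` (`HasNuclearBound`), then a greedy
choice of almost maximizing vectors shows that `traceNorm T ≤ 4 M`
(`HasNuclearBound.traceNorm_le`). Such bounds are additive, and an integral operator whose kernel is
a superposition `∫ c(s) p(x) A(s, x) B(s, y) q(y) ds` with `|A|, |B| ≤ 1` has the bound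
`‖c‖_{L¹} ‖p‖_{L²} ‖q‖_{L²}` (`exists_kernelOp`). So it is enough to cut `ℝ^d × ℝ^d` into products of
cells and to separate the variables `x` and `y` in the kernel over each product.

Over a pair of cells `m` integrations by parts in a coordinate `ξ_i` turn the kernel into
`(α / 2π)^d (i / (α (x_i - y_i)))^m ∫ e^{iα(x-y)·ξ} ∂_{ξ_i}^m a((1-t)x + ty, ξ) dξ`, where `m = 0` is
taken for neighbouring cells in the first estimate. A cut-off and the Fourier transform in `w` write
`∂_{ξ_i}^m a(w, ξ)` near the relevant `w` as a superposition of exponentials, whose total weight is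
bounded by `d + 1` derivatives in `L¹` (`exists_lintegral_fourier_cutoff_le`), and exponentials of
`(1-t)x + ty` separate. The factor `(x_i - y_i)^{-m}` is separated by a Laplace transform
(`exists_separation`), which costs a constant only if `|x_i - y_i|` is comparable to the distance of
the cells. Together this bounds the piece (`exists_pieceOp`) by `α^d (α · distance)^{-m}`, a local
`L¹` norm of the derivatives of `a`, and the `L²` norms of `h₁`, `h₂` over the cells.

That the kernel represents the oscillatory integral for every cut-off `χ(εξ)` has to be proved
without any control on the derivatives of `a` of order below `m`, as only those of order `m` are
integrable. Hence `a` grows at most polynomially in `ξ` in the mean (`exists_growth`), which gives an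
a priori bound of the regularized integrals by a power of `1 / ε`; each integration by parts improves
the exponent by one (`oscInt_bounded_and_tendsto`).

It remains to sum over the pairs of cells (`exists_isWeightedOp_of_weights`). For a fixed difference
`q` of the indices the local norms overlap boundedly, so they sum up to the global norm, and the
weights `|q|^{-m}` are summable over the lattice `ℤ^d` since `m ≥ d + 1`. For the first estimate the
cells have a fixed side, and `m = d + 1` away from the diagonal. For the second one they have a side
proportional to `r`, so small that the pieces near the diagonal vanish by the assumption on the
supports; the scaling in `r` then yields the factor `(α r)^{d-m}`.
-/

namespace TraceClassPDO

/-! ### Nuclear bounds and the trace norm -/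

section NuclearBound

variable {H : Type*} [NormedAddCommGroup H] [InnerProductSpace ℂ H]

/-- `M` bounds the sums `∑ |⟨f_l, T e_l⟩|` over all finite orthonormal systems `e`, `f`, which are
encoded as initial segments of sequences. -/
def HasNuclearBound (T : H →L[ℂ] H) (M : ℝ≥0∞) : Prop :=
  ∀ (n : ℕ) (e f : ℕ → H), Orthonormal ℂ (fun i : Fin n => e i) →
    Orthonormal ℂ (fun i : Fin n => f i) →
    ∑ l ∈ Finset.range n, ‖inner ℂ (f l) (T (e l))‖ₑ ≤ M

lemma HasNuclearBound.mono {T : H →L[ℂ] H} {M N : ℝ≥0∞} (h : HasNuclearBound T M) (hMN : M ≤ N) :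
    HasNuclearBound T N := fun n e f he hf => (h n e f he hf).trans hMN

lemma hasNuclearBound_zero : HasNuclearBound (0 : H →L[ℂ] H) 0 := by
  intro n e f _ _
  simp

lemma HasNuclearBound.enorm_le {T : H →L[ℂ] H} {M : ℝ≥0∞} (h : HasNuclearBound T M) :
    ‖T‖ₑ ≤ M := by
  rcases eq_or_ne M ⊤ with rfl | hM
  · exact le_top
  rw [← ENNReal.ofReal_toReal hM, ← ofReal_norm]
  refine ENNReal.ofReal_le_ofReal (T.opNorm_le_bound ENNReal.toReal_nonneg fun x => ?_)
  rcases eq_or_ne x 0 with rfl | hx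
  · simp
  rcases eq_or_ne (T x) 0 with hTx | hTx
  · rw [hTx, norm_zero]; positivity
  have hx' : 0 < ‖x‖ := norm_pos_iff.2 hx
  have hT' : 0 < ‖T x‖ := norm_pos_iff.2 hTx
  have key := h 1 (fun _ => ((‖x‖⁻¹ : ℝ) : ℂ) • x) (fun _ => ((‖T x‖⁻¹ : ℝ) : ℂ) • T x)
    (by
      rw [orthonormal_iff_ite]
      intro i j
      rw [Subsingleton.elim i j, inner_self_eq_norm_sq_to_K, norm_smul]
      simp [hx'.ne'])
    (by
      rw [orthonormal_iff_ite]
      intro i j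
      rw [Subsingleton.elim i j, inner_self_eq_norm_sq_to_K, norm_smul]
      simp [hT'.ne'])
  rw [Finset.sum_range_one, map_smul, inner_smul_left, inner_smul_right,
    inner_self_eq_norm_sq_to_K, ← ofReal_norm, ENNReal.ofReal_le_iff_le_toReal hM] at key
  simp only [norm_mul, Complex.norm_real, Complex.conj_ofReal, norm_inv, norm_pow,
    Complex.coe_algebraMap, norm_norm] at key
  have : ‖T x‖⁻¹ * (‖x‖⁻¹ * ‖T x‖ ^ 2) = ‖T x‖ / ‖x‖ := by field_simp
  rw [this, div_le_iff₀ hx'] at key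
  exact key

lemma HasNuclearBound.of_hasSum {ι : Type*} {T : ι → H →L[ℂ] H} {S : H →L[ℂ] H} {M : ι → ℝ≥0∞}
    (h : ∀ i, HasNuclearBound (T i) (M i)) (hS : HasSum T S) : HasNuclearBound S (∑' i, M i) := by
  intro n e f he hf
  have h1 : ∀ l, ‖inner ℂ (f l) (S (e l))‖ₑ ≤ ∑' i, ‖inner ℂ (f l) (T i (e l))‖ₑ := by
    intro l
    have : HasSum (fun i => inner ℂ (f l) (T i (e l))) (inner ℂ (f l) (S (e l))) :=
      (((innerSL ℂ (f l)).comp (ContinuousLinearMap.apply ℂ H (e l))).hasSum hS)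
    rw [← this.tsum_eq]
    exact enorm_tsum_le_tsum_enorm
  calc _ ≤ ∑ l ∈ Finset.range n, ∑' i, ‖inner ℂ (f l) (T i (e l))‖ₑ :=
        Finset.sum_le_sum fun l _ => h1 l
    _ = ∑' i, ∑ l ∈ Finset.range n, ‖inner ℂ (f l) (T i (e l))‖ₑ :=
        (Summable.tsum_finsetSum fun _ _ => ENNReal.summable).symm
    _ ≤ _ := ENNReal.tsum_le_tsum fun i => h i n e f he hf

lemma orthonormal_update {n : ℕ} {e : ℕ → H} {x : H} (he : Orthonormal ℂ (fun i : Fin n => e i))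
    (hx : ‖x‖ = 1) (hex : ∀ i < n, inner ℂ (e i) x = 0) :
    Orthonormal ℂ (fun i : Fin (n + 1) => Function.update e n x i) := by
  rw [orthonormal_iff_ite] at he ⊢
  intro i j
  rcases Nat.lt_succ_iff_lt_or_eq.1 i.2 with hi | hi <;>
  rcases Nat.lt_succ_iff_lt_or_eq.1 j.2 with hj | hj
  · have := he ⟨i, hi⟩ ⟨j, hj⟩
    rw [Function.update_of_ne hi.ne, Function.update_of_ne hj.ne]
    simpa [Fin.ext_iff] using this
  · rw [Function.update_of_ne hi.ne, hj, Function.update_self, hex _ hi, if_neg]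
    rw [Fin.ext_iff]; omega
  · rw [Function.update_of_ne hj.ne, hi, Function.update_self, ← inner_conj_symm, hex _ hj,
      if_neg, map_zero]
    rw [Fin.ext_iff]; omega
  · have : i = j := Fin.ext (hi.trans hj.symm)
    subst this
    rw [if_pos rfl, hi, Function.update_self, inner_self_eq_norm_sq_to_K, hx]
    simp

lemma singularValue_antitone (T : H →L[ℂ] H) : Antitone (singularValue T) := by
  intro m n hmn
  refine le_iInf₂ fun F hF => iInf₂_le F (hF.trans ?_)
  exact_mod_cast hmn

/-- One step of the greedy choice: after `n` vectors, compress `T` to the orthogonal complements of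
their spans. This changes `T` by an operator of rank at most `2 n`, so that a pair of vectors which
nearly attains the norm of the compression controls `singularValue T (2 * n)`. -/
lemma exists_next_pair (T : H →L[ℂ] H) {n : ℕ} {e f : ℕ → H}
    (hs : singularValue T (2 * n) ≠ 0) :
    ∃ x y : H, ‖x‖ = 1 ∧ ‖y‖ = 1 ∧ (∀ i < n, inner ℂ (e i) x = 0) ∧
      (∀ i < n, inner ℂ (f i) y = 0) ∧ singularValue T (2 * n) ≤ 2 * ‖inner ℂ y (T x)‖ₑ := by
  classical
  set V : Submodule ℂ H := Submodule.span ℂ ((Finset.range n).image e : Set H) with hV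
  set W : Submodule ℂ H := Submodule.span ℂ ((Finset.range n).image f : Set H) with hW
  have hVr : Module.rank ℂ V ≤ n := (rank_span_finset_le _).trans (by
    exact_mod_cast (Finset.card_image_le).trans (Finset.card_range n).le)
  have hWr : Module.rank ℂ W ≤ n := (rank_span_finset_le _).trans (by
    exact_mod_cast (Finset.card_image_le).trans (Finset.card_range n).le)
  have : FiniteDimensional ℂ V := FiniteDimensional.span_finset ℂ _
  have : FiniteDimensional ℂ W := FiniteDimensional.span_finset ℂ _
  set P := V.starProjection
  set Q := W.starProjection
  set R : H →L[ℂ] H := (1 - Q) * T * (1 - P) with hR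
  have hrank : ∀ (U : Submodule ℂ H) [FiniteDimensional ℂ U], Module.rank ℂ U ≤ n →
      LinearMap.rank (U.starProjection : H →ₗ[ℂ] H) ≤ n := by
    intro U _ hU
    refine le_trans (Submodule.rank_mono ?_) hU
    rintro _ ⟨z, rfl⟩
    exact Submodule.starProjection_apply_mem _ z
  have hRle : singularValue T (2 * n) ≤ ‖R‖ₑ := by
    have h1 : T - (Q * T + (1 - Q) * T * P) = R := by rw [hR]; noncomm_ring
    rw [← h1]
    refine iInf₂_le _ ?_
    have h2 : ((Q * T + (1 - Q) * T * P : H →L[ℂ] H) : H →ₗ[ℂ] H) =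
        (Q : H →ₗ[ℂ] H).comp (T : H →ₗ[ℂ] H) +
          (((1 - Q) * T : H →L[ℂ] H) : H →ₗ[ℂ] H).comp (P : H →ₗ[ℂ] H) := by
      ext z; simp
    rw [h2]
    refine (LinearMap.rank_add_le _ _).trans ?_
    refine (add_le_add ((LinearMap.rank_comp_le_left _ _).trans (hrank W hWr))
      ((LinearMap.rank_comp_le_right _ _).trans (hrank V hVr))).trans ?_
    push_cast
    rw [two_mul]
  have hRpos : 0 < ‖R‖ := by
    rw [norm_pos_iff]
    rintro h0
    have h0' : ‖R‖ₑ = 0 := by rw [← ofReal_norm, h0, norm_zero, ENNReal.ofReal_zero]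
    exact hs (le_antisymm (h0' ▸ hRle) bot_le)
  obtain ⟨x, hx1, hx2⟩ := R.exists_lt_apply_of_lt_opNorm (half_lt_self hRpos)
  have hRx : 0 < ‖R x‖ := (half_pos hRpos).trans hx2
  set x' := x - P x with hx'
  have hRx' : R x = T x' - Q (T x') := by simp [hR, hx']
  have hx'pos : 0 < ‖x'‖ := by
    rw [norm_pos_iff]
    intro h0
    rw [hRx', h0] at hRx
    simp at hRx
  have hx'le : ‖x'‖ ≤ ‖x‖ := by
    have := Submodule.norm_sq_eq_add_norm_sq_starProjection x V
    have h3 : Vᗮ.starProjection x = x' := by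
      rw [Submodule.starProjection_orthogonal_val]
    rw [h3] at this
    nlinarith [norm_nonneg x, norm_nonneg x', sq_nonneg ‖V.starProjection x‖]
  refine ⟨((‖x'‖⁻¹ : ℝ) : ℂ) • x', ((‖R x‖⁻¹ : ℝ) : ℂ) • R x, ?_, ?_, ?_, ?_, ?_⟩
  · rw [norm_smul]; simp [hx'pos.ne']
  · rw [norm_smul]; simp [hRx.ne']
  · intro i hi
    rw [inner_smul_right]
    have : x' ∈ Vᗮ := Submodule.sub_starProjection_mem_orthogonal x
    rw [(Submodule.mem_orthogonal V x').1 this (e i) (Submodule.subset_span (by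
      simpa using ⟨i, hi, rfl⟩)), mul_zero]
  · intro i hi
    rw [inner_smul_right]
    have : R x ∈ Wᗮ := by rw [hRx']; exact Submodule.sub_starProjection_mem_orthogonal _
    rw [(Submodule.mem_orthogonal W _).1 this (f i) (Submodule.subset_span (by
      simpa using ⟨i, hi, rfl⟩)), mul_zero]
  · have h4 : inner ℂ (R x) (T x') = ((‖R x‖ ^ 2 : ℝ) : ℂ) := by
      have : R x ∈ Wᗮ := by rw [hRx']; exact Submodule.sub_starProjection_mem_orthogonal _
      have h5 : inner ℂ (R x) (Q (T x')) = 0 :=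
        (Submodule.mem_orthogonal' W _).1 this _ (Submodule.starProjection_apply_mem _ _)
      have h6 : T x' = R x + Q (T x') := by rw [hRx']; abel
      rw [h6, inner_add_right, h5, add_zero, inner_self_eq_norm_sq_to_K]
      simp
    refine hRle.trans ?_
    rw [map_smul, inner_smul_left, inner_smul_right, h4, ← ofReal_norm, ← ofReal_norm,
      show (2 : ℝ≥0∞) = ENNReal.ofReal 2 by simp, ← ENNReal.ofReal_mul (by norm_num)]
    refine ENNReal.ofReal_le_ofReal ?_
    simp only [norm_mul, Complex.norm_real, Complex.conj_ofReal, norm_inv, norm_pow, norm_norm]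
    have h7 : ‖R x‖⁻¹ * (‖x'‖⁻¹ * ‖R x‖ ^ 2) = ‖R x‖ / ‖x'‖ := by field_simp
    rw [h7, ← mul_div_assoc, le_div_iff₀ hx'pos]
    nlinarith

lemma exists_orthonormal_sum_singularValue_le (T : H →L[ℂ] H) (n : ℕ) :
    (∀ k < n, singularValue T (2 * k) ≠ 0) →
    ∃ e f : ℕ → H, Orthonormal ℂ (fun i : Fin n => e i) ∧ Orthonormal ℂ (fun i : Fin n => f i) ∧
      ∀ k < n, singularValue T (2 * k) ≤ 2 * ‖inner ℂ (f k) (T (e k))‖ₑ := by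
  induction n with
  | zero =>
    intro _
    exact ⟨0, 0, by simp [Orthonormal, Subsingleton.pairwise],
      by simp [Orthonormal, Subsingleton.pairwise], by simp⟩
  | succ n ih =>
    intro h
    obtain ⟨e, f, he, hf, hef⟩ := ih fun k hk => h k (by omega)
    obtain ⟨x, y, hx, hy, hex, hfy, hxy⟩ :=
      exists_next_pair T (e := e) (f := f) (h n (by omega))
    refine ⟨Function.update e n x, Function.update f n y, orthonormal_update he hx hex,
      orthonormal_update hf hy hfy, fun k hk => ?_⟩
    rcases Nat.lt_succ_iff_lt_or_eq.1 hk with hk | rfl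
    · rw [Function.update_of_ne hk.ne, Function.update_of_ne hk.ne]
      exact hef k hk
    · rw [Function.update_self, Function.update_self]
      exact hxy

lemma HasNuclearBound.sum_singularValue_le {T : H →L[ℂ] H} {M : ℝ≥0∞} (h : HasNuclearBound T M)
    (n : ℕ) : ∑ k ∈ Finset.range n, singularValue T (2 * k) ≤ 2 * M := by
  induction n with
  | zero => simp
  | succ n ih =>
    by_cases h0 : singularValue T (2 * n) = 0
    · rwa [Finset.sum_range_succ, h0, add_zero]
    · obtain ⟨e, f, he, hf, hef⟩ := exists_orthonormal_sum_singularValue_le T (n + 1)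
        (fun k hk hk0 => h0 (le_antisymm
          (hk0 ▸ singularValue_antitone T (by omega : 2 * k ≤ 2 * n)) bot_le))
      calc _ ≤ ∑ k ∈ Finset.range (n + 1), 2 * ‖inner ℂ (f k) (T (e k))‖ₑ :=
            Finset.sum_le_sum fun k hk => hef k (Finset.mem_range.1 hk)
        _ ≤ 2 * M := by
            rw [← Finset.mul_sum]
            gcongr
            exact h _ e f he hf

/-- The greedy choice controls the singular values of even index up to a factor `2`; those of odd
index are dominated by the preceding ones. -/
lemma HasNuclearBound.traceNorm_le {T : H →L[ℂ] H} {M : ℝ≥0∞} (h : HasNuclearBound T M) :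
    traceNorm T ≤ 4 * M := by
  have h1 : traceNorm T = (∑' k : ℕ, singularValue T (2 * k)) +
      ∑' k : ℕ, singularValue T (2 * k + 1) :=
    (tsum_even_add_odd ENNReal.summable ENNReal.summable).symm
  have h2 : ∑' k : ℕ, singularValue T (2 * k) ≤ 2 * M :=
    ENNReal.tsum_le_of_sum_range_le h.sum_singularValue_le
  have h3 : ∑' k : ℕ, singularValue T (2 * k + 1) ≤ 2 * M :=
    (ENNReal.tsum_le_tsum fun k => singularValue_antitone T (by omega)).trans h2
  rw [h1]
  calc _ ≤ 2 * M + 2 * M := add_le_add h2 h3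
    _ = 4 * M := by ring

lemma isCompactOperator_of_rank_le (F : H →L[ℂ] H) (k : ℕ)
    (hF : LinearMap.rank (F : H →ₗ[ℂ] H) ≤ k) : IsCompactOperator F := by
  have hfin : FiniteDimensional ℂ (LinearMap.range (F : H →ₗ[ℂ] H)) :=
    Module.rank_lt_aleph0_iff.1 (hF.trans_lt (Cardinal.natCast_lt_aleph0))
  have h1 : IsCompactOperator (_root_.id : LinearMap.range (F : H →ₗ[ℂ] H) → _) :=
    (isCompactOperator_id_iff_finiteDimensional (𝕜 := ℂ)).2 hfin
  exact (h1.comp_clm (F.codRestrict (LinearMap.range (F : H →ₗ[ℂ] H))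
    fun x => ⟨x, rfl⟩)).clm_comp (LinearMap.range (F : H →ₗ[ℂ] H)).subtypeL

/-- Summability of the singular values implies compactness: `T` is a norm limit of operators of
finite rank. -/
lemma isTraceClass_of_traceNorm_lt_top [CompleteSpace H] {T : H →L[ℂ] H} (h : traceNorm T < ⊤) :
    IsTraceClass T := by
  refine ⟨?_, h⟩
  have hlim : Tendsto (singularValue T) atTop (𝓝 0) :=
    ENNReal.tendsto_atTop_zero_of_tsum_ne_top h.ne
  have hmem : T ∈ closure {F : H →L[ℂ] H | IsCompactOperator F} := by
    rw [EMetric.mem_closure_iff]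
    intro ε hε
    obtain ⟨k, hk⟩ := (hlim.eventually (gt_mem_nhds hε)).exists
    obtain ⟨F, hF⟩ := iInf_lt_iff.1 hk
    obtain ⟨hF1, hF2⟩ := iInf_lt_iff.1 hF
    exact ⟨F, isCompactOperator_of_rank_le F k hF1, by rwa [edist_eq_enorm_sub]⟩
  have := (isClosed_setOfPred_isCompactOperator (σ₁₂ := RingHom.id ℂ) (M₁ := H) (M₂ := H)).closure_eq
  rw [this] at hmem
  exact hmem

end NuclearBound

/-! ### Integral operators with separated kernels -/

section KernelOperator

/-- The nuclear bound of an operator of rank one, by the inequalities of Cauchy–Schwarz and Bessel. -/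
lemma sum_norm_inner_mul_norm_inner_le {H : Type*} [NormedAddCommGroup H] [InnerProductSpace ℂ H]
    {n : ℕ} {e f : ℕ → H} (he : Orthonormal ℂ (fun i : Fin n => e i))
    (hf : Orthonormal ℂ (fun i : Fin n => f i)) (x y : H) :
    ∑ l ∈ Finset.range n, ‖inner ℂ (f l) x‖ * ‖inner ℂ y (e l)‖ ≤ ‖x‖ * ‖y‖ := by
  rw [Finset.sum_range]
  refine (Real.sum_mul_le_sqrt_mul_sqrt _ _ _).trans ?_
  refine mul_le_mul ?_ ?_ (Real.sqrt_nonneg _) (norm_nonneg _)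
  · exact Real.sqrt_le_iff.2 ⟨norm_nonneg _, hf.sum_inner_products_le x⟩
  · refine Real.sqrt_le_iff.2 ⟨norm_nonneg _, ?_⟩
    simpa only [norm_inner_symm] using he.sum_inner_products_le y (s := Finset.univ)

variable {S X : Type*} [MeasurableSpace S] [MeasurableSpace X] {μ : Measure S}
  {ν : Measure X}

lemma integrable_mul_mul_of_norm_le_one {g : X → ℂ} {c : S → ℂ} {A : S → X → ℂ}
    (hg : Integrable g ν) (hc : Integrable c μ) (hA : Measurable (Function.uncurry A))
    (hA1 : ∀ s x, ‖A s x‖ ≤ 1) :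
    Integrable (fun z : S × X => A z.1 z.2 * (c z.1 * g z.2)) (μ.prod ν) :=
  (hc.mul_prod hg).bdd_mul (c := 1) hA.aestronglyMeasurable (ae_of_all _ fun z => hA1 z.1 z.2)

variable [SFinite μ] [SFinite ν]

lemma integral_mul_integral_swap {g : X → ℂ} {c : S → ℂ} {A : S → X → ℂ}
    (hg : Integrable g ν) (hc : Integrable c μ) (hA : Measurable (Function.uncurry A))
    (hA1 : ∀ s x, ‖A s x‖ ≤ 1) :
    ∫ x, (∫ s, c s * A s x ∂μ) * g x ∂ν = ∫ s, c s * ∫ x, A s x * g x ∂ν ∂μ := by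
  simp_rw [← integral_mul_const, ← integral_const_mul]
  rw [integral_integral_swap]
  · refine integral_congr_ae (ae_of_all _ fun s => integral_congr_ae (ae_of_all _ fun x => ?_))
    simp only []
    ring
  · refine (integrable_mul_mul_of_norm_le_one hg hc hA hA1).swap.congr (ae_of_all _ fun z => ?_)
    simp only [Function.comp_apply, Prod.fst_swap, Prod.snd_swap, Function.uncurry]
    ring

/-- The integral operator with kernel `p(x) q(y) ∫ c(s) A(s, x) B(s, y) dμ(s)`. It is a
superposition of operators of rank one with norms at most `|c(s)| ‖p‖ ‖q‖`, whence its nuclear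
bound. -/
theorem exists_kernelOp {p q : X → ℂ} (hp : MemLp p 2 ν) (hq : MemLp q 2 ν) {c : S → ℂ}
    (hc : Integrable c μ) {A B : S → X → ℂ} (hA : Measurable (Function.uncurry A))
    (hB : Measurable (Function.uncurry B)) (hA1 : ∀ s x, ‖A s x‖ ≤ 1) (hB1 : ∀ s x, ‖B s x‖ ≤ 1) :
    ∃ T : Lp ℂ 2 ν →L[ℂ] Lp ℂ 2 ν,
      (∀ u : Lp ℂ 2 ν, ∀ᵐ x ∂ν,
        T u x = p x * ∫ y, (∫ s, c s * A s x * B s y ∂μ) * (q y * u y) ∂ν) ∧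
      HasNuclearBound T ((∫⁻ s, ‖c s‖ₑ ∂μ) * eLpNorm p 2 ν * eLpNorm q 2 ν) := by
  set V : (X → ℂ) → X → ℂ := fun g x => ∫ y, (∫ s, c s * A s x * B s y ∂μ) * g y ∂ν with hV
  have hcA : ∀ x, Integrable (fun s => c s * A s x) μ := fun x =>
    hc.mul_bdd (c := 1) (hA.comp (measurable_id.prodMk measurable_const)).aestronglyMeasurable
      (ae_of_all _ fun s => hA1 s x)
  -- the inner integrals `∫ B(s, y) g(y) dy`
  have hE_meas : ∀ {A : S → X → ℂ}, Measurable (Function.uncurry A) → ∀ {g : X → ℂ},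
      Integrable g ν → AEStronglyMeasurable (fun s => ∫ y, A s y * g y ∂ν) μ := by
    intro A hA g hg
    have : AEStronglyMeasurable (fun z : S × X => A z.1 z.2 * g z.2) (μ.prod ν) :=
      hA.aestronglyMeasurable.mul hg.aestronglyMeasurable.comp_snd
    exact this.integral_prod_right'
  have hE_le : ∀ {A : S → X → ℂ}, (∀ s x, ‖A s x‖ ≤ 1) → ∀ {g : X → ℂ}, Integrable g ν → ∀ s,
      ‖∫ y, A s y * g y ∂ν‖ ≤ ∫ y, ‖g y‖ ∂ν := by
    intro A hA1 g hg s
    refine norm_integral_le_of_norm_le hg.norm (ae_of_all _ fun y => ?_)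
    rw [norm_mul]
    exact mul_le_of_le_one_left (norm_nonneg _) (hA1 s y)
  have hV_eq : ∀ {g : X → ℂ}, Integrable g ν → ∀ x,
      V g x = ∫ s, (c s * ∫ y, B s y * g y ∂ν) * A s x ∂μ := by
    intro g hg x
    rw [hV]
    simp only []
    rw [integral_mul_integral_swap hg (hcA x) hB hB1]
    refine integral_congr_ae (ae_of_all _ fun s => ?_)
    simp only []
    ring
  have hcE : ∀ {g : X → ℂ}, Integrable g ν →
      Integrable (fun s => c s * ∫ y, B s y * g y ∂ν) μ := fun hg =>
    hc.mul_bdd (hE_meas hB hg) (ae_of_all _ (hE_le hB1 hg))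
  have hV_meas : ∀ {g : X → ℂ}, Integrable g ν → AEStronglyMeasurable (V g) ν := by
    intro g hg
    rw [funext (hV_eq hg)]
    have : AEStronglyMeasurable (fun z : X × S => (c z.2 * ∫ y, B z.2 y * g y ∂ν) * A z.2 z.1)
        (ν.prod μ) :=
      (hcE hg).aestronglyMeasurable.comp_snd.mul
        (hA.comp measurable_swap).aestronglyMeasurable
    exact this.integral_prod_right'
  have hV_le : ∀ {g : X → ℂ}, Integrable g ν → ∀ x,
      ‖V g x‖ ≤ (∫ s, ‖c s‖ ∂μ) * ∫ y, ‖g y‖ ∂ν := by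
    intro g hg x
    rw [hV_eq hg, ← integral_mul_const]
    refine norm_integral_le_of_norm_le (hc.norm.mul_const _) (ae_of_all _ fun s => ?_)
    rw [norm_mul, norm_mul]
    exact (mul_le_of_le_one_right (by positivity) (hA1 s x)).trans
      (mul_le_mul_of_nonneg_left (hE_le hB1 hg s) (norm_nonneg _))
  have hqu : ∀ u : Lp ℂ 2 ν, Integrable (fun y => q y * u y) ν := fun u =>
    hq.integrable_mul (Lp.memLp u)
  have hqu_le : ∀ u : Lp ℂ 2 ν, ∫ y, ‖q y * u y‖ ∂ν ≤ (eLpNorm q 2 ν).toReal * ‖u‖ := by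
    intro u
    rw [Lp.norm_def, ← ENNReal.toReal_mul, integral_norm_eq_lintegral_enorm
      (hqu u).aestronglyMeasurable, ← eLpNorm_one_eq_lintegral_enorm]
    refine ENNReal.toReal_mono (ENNReal.mul_ne_top hq.2.ne (Lp.memLp u).2.ne) ?_
    have := eLpNorm_smul_le_mul_eLpNorm (p := 2) (q := 2) (r := 1)
      (Lp.memLp u).aestronglyMeasurable hq.aestronglyMeasurable
    simpa only [Pi.smul_apply', smul_eq_mul] using! this
  have hmem : ∀ u : Lp ℂ 2 ν, MemLp (fun x => p x * V (fun y => q y * u y) x) 2 ν := by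
    intro u
    refine hp.of_le_mul (c := (∫ s, ‖c s‖ ∂μ) * ∫ y, ‖q y * u y‖ ∂ν)
      (hp.aestronglyMeasurable.mul (hV_meas (hqu u))) (ae_of_all _ fun x => ?_)
    rw [norm_mul, mul_comm]
    exact mul_le_mul_of_nonneg_right (hV_le (hqu u) x) (norm_nonneg _)
  have hV_add : ∀ {g g' : X → ℂ}, Integrable g ν → Integrable g' ν → ∀ x,
      V (fun y => g y + g' y) x = V g x + V g' x := by
    intro g g' hg hg' x
    have hbdd : ∀ {g : X → ℂ}, Integrable g ν →
        Integrable (fun y => (∫ s, c s * A s x * B s y ∂μ) * g y) ν := by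
      intro g hg
      refine hg.bdd_mul (c := ∫ s, ‖c s‖ ∂μ) ?_ (ae_of_all _ fun y => ?_)
      · have : AEStronglyMeasurable (fun z : X × S => c z.2 * A z.2 x * B z.2 z.1) (ν.prod μ) :=
          (hcA x).aestronglyMeasurable.comp_snd.mul (hB.comp measurable_swap).aestronglyMeasurable
        exact this.integral_prod_right'
      · refine norm_integral_le_of_norm_le hc.norm (ae_of_all _ fun s => ?_)
        rw [norm_mul, norm_mul]
        exact (mul_le_of_le_one_right (by positivity) (hB1 s y)).trans
          (mul_le_of_le_one_right (norm_nonneg _) (hA1 s x))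
    simp only [hV, mul_add]
    exact integral_add (hbdd hg) (hbdd hg')
  have hV_smul : ∀ (a : ℂ) (g : X → ℂ) x, V (fun y => a * g y) x = a * V g x := by
    intro a g x
    simp only [hV]
    rw [← integral_const_mul]
    refine integral_congr_ae (ae_of_all _ fun y => ?_)
    simp only []
    ring
  have hV_congr : ∀ {g g' : X → ℂ}, g =ᵐ[ν] g' → ∀ x, V g x = V g' x := by
    intro g g' h x
    refine integral_congr_ae ?_
    filter_upwards [h] with y hy
    rw [hy]
  let T₀ : Lp ℂ 2 ν →ₗ[ℂ] Lp ℂ 2 ν :=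
    { toFun := fun u => (hmem u).toLp _
      map_add' := by
        intro u v
        rw [← MemLp.toLp_add, MemLp.toLp_eq_toLp_iff]
        refine ae_of_all _ fun x => ?_
        simp only [Pi.add_apply]
        rw [← mul_add, ← hV_add (hqu u) (hqu v)]
        congr 1
        refine hV_congr ?_ x
        filter_upwards [Lp.coeFn_add u v] with y hy
        rw [hy, Pi.add_apply, mul_add]
      map_smul' := by
        intro a u
        rw [RingHom.id_apply, ← MemLp.toLp_const_smul, MemLp.toLp_eq_toLp_iff]
        refine ae_of_all _ fun x => ?_
        simp only [Pi.smul_apply, smul_eq_mul]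
        rw [mul_left_comm a, ← hV_smul a]
        congr 1
        refine hV_congr ?_ x
        filter_upwards [Lp.coeFn_smul a u] with y hy
        rw [hy, Pi.smul_apply, smul_eq_mul, mul_left_comm] }
  have hT₀ : ∀ u, T₀ u =ᵐ[ν] fun x => p x * V (fun y => q y * u y) x := fun u =>
    (hmem u).coeFn_toLp
  let T : Lp ℂ 2 ν →L[ℂ] Lp ℂ 2 ν := T₀.mkContinuous
    ((∫ s, ‖c s‖ ∂μ) * (eLpNorm q 2 ν).toReal * ‖hp.toLp p‖) (by
      intro u
      have h1 : ‖T₀ u‖ ≤ ((∫ s, ‖c s‖ ∂μ) * ∫ y, ‖q y * u y‖ ∂ν) * ‖hp.toLp p‖ := by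
        refine Lp.norm_le_mul_norm_of_ae_le_mul ?_
        filter_upwards [hT₀ u, hp.coeFn_toLp] with x hx hx'
        rw [hx, hx', norm_mul, mul_comm]
        exact mul_le_mul_of_nonneg_right (hV_le (hqu u) x) (norm_nonneg _)
      refine h1.trans ?_
      have h2 : 0 ≤ ∫ s, ‖c s‖ ∂μ := integral_nonneg fun _ => norm_nonneg _
      calc _ ≤ ((∫ s, ‖c s‖ ∂μ) * ((eLpNorm q 2 ν).toReal * ‖u‖)) * ‖hp.toLp p‖ := by
            gcongr
            exact hqu_le u
        _ = _ := by ring)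
  refine ⟨T, fun u => hT₀ u, ?_⟩
  intro n e f he hf
  have hfp : ∀ l, Integrable (fun x => (starRingEnd ℂ) (f l x) * p x) ν := fun l =>
    (Lp.memLp (f l)).star.integrable_mul hp
  have hinner : ∀ l, inner ℂ (f l) (T (e l)) =
      ∫ s, (c s * ∫ y, B s y * (q y * e l y) ∂ν) *
        ∫ x, A s x * ((starRingEnd ℂ) (f l x) * p x) ∂ν ∂μ := by
    intro l
    rw [← integral_mul_integral_swap (hfp l) (hcE (hqu (e l))) hA hA1, L2.inner_def]
    refine integral_congr_ae ?_
    filter_upwards [hT₀ (e l)] with x hx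
    have hx' : (T (e l)) x = p x * V (fun y => q y * e l y) x := hx
    rw [hx', hV_eq (hqu _), RCLike.inner_apply']
    ring
  have hmeas : ∀ l, AEStronglyMeasurable (fun s => (c s * ∫ y, B s y * (q y * e l y) ∂ν) *
        ∫ x, A s x * ((starRingEnd ℂ) (f l x) * p x) ∂ν) μ := fun l =>
    (hcE (hqu (e l))).aestronglyMeasurable.mul (hE_meas hA (hfp l))
  have hAp : ∀ s, MemLp (fun x => A s x * p x) 2 ν := fun s =>
    hp.of_le_mul (c := 1) ((hA.comp (measurable_const.prodMk
      measurable_id)).aestronglyMeasurable.mul hp.aestronglyMeasurable)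
      (ae_of_all _ fun x => by
        rw [norm_mul]; exact mul_le_mul_of_nonneg_right (hA1 s x) (norm_nonneg _))
  have hBq' : ∀ s, MemLp (fun x => B s x * q x) 2 ν := fun s =>
    hq.of_le_mul (c := 1) ((hB.comp (measurable_const.prodMk
      measurable_id)).aestronglyMeasurable.mul hq.aestronglyMeasurable)
      (ae_of_all _ fun x => by
        rw [norm_mul]; exact mul_le_mul_of_nonneg_right (hB1 s x) (norm_nonneg _))
  have hBq : ∀ s, MemLp (fun x => (starRingEnd ℂ) (B s x * q x)) 2 ν := fun s => (hBq' s).star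
  have hAp_le : ∀ s, ‖(hAp s).toLp _‖ ≤ (eLpNorm p 2 ν).toReal := by
    intro s
    rw [Lp.norm_toLp]
    refine ENNReal.toReal_mono hp.2.ne (eLpNorm_mono fun x => ?_)
    rw [norm_mul]; exact mul_le_of_le_one_left (norm_nonneg _) (hA1 s x)
  have hBq_le : ∀ s, ‖(hBq s).toLp _‖ ≤ (eLpNorm q 2 ν).toReal := by
    intro s
    rw [Lp.norm_toLp]
    refine ENNReal.toReal_mono hq.2.ne (eLpNorm_mono fun x => ?_)
    rw [RCLike.norm_conj, norm_mul]; exact mul_le_of_le_one_left (norm_nonneg _) (hB1 s x)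
  have hF : ∀ l s, ∫ x, A s x * ((starRingEnd ℂ) (f l x) * p x) ∂ν =
      inner ℂ (f l) ((hAp s).toLp _) := by
    intro l s
    rw [L2.inner_def]
    refine integral_congr_ae ?_
    filter_upwards [(hAp s).coeFn_toLp] with x hx
    rw [hx, RCLike.inner_apply']
    ring
  have hE : ∀ l s, ∫ y, B s y * (q y * e l y) ∂ν = inner ℂ ((hBq s).toLp _) (e l) := by
    intro l s
    rw [L2.inner_def]
    refine integral_congr_ae ?_
    filter_upwards [(hBq s).coeFn_toLp] with x hx
    rw [hx, RCLike.inner_apply', Complex.conj_conj]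
    ring
  have hpt : ∀ s, ∑ l ∈ Finset.range n, ‖(c s * ∫ y, B s y * (q y * e l y) ∂ν) *
        ∫ x, A s x * ((starRingEnd ℂ) (f l x) * p x) ∂ν‖ₑ ≤
        ‖c s‖ₑ * (eLpNorm p 2 ν * eLpNorm q 2 ν) := by
    intro s
    have h1 : ∑ l ∈ Finset.range n, ‖(c s * ∫ y, B s y * (q y * e l y) ∂ν) *
        ∫ x, A s x * ((starRingEnd ℂ) (f l x) * p x) ∂ν‖ ≤
        ‖c s‖ * ((eLpNorm p 2 ν).toReal * (eLpNorm q 2 ν).toReal) := by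
      simp_rw [hF, hE, norm_mul]
      calc _ = ‖c s‖ * ∑ l ∈ Finset.range n, ‖inner ℂ (f l) ((hAp s).toLp _)‖ *
            ‖inner ℂ ((hBq s).toLp _) (e l)‖ := by
            rw [Finset.mul_sum]
            exact Finset.sum_congr rfl fun l _ => by ring
        _ ≤ ‖c s‖ * (‖(hAp s).toLp _‖ * ‖(hBq s).toLp _‖) := by
            gcongr
            exact sum_norm_inner_mul_norm_inner_le he hf _ _
        _ ≤ _ := by
            gcongr
            · exact hAp_le s
            · exact hBq_le s
    simp_rw [← ofReal_norm]
    rw [← ENNReal.ofReal_sum_of_nonneg fun _ _ => norm_nonneg _]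
    refine (ENNReal.ofReal_le_ofReal h1).trans ?_
    rw [ENNReal.ofReal_mul (norm_nonneg _), ENNReal.ofReal_mul ENNReal.toReal_nonneg,
      ENNReal.ofReal_toReal hp.2.ne, ENNReal.ofReal_toReal hq.2.ne]
  calc ∑ l ∈ Finset.range n, ‖inner ℂ (f l) (T (e l))‖ₑ
      ≤ ∑ l ∈ Finset.range n, ∫⁻ s, ‖(c s * ∫ y, B s y * (q y * e l y) ∂ν) *
        ∫ x, A s x * ((starRingEnd ℂ) (f l x) * p x) ∂ν‖ₑ ∂μ := by
        refine Finset.sum_le_sum fun l _ => ?_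
        rw [hinner]
        exact enorm_integral_le_lintegral_enorm _
    _ = ∫⁻ s, ∑ l ∈ Finset.range n, ‖(c s * ∫ y, B s y * (q y * e l y) ∂ν) *
        ∫ x, A s x * ((starRingEnd ℂ) (f l x) * p x) ∂ν‖ₑ ∂μ :=
        (lintegral_finsetSum' _ fun l _ => (hmeas l).enorm).symm
    _ ≤ ∫⁻ s, ‖c s‖ₑ * (eLpNorm p 2 ν * eLpNorm q 2 ν) ∂μ := lintegral_mono hpt
    _ = _ := by
        rw [lintegral_mul_const'' _ hc.aestronglyMeasurable.enorm, mul_assoc]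

end KernelOperator

/-! ### Localized Fourier expansion -/

section Fourier

open FourierTransform

variable {d : ℕ}

/-- A smooth compactly supported function has an integrable Fourier transform, controlled by the
`L¹` norms of its derivatives of order up to `d + 1`. -/
lemma exists_lintegral_fourier_le (d : ℕ) : ∃ C : ℝ, 0 ≤ C ∧
    ∀ {F : Type} [NormedAddCommGroup F] [NormedSpace ℂ F] [CompleteSpace F] (f : E d → F),
      ContDiff ℝ ∞ f → HasCompactSupport f → Integrable (𝓕 f) ∧
        ∫⁻ θ, ‖𝓕 f θ‖ₑ ≤ ENNReal.ofReal C *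
          ∑ k ∈ Finset.range (d + 2), ∫⁻ w, ‖iteratedFDeriv ℝ k f w‖ₑ := by
  have hJ : Integrable (fun θ : E d => (1 + ‖θ‖) ^ (-((d : ℝ) + 1))) :=
    integrable_one_add_norm (by simp)
  refine ⟨2 ^ (2 * d + 2) * ∫ θ : E d, (1 + ‖θ‖) ^ (-((d : ℝ) + 1)),
    mul_nonneg (by positivity) (integral_nonneg fun θ => by positivity), ?_⟩
  intro F _ _ _ f hf hfc
  have hint : ∀ n : ℕ, Integrable (iteratedFDeriv ℝ n f) := fun n =>
    (hf.continuous_iteratedFDeriv (by exact_mod_cast le_top)).integrable_of_hasCompactSupport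
      (hfc.iteratedFDeriv n)
  set S : ℝ := ∑ k ∈ Finset.range (d + 2), ∫ w, ‖iteratedFDeriv ℝ k f w‖ with hS
  have hS0 : 0 ≤ S := Finset.sum_nonneg fun k _ => integral_nonneg fun _ => norm_nonneg _
  have hpow : ∀ n ≤ d + 1, ∀ θ, ‖θ‖ ^ n * ‖𝓕 f θ‖ ≤ 2 ^ n * S := by
    intro n hn θ
    have := Real.pow_mul_norm_iteratedFDeriv_fourier_le (K := 0) (N := ⊤) hf
      (fun k n hk _ => by
        have hk0 : k = 0 := by simpa using hk
        subst hk0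
        simpa using (hint n).norm) (k := 0) (n := n) le_rfl le_top θ
    rw [norm_iteratedFDeriv_zero] at this
    refine this.trans ?_
    simp only [pow_zero, one_mul, Nat.cast_zero, mul_zero, zero_add]
    gcongr
    rw [Finset.range_one, Finset.singleton_product, Finset.sum_map]
    simp only [Function.Embedding.coeFn_mk, pow_zero, one_mul]
    exact Finset.sum_le_sum_of_subset_of_nonneg (Finset.range_mono (by omega))
      fun k _ _ => integral_nonneg fun _ => norm_nonneg _
  have hbd : ∀ θ, ‖𝓕 f θ‖ ≤ 2 ^ (2 * d + 2) * S * (1 + ‖θ‖) ^ (-((d : ℝ) + 1)) := by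
    intro θ
    have hpos : (0 : ℝ) < 1 + ‖θ‖ := by positivity
    have h1 : (1 + ‖θ‖) ^ (-((d : ℝ) + 1)) = ((1 + ‖θ‖) ^ (d + 1))⁻¹ := by
      rw [Real.rpow_neg hpos.le, ← Real.rpow_natCast]; norm_cast
    rw [h1, ← div_eq_mul_inv, le_div_iff₀ (by positivity)]
    have h2 : (1 + ‖θ‖) ^ (d + 1) ≤ 2 ^ d * (1 + ‖θ‖ ^ (d + 1)) := by
      simpa using add_pow_le zero_le_one (norm_nonneg θ) (d + 1)
    calc ‖𝓕 f θ‖ * (1 + ‖θ‖) ^ (d + 1) ≤ ‖𝓕 f θ‖ * (2 ^ d * (1 + ‖θ‖ ^ (d + 1))) := by gcongr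
      _ = 2 ^ d * (‖θ‖ ^ 0 * ‖𝓕 f θ‖ + ‖θ‖ ^ (d + 1) * ‖𝓕 f θ‖) := by ring
      _ ≤ 2 ^ d * (2 ^ 0 * S + 2 ^ (d + 1) * S) := by
          exact mul_le_mul_of_nonneg_left (add_le_add (hpow 0 (by omega) θ)
            (hpow (d + 1) le_rfl θ)) (by positivity)
      _ ≤ 2 ^ d * (2 ^ (d + 1) * S + 2 ^ (d + 1) * S) := by
          gcongr
          · norm_num
          · omega
      _ = 2 ^ (2 * d + 2) * S := by ring
  have hcont : Continuous (𝓕 f) := by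
    have h0 : Integrable f := hf.continuous.integrable_of_hasCompactSupport hfc
    exact VectorFourier.fourierIntegral_continuous Real.continuous_fourierChar
      (by exact continuous_inner) h0
  refine ⟨(hJ.const_mul (2 ^ (2 * d + 2) * S)).mono' hcont.aestronglyMeasurable
    (ae_of_all _ hbd), ?_⟩
  have hSe : ENNReal.ofReal S =
      ∑ k ∈ Finset.range (d + 2), ∫⁻ w, ‖iteratedFDeriv ℝ k f w‖ₑ := by
    rw [hS, ENNReal.ofReal_sum_of_nonneg fun k _ => integral_nonneg fun _ => norm_nonneg _]
    exact Finset.sum_congr rfl fun k _ => ofReal_integral_norm_eq_lintegral_enorm (hint k)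
  rw [← hSe, ← ENNReal.ofReal_mul (mul_nonneg (by positivity)
    (integral_nonneg fun θ => by positivity))]
  calc ∫⁻ θ, ‖𝓕 f θ‖ₑ
      ≤ ∫⁻ θ, ENNReal.ofReal (2 ^ (2 * d + 2) * S * (1 + ‖θ‖) ^ (-((d : ℝ) + 1))) := by
        refine lintegral_mono fun θ => ?_
        rw [← ofReal_norm]
        exact ENNReal.ofReal_le_ofReal (hbd θ)
    _ = ENNReal.ofReal (∫ θ, 2 ^ (2 * d + 2) * S * (1 + ‖θ‖) ^ (-((d : ℝ) + 1))) :=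
        (ofReal_integral_eq_lintegral_ofReal (hJ.const_mul _)
          (ae_of_all _ fun θ => by positivity)).symm
    _ = _ := by
        rw [integral_const_mul]
        congr 1
        ring

/-- The reference bump function: `1` on the unit ball, `0` outside the ball of radius `2`. -/
noncomputable def baseBump (d : ℕ) : ContDiffBump (0 : E d) := ⟨1, 2, one_pos, one_lt_two⟩

/-- The bump function at scale `r`, centred at `s`. -/
noncomputable def cutoff (r : ℝ) (s w : E d) : ℝ := baseBump d (r⁻¹ • (w - s))

lemma contDiff_cutoff (r : ℝ) (s : E d) : ContDiff ℝ ∞ (cutoff r s) := by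
  unfold cutoff
  exact (baseBump d).contDiff.comp (by fun_prop)

lemma cutoff_eq_one {r : ℝ} (hr : 0 < r) {s w : E d} (hw : dist w s ≤ r) : cutoff r s w = 1 := by
  refine (baseBump d).one_of_mem_closedBall ?_
  rw [mem_closedBall_zero_iff, norm_smul, norm_inv, Real.norm_of_nonneg hr.le, ← dist_eq_norm]
  change r⁻¹ * dist w s ≤ 1
  rwa [inv_mul_le_iff₀ hr, mul_one]

lemma cutoff_eq_zero {r : ℝ} (hr : 0 < r) {s w : E d} (hw : 2 * r ≤ dist w s) :
    cutoff r s w = 0 := by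
  refine (baseBump d).zero_of_le_dist ?_
  rw [dist_zero_right, norm_smul, norm_inv, Real.norm_of_nonneg hr.le, ← dist_eq_norm]
  change 2 ≤ r⁻¹ * dist w s
  rwa [le_inv_mul_iff₀ hr, mul_comm]

lemma tsupport_cutoff_subset {r : ℝ} (hr : 0 < r) (s : E d) :
    tsupport (cutoff r s) ⊆ Metric.closedBall s (2 * r) := by
  refine closure_minimal (fun w hw => ?_) Metric.isClosed_closedBall
  by_contra h
  exact hw (cutoff_eq_zero hr (not_le.1 h).le)

lemma exists_norm_iteratedFDeriv_cutoff_le (d n : ℕ) : ∃ C : ℝ, 0 ≤ C ∧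
    ∀ k ≤ n, ∀ r : ℝ, 1 ≤ r → ∀ s w : E d, ‖iteratedFDeriv ℝ k (cutoff r s) w‖ ≤ C := by
  have h1 : ∀ k : ℕ, ∃ C : ℝ, 0 ≤ C ∧ ∀ w, ‖iteratedFDeriv ℝ k (baseBump d) w‖ ≤ C := by
    intro k
    have hc : Continuous (iteratedFDeriv ℝ k (baseBump d)) :=
      (baseBump d).contDiff (n := ⊤) |>.continuous_iteratedFDeriv (by exact_mod_cast le_top)
    obtain ⟨C, hC⟩ := hc.bounded_above_of_compact_support
      ((baseBump d).hasCompactSupport.iteratedFDeriv k)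
    exact ⟨C, (norm_nonneg _).trans (hC 0), hC⟩
  choose C hC0 hC using h1
  refine ⟨∑ k ∈ Finset.range (n + 1), C k, Finset.sum_nonneg fun k _ => hC0 k, ?_⟩
  intro k hk r hr s w
  refine le_trans ?_ (Finset.single_le_sum (fun k _ => hC0 k)
    (Finset.mem_range.2 (Nat.lt_succ_of_le hk)))
  set L : E d →L[ℝ] E d := r⁻¹ • ContinuousLinearMap.id ℝ (E d)
  have hL : ‖L‖ ≤ 1 := by
    refine L.opNorm_le_bound zero_le_one fun x => ?_
    change ‖r⁻¹ • x‖ ≤ 1 * ‖x‖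
    rw [norm_smul, norm_inv, Real.norm_of_nonneg (by linarith)]
    exact mul_le_mul_of_nonneg_right (inv_le_one_of_one_le₀ hr) (norm_nonneg _)
  have h2 : cutoff r s = fun w => ((baseBump d) ∘ L) (w - s) := by
    ext w; simp [cutoff, L]
  rw [h2, iteratedFDeriv_comp_sub, L.iteratedFDeriv_comp_right (baseBump d).contDiff _ le_rfl]
  refine (ContinuousMultilinearMap.norm_compContinuousLinearMap_le _ _).trans ?_
  refine (mul_le_of_le_one_right (norm_nonneg _) ?_).trans (hC k _)
  exact Finset.prod_le_one (fun _ _ => norm_nonneg _) fun _ _ => hL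

/-- Near the ball of radius `r`, a smooth function is a superposition of exponentials whose total
weight is controlled by the `L¹` norms of its derivatives over the ball of twice the radius. -/
lemma exists_lintegral_fourier_cutoff_le (d : ℕ) : ∃ C : ℝ, 0 ≤ C ∧
    ∀ {F : Type} [NormedAddCommGroup F] [NormedSpace ℂ F] [CompleteSpace F] (b : E d → F),
      ContDiff ℝ ∞ b → ∀ r : ℝ, 1 ≤ r → ∀ s : E d,
        Integrable (𝓕 fun w => cutoff r s w • b w) ∧
        ∫⁻ θ, ‖𝓕 (fun w => cutoff r s w • b w) θ‖ₑ ≤ ENNReal.ofReal C *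
          ∑ k ∈ Finset.range (d + 2),
            ∫⁻ w in Metric.closedBall s (2 * r), ‖iteratedFDeriv ℝ k b w‖ₑ := by
  obtain ⟨C, hC0, hC⟩ := exists_lintegral_fourier_le d
  obtain ⟨D, hD0, hD⟩ := exists_norm_iteratedFDeriv_cutoff_le d (d + 1)
  refine ⟨C * ((d + 2) * (2 ^ (d + 1) * D)), by positivity, ?_⟩
  intro F _ _ _ b hb r hr s
  have hr0 : 0 < r := by linarith
  set g : E d → F := fun w => cutoff r s w • b w with hg
  have hgs : ContDiff ℝ ∞ g := (contDiff_cutoff r s).smul hb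
  have hgt : tsupport g ⊆ Metric.closedBall s (2 * r) :=
    (tsupport_smul_subset_left _ _).trans (tsupport_cutoff_subset hr0 s)
  have hgc : HasCompactSupport g :=
    (isCompact_closedBall s (2 * r)).of_isClosed_subset (isClosed_tsupport _) hgt
  obtain ⟨h1, h2⟩ := hC g hgs hgc
  refine ⟨h1, h2.trans ?_⟩
  set I : ℕ → ℝ≥0∞ := fun k => ∫⁻ w in Metric.closedBall s (2 * r), ‖iteratedFDeriv ℝ k b w‖ₑ
  have hbm : ∀ k : ℕ, Measurable fun w => ‖iteratedFDeriv ℝ k b w‖ₑ := fun k =>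
    (hb.continuous_iteratedFDeriv (m := k) (by exact_mod_cast le_top)).enorm.measurable
  have h3 : ∀ k ∈ Finset.range (d + 2), ∫⁻ w, ‖iteratedFDeriv ℝ k g w‖ₑ ≤
      ENNReal.ofReal (2 ^ (d + 1) * D) * ∑ i ∈ Finset.range (d + 2), I i := by
    intro k hk
    rw [Finset.mem_range] at hk
    have h4 : ∀ w, ‖iteratedFDeriv ℝ k g w‖ ≤
        2 ^ (d + 1) * D * ∑ i ∈ Finset.range (d + 2), ‖iteratedFDeriv ℝ i b w‖ := by
      intro w
      refine (norm_iteratedFDeriv_smul_le (contDiff_cutoff r s) hb w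
        (n := k) (by exact_mod_cast le_top)).trans ?_
      rw [Finset.mul_sum]
      calc _ ≤ ∑ i ∈ Finset.range (k + 1), 2 ^ (d + 1) * D * ‖iteratedFDeriv ℝ (k - i) b w‖ := by
            refine Finset.sum_le_sum fun i hi => ?_
            rw [Finset.mem_range] at hi
            gcongr
            · calc (k.choose i : ℝ) ≤ 2 ^ k := by exact_mod_cast Nat.choose_le_two_pow k i
                _ ≤ 2 ^ (d + 1) := pow_le_pow_right₀ (by norm_num) (by omega)
            · exact hD i (by omega) r hr s w
        _ = ∑ i ∈ Finset.range (k + 1), 2 ^ (d + 1) * D * ‖iteratedFDeriv ℝ i b w‖ :=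
            Finset.sum_range_reflect (fun i => 2 ^ (d + 1) * D * ‖iteratedFDeriv ℝ i b w‖) (k + 1)
        _ ≤ _ := Finset.sum_le_sum_of_subset_of_nonneg (Finset.range_mono (by omega))
            fun i _ _ => by positivity
    calc ∫⁻ w, ‖iteratedFDeriv ℝ k g w‖ₑ
        = ∫⁻ w in Metric.closedBall s (2 * r), ‖iteratedFDeriv ℝ k g w‖ₑ := by
          refine (setLIntegral_eq_of_support_subset fun w hw => ?_).symm
          refine hgt (support_iteratedFDeriv_subset (𝕜 := ℝ) k ?_)
          intro h0
          exact hw (by simp [h0])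
      _ ≤ ∫⁻ w in Metric.closedBall s (2 * r), ENNReal.ofReal (2 ^ (d + 1) * D) *
          ∑ i ∈ Finset.range (d + 2), ‖iteratedFDeriv ℝ i b w‖ₑ := by
          refine lintegral_mono fun w => ?_
          rw [← ofReal_norm]
          refine (ENNReal.ofReal_le_ofReal (h4 w)).trans ?_
          rw [ENNReal.ofReal_mul (by positivity),
            ENNReal.ofReal_sum_of_nonneg fun _ _ => norm_nonneg _]
          simp_rw [ofReal_norm]
          exact le_rfl
      _ = _ := by
          rw [lintegral_const_mul _ (Finset.measurable_sum _ fun i _ => hbm i),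
            lintegral_finsetSum _ fun i _ => hbm i]
  calc _ ≤ ENNReal.ofReal C * ∑ k ∈ Finset.range (d + 2),
        (ENNReal.ofReal (2 ^ (d + 1) * D) * ∑ i ∈ Finset.range (d + 2), I i) := by
        gcongr with k hk
        exact h3 k hk
    _ = _ := by
        rw [Finset.sum_const, Finset.card_range, nsmul_eq_mul, ← mul_assoc, ← mul_assoc,
          ← ENNReal.ofReal_natCast, ← ENNReal.ofReal_mul hC0, ← ENNReal.ofReal_mul (by positivity)]
        push_cast
        congr 2
        ring

/-- Fourier inversion on the ball where the cut-off equals `1`. -/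
lemma integral_fourier_cutoff_eq {F : Type} [NormedAddCommGroup F] [NormedSpace ℂ F]
    [CompleteSpace F] {b : E d → F} (hb : ContDiff ℝ ∞ b) {r : ℝ} (hr : 1 ≤ r) {s w : E d}
    (hw : dist w s ≤ r) :
    ∫ θ, Complex.exp (((2 * Real.pi * inner ℝ θ w : ℝ) : ℂ) * Complex.I) •
      𝓕 (fun w => cutoff r s w • b w) θ = b w := by
  have hr0 : 0 < r := by linarith
  set g : E d → F := fun w => cutoff r s w • b w with hg
  have hgs : ContDiff ℝ ∞ g := (contDiff_cutoff r s).smul hb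
  have hgc : HasCompactSupport g :=
    (isCompact_closedBall s (2 * r)).of_isClosed_subset (isClosed_tsupport _)
      ((tsupport_smul_subset_left _ _).trans (tsupport_cutoff_subset hr0 s))
  obtain ⟨C, -, hC⟩ := exists_lintegral_fourier_cutoff_le d
  have h := hgs.continuous.fourierInv_fourier_eq
    (hgs.continuous.integrable_of_hasCompactSupport hgc) (hC b hb r hr s).1
  have h2 := congrFun h w
  rw [Real.fourierInv_eq'] at h2
  rw [h2, hg]
  simp [cutoff_eq_one hr0 hw]

/-- The Sobolev inequality `W^{d+1,1} ⊆ L^∞`. -/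
lemma exists_enorm_le_lintegral_iteratedFDeriv (d : ℕ) : ∃ C : ℝ, 0 ≤ C ∧
    ∀ {F : Type} [NormedAddCommGroup F] [NormedSpace ℂ F] [CompleteSpace F] (b : E d → F),
      ContDiff ℝ ∞ b → ∀ w, ‖b w‖ₑ ≤ ENNReal.ofReal C *
          ∑ k ∈ Finset.range (d + 2), ∫⁻ w, ‖iteratedFDeriv ℝ k b w‖ₑ := by
  obtain ⟨C, hC0, hC⟩ := exists_lintegral_fourier_cutoff_le d
  refine ⟨C, hC0, ?_⟩
  intro F _ _ _ b hb w
  rw [← integral_fourier_cutoff_eq hb le_rfl (s := w) (w := w) (by simp)]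
  refine (enorm_integral_le_lintegral_enorm _).trans ?_
  have h1 : ∀ θ, ‖Complex.exp (((2 * Real.pi * inner ℝ θ w : ℝ) : ℂ) * Complex.I) •
      𝓕 (fun w' => cutoff 1 w w' • b w') θ‖ₑ = ‖𝓕 (fun w' => cutoff 1 w w' • b w') θ‖ₑ := by
    intro θ
    rw [← ofReal_norm, norm_smul, Complex.norm_exp_ofReal_mul_I, one_mul, ofReal_norm]
  simp_rw [h1]
  refine ((hC b hb 1 le_rfl w).2).trans ?_
  gcongr
  exact Measure.restrict_le_self

end Fourier

/-! ### Derivatives with parameters -/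

section Parameters

variable {P V F : Type*} [NormedAddCommGroup P] [NormedSpace ℝ P] [NormedAddCommGroup V]
  [NormedSpace ℝ V] [NormedAddCommGroup F] [NormedSpace ℝ F]

lemma contDiff_iteratedFDeriv_param {f : P → V → F}
    (hf : ContDiff ℝ ∞ (fun p : P × V => f p.1 p.2)) (l : ℕ) :
    ContDiff ℝ ∞ (fun p : P × V => iteratedFDeriv ℝ l (f p.1) p.2) := by
  set g : P × V → F := fun p => f p.1 p.2 with hg
  have h1 : ∀ p : P × V, iteratedFDeriv ℝ l (f p.1) p.2 =
      (iteratedFDeriv ℝ l g p).compContinuousLinearMap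
        fun _ => ContinuousLinearMap.inr ℝ P V := by
    intro p
    have h2 : f p.1 = fun v => (g ∘ fun q => ((p.1, 0) : P × V) + q)
        (ContinuousLinearMap.inr ℝ P V v) := by
      ext v; simp [hg]
    have h3 : ContDiff ℝ ∞ (g ∘ fun q => ((p.1, 0) : P × V) + q) :=
      hf.comp (contDiff_const.add contDiff_id)
    have h4 := (ContinuousLinearMap.inr ℝ P V).iteratedFDeriv_comp_right h3 p.2 (i := l)
      (by exact_mod_cast le_top)
    rw [h2]
    refine h4.trans ?_
    rw [show (g ∘ fun q => ((p.1, 0) : P × V) + q) = fun q => g ((p.1, 0) + q) from rfl,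
      iteratedFDeriv_comp_add_left]
    simp
  simp_rw [h1]
  exact (ContinuousMultilinearMap.compContinuousLinearMapL (𝕜 := ℝ)
    (fun _ : Fin l => ContinuousLinearMap.inr ℝ P V)).contDiff.comp
    (hf.iteratedFDeriv_right (m := ∞) (by exact_mod_cast (le_top : (⊤ : ℕ∞) + l ≤ ⊤)))

end Parameters

/-! ### Growth in the mean -/

section Growth

variable {d : ℕ}

lemma setLIntegral_closedBall_comp_smul {g : E d → ℝ≥0∞} (hg : Measurable g) {σ : ℝ}
    (hσ : 0 < σ) :
    ∫⁻ ζ in Metric.closedBall (0 : E d) 1, g (σ • ζ) =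
      ENNReal.ofReal ((σ ^ d)⁻¹) * ∫⁻ ξ in Metric.closedBall (0 : E d) σ, g ξ := by
  have hmap := Measure.map_addHaar_smul (volume : Measure (E d)) hσ.ne'
  have h1 : ∫⁻ ζ, (Metric.closedBall (0 : E d) σ).indicator g (σ • ζ) =
      ENNReal.ofReal ((σ ^ d)⁻¹) * ∫⁻ ξ, (Metric.closedBall (0 : E d) σ).indicator g ξ := by
    rw [← lintegral_map (hg.indicator Metric.isClosed_closedBall.measurableSet)
      (measurable_const_smul σ), hmap, lintegral_smul_measure, abs_of_pos (by positivity),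
      finrank_euclideanSpace_fin, smul_eq_mul]
  rw [lintegral_indicator Metric.isClosed_closedBall.measurableSet] at h1
  rw [← h1, ← lintegral_indicator Metric.isClosed_closedBall.measurableSet]
  refine lintegral_congr fun ζ => ?_
  have : ζ ∈ Metric.closedBall (0 : E d) 1 ↔ σ • ζ ∈ Metric.closedBall (0 : E d) σ := by
    rw [mem_closedBall_zero_iff, mem_closedBall_zero_iff, norm_smul, Real.norm_of_nonneg hσ.le,
      mul_le_iff_le_one_right hσ]
  by_cases h : ζ ∈ Metric.closedBall (0 : E d) 1
  · rw [Set.indicator_of_mem h, Set.indicator_of_mem (this.1 h)]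
  · rw [Set.indicator_of_notMem h, Set.indicator_of_notMem (fun h' => h (this.2 h'))]

variable {F : Type*} [NormedAddCommGroup F] [NormedSpace ℝ F]

lemma enorm_smul_le_enorm_add_lintegral {f : E d → F} [CompleteSpace F] (hf : ContDiff ℝ 1 f)
    {R : ℝ} (hR : 1 ≤ R) {ζ : E d} (hζ : ‖ζ‖ ≤ 1) :
    ‖f (R • ζ)‖ₑ ≤ ‖f ζ‖ₑ + ∫⁻ σ in Set.Ioc 1 R, ‖fderiv ℝ f (σ • ζ)‖ₑ := by
  have hcont : Continuous fun σ : ℝ => fderiv ℝ f (σ • ζ) ζ :=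
    ((hf.continuous_fderiv (by norm_num)).comp (by fun_prop)).clm_apply continuous_const
  have h1 : ∫ σ in (1 : ℝ)..R, fderiv ℝ f (σ • ζ) ζ = f (R • ζ) - f ((1 : ℝ) • ζ) := by
    refine intervalIntegral.integral_eq_sub_of_hasDerivAt (f := fun σ : ℝ => f (σ • ζ))
      (fun σ _ => ?_) (hcont.intervalIntegrable _ _)
    have h2 : HasDerivAt (fun σ : ℝ => σ • ζ) ζ σ := by
      simpa using (hasDerivAt_id σ).smul_const ζ
    exact ((hf.differentiable (by norm_num) (σ • ζ)).hasFDerivAt).comp_hasDerivAt σ h2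
  rw [one_smul, intervalIntegral.integral_of_le hR] at h1
  have h3 : f (R • ζ) = f ζ + ∫ σ in Set.Ioc 1 R, fderiv ℝ f (σ • ζ) ζ := by rw [h1]; abel
  rw [h3]
  refine (enorm_add_le _ _).trans (add_le_add le_rfl ?_)
  refine (enorm_integral_le_lintegral_enorm _).trans (lintegral_mono fun σ => ?_)
  rw [← ofReal_norm, ← ofReal_norm]
  exact ENNReal.ofReal_le_ofReal ((ContinuousLinearMap.le_opNorm _ _).trans
    (mul_le_of_le_one_right (norm_nonneg _) hζ))

/-- The `L¹` norm over a large ball is controlled by that over the unit ball and by the derivative: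
integrate along rays from the unit sphere outwards. -/
lemma setLIntegral_closedBall_le_fderiv [CompleteSpace F] {f : E d → F} (hf : ContDiff ℝ 1 f)
    {R : ℝ} (hR : 1 ≤ R) :
    ∫⁻ ξ in Metric.closedBall (0 : E d) R, ‖f ξ‖ₑ ≤ ENNReal.ofReal (R ^ d) *
      ((∫⁻ ξ in Metric.closedBall (0 : E d) 1, ‖f ξ‖ₑ) +
        ENNReal.ofReal R * ∫⁻ ξ in Metric.closedBall (0 : E d) R, ‖fderiv ℝ f ξ‖ₑ) := by
  have hR0 : 0 < R := by linarith
  have hfm : Measurable fun ξ => ‖f ξ‖ₑ := hf.continuous.enorm.measurable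
  have hf'c : Continuous fun ξ => fderiv ℝ f ξ := hf.continuous_fderiv (by norm_num)
  have hf'm : Measurable fun ξ => ‖fderiv ℝ f ξ‖ₑ := hf'c.enorm.measurable
  have h1 := setLIntegral_closedBall_comp_smul hfm hR0
  have h2 : ∫⁻ ξ in Metric.closedBall (0 : E d) R, ‖f ξ‖ₑ =
      ENNReal.ofReal (R ^ d) * ∫⁻ ζ in Metric.closedBall (0 : E d) 1, ‖f (R • ζ)‖ₑ := by
    rw [h1, ← mul_assoc, ← ENNReal.ofReal_mul (by positivity), mul_inv_cancel₀ (by positivity),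
      ENNReal.ofReal_one, one_mul]
  rw [h2]
  gcongr
  have hjoint : Continuous fun z : E d × ℝ => ‖fderiv ℝ f (z.2 • z.1)‖ₑ :=
    (hf'c.comp (by fun_prop)).enorm
  calc ∫⁻ ζ in Metric.closedBall (0 : E d) 1, ‖f (R • ζ)‖ₑ
      ≤ ∫⁻ ζ in Metric.closedBall (0 : E d) 1,
          (‖f ζ‖ₑ + ∫⁻ σ in Set.Ioc 1 R, ‖fderiv ℝ f (σ • ζ)‖ₑ) := by
        refine setLIntegral_mono' Metric.isClosed_closedBall.measurableSet fun ζ hζ => ?_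
        exact enorm_smul_le_enorm_add_lintegral hf hR (mem_closedBall_zero_iff.1 hζ)
    _ = (∫⁻ ζ in Metric.closedBall (0 : E d) 1, ‖f ζ‖ₑ) +
          ∫⁻ ζ in Metric.closedBall (0 : E d) 1,
            ∫⁻ σ in Set.Ioc 1 R, ‖fderiv ℝ f (σ • ζ)‖ₑ := lintegral_add_left hfm _
    _ = (∫⁻ ζ in Metric.closedBall (0 : E d) 1, ‖f ζ‖ₑ) +
          ∫⁻ σ in Set.Ioc 1 R, ∫⁻ ζ in Metric.closedBall (0 : E d) 1,
            ‖fderiv ℝ f (σ • ζ)‖ₑ := by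
        rw [lintegral_lintegral_swap hjoint.measurable.aemeasurable]
    _ ≤ (∫⁻ ζ in Metric.closedBall (0 : E d) 1, ‖f ζ‖ₑ) +
          ∫⁻ σ in Set.Ioc 1 R, ∫⁻ ξ in Metric.closedBall (0 : E d) R, ‖fderiv ℝ f ξ‖ₑ := by
        refine add_le_add le_rfl (setLIntegral_mono' measurableSet_Ioc fun σ hσ => ?_)
        have hσ0 : 0 < σ := by linarith [hσ.1]
        rw [setLIntegral_closedBall_comp_smul hf'm hσ0]
        refine (mul_le_of_le_one_left bot_le ?_).trans
          (lintegral_mono_set (Metric.closedBall_subset_closedBall hσ.2))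
        rw [ENNReal.ofReal_le_one]
        exact inv_le_one_of_one_le₀ (one_le_pow₀ hσ.1.le)
    _ ≤ _ := by
        rw [lintegral_const, Measure.restrict_apply_univ, Real.volume_Ioc, mul_comm]
        gcongr
        linarith

/-- If the derivatives of order `m` are integrable, then the function grows at most polynomially in
the mean. The lower derivatives enter only through their integrals over the unit ball, and all bounds
are uniform over the family. -/
lemma exists_growth {Y : Type*} (m : ℕ) : ∀ {F : Type} [NormedAddCommGroup F] [NormedSpace ℝ F]
    [CompleteSpace F] (f : Y → E d → F), (∀ y, ContDiff ℝ ∞ (f y)) →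
    (∃ C : ℝ, ∀ y, ∫⁻ ξ, ‖iteratedFDeriv ℝ m (f y) ξ‖ₑ ≤ ENNReal.ofReal C) →
    (∀ l < m, ∃ C : ℝ, ∀ y, ∫⁻ ξ in Metric.closedBall (0 : E d) 1,
      ‖iteratedFDeriv ℝ l (f y) ξ‖ₑ ≤ ENNReal.ofReal C) →
    ∃ (C : ℝ) (N : ℕ), 0 ≤ C ∧ ∀ y, ∀ R : ℝ, 1 ≤ R →
      ∫⁻ ξ in Metric.closedBall (0 : E d) R, ‖f y ξ‖ₑ ≤ ENNReal.ofReal (C * R ^ N) := by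
  induction m with
  | zero =>
    intro F _ _ _ f hf ⟨C, hC⟩ _
    refine ⟨|C|, 0, abs_nonneg C, fun y R hR => ?_⟩
    refine (setLIntegral_le_lintegral _ _).trans ?_
    rw [pow_zero, mul_one]
    refine le_trans (le_of_eq (lintegral_congr fun ξ => ?_)) ((hC y).trans
      (ENNReal.ofReal_le_ofReal (le_abs_self C)))
    rw [← ofReal_norm, ← ofReal_norm, norm_iteratedFDeriv_zero]
  | succ m ih =>
    intro F _ _ _ f hf hm hl
    have heq : ∀ l y ξ, ‖iteratedFDeriv ℝ l (fderiv ℝ (f y)) ξ‖ₑ =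
        ‖iteratedFDeriv ℝ (l + 1) (f y) ξ‖ₑ := by
      intro l y ξ
      rw [← ofReal_norm, ← ofReal_norm, norm_iteratedFDeriv_fderiv]
    obtain ⟨C, N, hC0, hC⟩ := ih (fun y => fderiv ℝ (f y))
      (fun y => (hf y).fderiv_right (by simp)) (by simpa only [heq] using hm)
      (fun l hlm => by simpa only [heq] using hl (l + 1) (by omega))
    obtain ⟨D, hD⟩ := hl 0 (by omega)
    refine ⟨|D| + C, N + 1 + d, by positivity, fun y R hR => ?_⟩
    have hR0 : 0 < R := by linarith
    refine (setLIntegral_closedBall_le_fderiv ((hf y).of_le (by simp)) hR).trans ?_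
    have h1 : ∫⁻ ξ in Metric.closedBall (0 : E d) 1, ‖f y ξ‖ₑ ≤ ENNReal.ofReal |D| := by
      refine le_trans (le_of_eq (lintegral_congr fun ξ => ?_)) ((hD y).trans
        (ENNReal.ofReal_le_ofReal (le_abs_self D)))
      rw [← ofReal_norm, ← ofReal_norm, norm_iteratedFDeriv_zero]
    calc _ ≤ ENNReal.ofReal (R ^ d) * (ENNReal.ofReal |D| +
          ENNReal.ofReal R * ENNReal.ofReal (C * R ^ N)) := by
          gcongr
          exact hC y R hR
      _ = ENNReal.ofReal (R ^ d * (|D| + R * (C * R ^ N))) := by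
          rw [ENNReal.ofReal_mul (p := R ^ d) (by positivity), ENNReal.ofReal_add (abs_nonneg D)
            (by positivity), ENNReal.ofReal_mul (p := R) hR0.le]
      _ ≤ _ := by
          refine ENNReal.ofReal_le_ofReal ?_
          have h2 : |D| ≤ |D| * R ^ (N + 1) :=
            le_mul_of_one_le_right (abs_nonneg D) (one_le_pow₀ hR)
          calc R ^ d * (|D| + R * (C * R ^ N)) ≤ R ^ d * (|D| * R ^ (N + 1) + R * (C * R ^ N)) := by
                gcongr
            _ = _ := by ring

end Growth

/-! ### Oscillatory integrals -/

section Oscillatory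

variable {d : ℕ}

/-- The exponential `e^{iα z·ξ}`. -/
noncomputable def phase (α : ℝ) (z ξ : E d) : ℂ :=
  Complex.exp (Complex.I * ((α * inner ℝ z ξ : ℝ) : ℂ))

@[simp] lemma norm_phase (α : ℝ) (z ξ : E d) : ‖phase α z ξ‖ = 1 := by
  rw [phase, mul_comm, Complex.norm_exp_ofReal_mul_I]

lemma continuous_phase (α : ℝ) : Continuous fun p : E d × E d => phase α p.1 p.2 := by
  unfold phase
  fun_prop

lemma contDiff_phase (α : ℝ) (z : E d) : ContDiff ℝ ∞ (phase α z) := by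
  unfold phase
  refine Complex.contDiff_exp.comp (contDiff_const.mul ?_)
  exact Complex.ofRealCLM.contDiff.comp (contDiff_const.mul (contDiff_const.inner ℝ contDiff_id))

lemma fderiv_phase_single (α : ℝ) (z ξ : E d) (i : Fin d) :
    fderiv ℝ (phase α z) ξ (EuclideanSpace.single i 1) =
      phase α z ξ * (Complex.I * ((α * z i : ℝ) : ℂ)) := by
  have h1 : HasDerivAt (fun s : ℝ => phase α z (ξ + s • EuclideanSpace.single i 1))
      (phase α z ξ * (Complex.I * ((α * z i : ℝ) : ℂ))) 0 := by
    have h2 : ∀ s : ℝ, phase α z (ξ + s • EuclideanSpace.single i 1) =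
        phase α z ξ * Complex.exp (Complex.I * ((α * z i : ℝ) : ℂ) * (s : ℂ)) := by
      intro s
      rw [phase, phase, ← Complex.exp_add]
      congr 1
      rw [inner_add_right, inner_smul_right, EuclideanSpace.inner_single_right]
      push_cast
      simp only [one_mul, conj_trivial]
      ring
    rw [funext h2]
    have h3 : HasDerivAt (fun s : ℝ => Complex.I * ((α * z i : ℝ) : ℂ) * (s : ℂ))
        (Complex.I * ((α * z i : ℝ) : ℂ)) 0 := by
      simpa using (Complex.ofRealCLM.hasDerivAt (x := (0 : ℝ))).const_mul
        (Complex.I * ((α * z i : ℝ) : ℂ))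
    have h4 := (h3.cexp).const_mul (phase α z ξ)
    simpa using h4
  have h5 : HasFDerivAt (phase α z) (fderiv ℝ (phase α z) ξ) ξ :=
    ((contDiff_phase α z).differentiable (by simp) ξ).hasFDerivAt
  have h6 : HasDerivAt (fun s : ℝ => phase α z (ξ + s • EuclideanSpace.single i 1))
      (fderiv ℝ (phase α z) ξ (EuclideanSpace.single i 1)) 0 := by
    have h7 : HasDerivAt (fun s : ℝ => ξ + s • EuclideanSpace.single i (1 : ℝ))
        (EuclideanSpace.single i 1) 0 := by
      simpa using ((hasDerivAt_id (0 : ℝ)).smul_const (EuclideanSpace.single i (1 : ℝ))).const_add ξ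
    have h8 : HasFDerivAt (phase α z) (fderiv ℝ (phase α z) ξ)
        (ξ + (0 : ℝ) • EuclideanSpace.single i (1 : ℝ)) := by simpa using h5
    exact h8.comp_hasDerivAt (0 : ℝ) h7
  exact h6.unique h1

/-- The integral `∫ χ(εξ) e^{iα z·ξ} f(ξ) dξ`. -/
noncomputable def oscInt (α : ℝ) (z : E d) (χ f : E d → ℂ) (ε : ℝ) : ℂ :=
  ∫ ξ, χ (ε • ξ) * phase α z ξ * f ξ

/-- The partial derivative in the direction of the `i`-th coordinate. -/
noncomputable def partialDeriv (i : Fin d) (f : E d → ℂ) (ξ : E d) : ℂ :=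
  fderiv ℝ f ξ (EuclideanSpace.single i 1)

lemma contDiff_partialDeriv {f : E d → ℂ} (hf : ContDiff ℝ ∞ f) (i : Fin d) :
    ContDiff ℝ ∞ (partialDeriv i f) :=
  (hf.fderiv_right (by simp)).clm_apply contDiff_const

lemma hasCompactSupport_partialDeriv {f : E d → ℂ} (hf : HasCompactSupport f) (i : Fin d) :
    HasCompactSupport (partialDeriv i f) :=
  (hf.fderiv ℝ).comp_left (g := fun L : E d →L[ℝ] ℂ => L (EuclideanSpace.single i 1)) (by simp)

lemma norm_iteratedFDeriv_partialDeriv_le {f : E d → ℂ} (hf : ContDiff ℝ ∞ f) (i : Fin d) (l : ℕ)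
    (ξ : E d) : ‖iteratedFDeriv ℝ l (partialDeriv i f) ξ‖ ≤ ‖iteratedFDeriv ℝ (l + 1) f ξ‖ := by
  have h : ContDiff ℝ ∞ (fderiv ℝ f) := hf.fderiv_right (by simp)
  have := norm_iteratedFDeriv_clm_apply_const (c := EuclideanSpace.single i (1 : ℝ)) (n := l)
    h.contDiffAt (x := ξ) (by exact_mod_cast le_top)
  rw [PiLp.norm_single, norm_one, one_mul, norm_iteratedFDeriv_fderiv] at this
  exact this

lemma iteratedFDeriv_partialDeriv_apply {f : E d → ℂ} (hf : ContDiff ℝ ∞ f) (i : Fin d) (l : ℕ)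
    (ξ : E d) : iteratedFDeriv ℝ l (partialDeriv i f) ξ (fun _ => EuclideanSpace.single i 1) =
      iteratedFDeriv ℝ (l + 1) f ξ (fun _ => EuclideanSpace.single i 1) := by
  have h : ContDiff ℝ ∞ (fderiv ℝ f) := hf.fderiv_right (by simp)
  rw [iteratedFDeriv_succ_apply_right]
  exact iteratedFDeriv_clm_apply_const_apply h (by exact_mod_cast le_top)

lemma hasCompactSupport_comp_smul {χ : E d → ℂ} (hχ : HasCompactSupport χ) {ε : ℝ} (hε : ε ≠ 0) :
    HasCompactSupport fun ξ => χ (ε • ξ) :=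
  hχ.comp_homeomorph (Homeomorph.smulOfNeZero ε hε)

lemma integrable_oscInt {χ f : E d → ℂ} (hχ : Continuous χ) (hχc : HasCompactSupport χ)
    (hf : Continuous f) (α : ℝ) (z : E d) {ε : ℝ} (hε : ε ≠ 0) :
    Integrable fun ξ => χ (ε • ξ) * phase α z ξ * f ξ := by
  refine Continuous.integrable_of_hasCompactSupport ?_ ?_
  · exact ((hχ.comp (by fun_prop)).mul (contDiff_phase α z).continuous).mul hf
  · exact ((hasCompactSupport_comp_smul hχc hε).mul_right).mul_right

/-- Integration by parts in the `i`-th coordinate. -/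
lemma oscInt_eq_mul_add {χ f : E d → ℂ} (hχ : ContDiff ℝ ∞ χ) (hχc : HasCompactSupport χ)
    (hf : ContDiff ℝ ∞ f) {α : ℝ} {z : E d} {i : Fin d} (hz : α * z i ≠ 0) {ε : ℝ} (hε : ε ≠ 0) :
    oscInt α z χ f ε = Complex.I / ((α * z i : ℝ) : ℂ) *
      (ε * oscInt α z (partialDeriv i χ) f ε + oscInt α z χ (partialDeriv i f) ε) := by
  set u : E d → ℂ := fun ξ => χ (ε • ξ) * f ξ with hu
  have hχε : ContDiff ℝ ∞ fun ξ => χ (ε • ξ) := hχ.comp (by fun_prop)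
  have hus : ContDiff ℝ ∞ u := hχε.mul hf
  have huc : HasCompactSupport u := (hasCompactSupport_comp_smul hχc hε).mul_right
  have hus' : Continuous fun ξ => fderiv ℝ u ξ (EuclideanSpace.single i 1) :=
    (contDiff_partialDeriv hus i).continuous
  have hphc := (contDiff_phase α z).continuous
  have hibp := integral_mul_fderiv_eq_neg_fderiv_mul_of_integrable (μ := (volume : Measure (E d)))
    (f := u) (g := phase α z) (v := EuclideanSpace.single i 1)
    ((hus'.mul hphc).integrable_of_hasCompactSupport
      ((hasCompactSupport_partialDeriv huc i).mul_right))
    ((hus.continuous.mul (contDiff_partialDeriv (contDiff_phase α z) i).continuous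
      ).integrable_of_hasCompactSupport huc.mul_right)
    ((hus.continuous.mul hphc).integrable_of_hasCompactSupport huc.mul_right)
    (fun ξ _ => hus.differentiable (by simp) ξ)
    (fun ξ _ => (contDiff_phase α z).differentiable (by simp) ξ)
  have hfu : ∀ ξ, fderiv ℝ u ξ (EuclideanSpace.single i 1) =
      ε * (partialDeriv i χ (ε • ξ)) * f ξ + χ (ε • ξ) * partialDeriv i f ξ := by
    intro ξ
    have h1 : HasFDerivAt (fun ξ => χ (ε • ξ))
        ((fderiv ℝ χ (ε • ξ)).comp (ε • ContinuousLinearMap.id ℝ (E d))) ξ :=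
      ((hχ.differentiable (by simp) (ε • ξ)).hasFDerivAt).comp ξ
        ((ContinuousLinearMap.id ℝ (E d)).hasFDerivAt.const_smul ε)
    have h2 : HasFDerivAt f (fderiv ℝ f ξ) ξ := (hf.differentiable (by simp) ξ).hasFDerivAt
    have h3 : HasFDerivAt u _ ξ := h1.mul h2
    rw [h3.fderiv]
    simp [partialDeriv]
    ring
  have hA := integrable_oscInt hχ.continuous hχc (contDiff_partialDeriv hf i).continuous α z hε
  have hB := integrable_oscInt (contDiff_partialDeriv hχ i).continuous
    (hasCompactSupport_partialDeriv hχc i) hf.continuous α z hε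
  have hL : ∫ ξ, u ξ * fderiv ℝ (phase α z) ξ (EuclideanSpace.single i 1) =
      (Complex.I * ((α * z i : ℝ) : ℂ)) * oscInt α z χ f ε := by
    rw [oscInt, ← integral_const_mul]
    refine integral_congr_ae (ae_of_all _ fun ξ => ?_)
    simp only [hu, fderiv_phase_single]
    ring
  have hR : ∫ ξ, fderiv ℝ u ξ (EuclideanSpace.single i 1) * phase α z ξ =
      ε * oscInt α z (partialDeriv i χ) f ε + oscInt α z χ (partialDeriv i f) ε := by
    rw [oscInt, oscInt, ← integral_const_mul, ← integral_add (hB.const_mul _) hA]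
    refine integral_congr_ae (ae_of_all _ fun ξ => ?_)
    simp only [hfu]
    ring
  rw [hL, hR] at hibp
  have hz' : ((α * z i : ℝ) : ℂ) ≠ 0 := by exact_mod_cast hz
  have h3 : ε * oscInt α z (partialDeriv i χ) f ε + oscInt α z χ (partialDeriv i f) ε =
      -(Complex.I * ((α * z i : ℝ) : ℂ) * oscInt α z χ f ε) := by rw [hibp, neg_neg]
  rw [h3]
  field_simp
  rw [Complex.I_sq]
  ring

lemma norm_oscInt_le {χ f : E d → ℂ} {A ρ D : ℝ} (hA : ∀ ξ, ‖χ ξ‖ ≤ A)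
    (hρ : ∀ ξ, ρ < ‖ξ‖ → χ ξ = 0) (hD : 0 ≤ D) (α : ℝ) (z : E d) {ε : ℝ} (hε : 0 < ε)
    (hf : ∫⁻ ξ in Metric.closedBall (0 : E d) (ρ / ε), ‖f ξ‖ₑ ≤ ENNReal.ofReal D) :
    ‖oscInt α z χ f ε‖ ≤ A * D := by
  have hA0 : 0 ≤ A := (norm_nonneg _).trans (hA 0)
  rw [← ENNReal.ofReal_le_ofReal_iff (by positivity), ofReal_norm]
  refine (enorm_integral_le_lintegral_enorm _).trans ?_
  calc ∫⁻ ξ, ‖χ (ε • ξ) * phase α z ξ * f ξ‖ₑ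
      = ∫⁻ ξ in Metric.closedBall (0 : E d) (ρ / ε), ‖χ (ε • ξ) * phase α z ξ * f ξ‖ₑ := by
        refine (setLIntegral_eq_of_support_subset fun ξ hξ => ?_).symm
        by_contra h
        rw [mem_closedBall_zero_iff, not_le, div_lt_iff₀ hε] at h
        refine hξ ?_
        have : χ (ε • ξ) = 0 := hρ _ (by
          rwa [norm_smul, Real.norm_of_nonneg hε.le, mul_comm])
        simp [this]
    _ ≤ ∫⁻ ξ in Metric.closedBall (0 : E d) (ρ / ε), ENNReal.ofReal A * ‖f ξ‖ₑ := by
        refine lintegral_mono fun ξ => ?_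
        rw [← ofReal_norm, norm_mul, norm_mul, norm_phase, mul_one,
          ENNReal.ofReal_mul (norm_nonneg _), ofReal_norm (f ξ)]
        gcongr
        exact hA _
    _ = ENNReal.ofReal A * ∫⁻ ξ in Metric.closedBall (0 : E d) (ρ / ε), ‖f ξ‖ₑ :=
        lintegral_const_mul' _ _ ENNReal.ofReal_ne_top
    _ ≤ ENNReal.ofReal A * ENNReal.ofReal D := by gcongr
    _ = _ := (ENNReal.ofReal_mul hA0).symm

lemma exists_bound_of_hasCompactSupport {χ : E d → ℂ} (hχ : ContDiff ℝ ∞ χ)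
    (hχc : HasCompactSupport χ) :
    ∃ A ρ : ℝ, 1 ≤ ρ ∧ (∀ ξ, ‖χ ξ‖ ≤ A) ∧ ∀ ξ, ρ < ‖ξ‖ → χ ξ = 0 := by
  obtain ⟨A, hA⟩ := hχ.continuous.bounded_above_of_compact_support hχc
  obtain ⟨ρ, hρ⟩ := hχc.isCompact.isBounded.subset_closedBall 0
  refine ⟨A, max ρ 1, le_max_right _ _, hA, fun ξ hξ => ?_⟩
  by_contra h
  have := hρ (subset_tsupport χ h)
  rw [mem_closedBall_zero_iff] at this
  exact absurd hξ (not_lt.2 (this.trans (le_max_left _ _)))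

/-- Regularized oscillatory integrals of a family `f` with integrable derivatives of order `m`.
Integration by parts once gains a factor `ε` on the terms in which the cut-off is differentiated.
The polynomial growth of `f` in the mean gives an a priori bound by a negative power of `ε`; a
repeated use of the gain improves it to boundedness, and one more makes those terms
vanish in the limit, so that all `m` derivatives fall on `f`. -/
theorem oscInt_bounded_and_tendsto {Y : Type*} {α : ℝ} (hα : α ≠ 0) (i : Fin d) (z : Y → E d)
    (m : ℕ) : ∀ (f : Y → E d → ℂ), (∀ y, ContDiff ℝ ∞ (f y)) →
    (m ≠ 0 → ∃ κ > 0, ∀ y, κ ≤ |z y i|) →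
    (∃ C : ℝ, ∀ y, ∫⁻ ξ, ‖iteratedFDeriv ℝ m (f y) ξ‖ₑ ≤ ENNReal.ofReal C) →
    (∀ l < m, ∃ C : ℝ, ∀ y, ∫⁻ ξ in Metric.closedBall (0 : E d) 1,
      ‖iteratedFDeriv ℝ l (f y) ξ‖ₑ ≤ ENNReal.ofReal C) →
    ∀ χ : E d → ℂ, ContDiff ℝ ∞ χ → HasCompactSupport χ →
      (∃ C : ℝ, ∀ y, ∀ ε ∈ Set.Ioc (0 : ℝ) 1, ‖oscInt α (z y) χ (f y) ε‖ ≤ C) ∧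
      ∀ y, Tendsto (fun ε => oscInt α (z y) χ (f y) ε) (𝓝[>] 0)
        (𝓝 (χ 0 * ((Complex.I / ((α * z y i : ℝ) : ℂ)) ^ m * ∫ ξ, phase α (z y) ξ *
          iteratedFDeriv ℝ m (f y) ξ (fun _ => EuclideanSpace.single i 1)))) := by
  induction m with
  | zero =>
    intro f hf _ ⟨C, hC⟩ _ χ hχ hχc
    have h0 : ∀ y ξ, ‖iteratedFDeriv ℝ 0 (f y) ξ‖ₑ = ‖f y ξ‖ₑ := fun y ξ => by
      rw [← ofReal_norm, ← ofReal_norm, norm_iteratedFDeriv_zero]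
    simp_rw [h0] at hC
    obtain ⟨A, ρ, hρ1, hA, hρ⟩ := exists_bound_of_hasCompactSupport hχ hχc
    refine ⟨⟨A * |C|, fun y ε hε => norm_oscInt_le hA hρ (abs_nonneg C) α (z y) hε.1
      ((setLIntegral_le_lintegral _ _).trans ((hC y).trans
        (ENNReal.ofReal_le_ofReal (le_abs_self C))))⟩, fun y => ?_⟩
    simp only [pow_zero, one_mul, iteratedFDeriv_zero_apply]
    rw [← integral_const_mul]
    have hfi : Integrable (f y) := ⟨(hf y).continuous.aestronglyMeasurable,
      (hC y).trans_lt ENNReal.ofReal_lt_top⟩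
    refine tendsto_integral_filter_of_dominated_convergence (fun ξ => A * ‖f y ξ‖) ?_ ?_
      (hfi.norm.const_mul A) ?_
    · refine Eventually.of_forall fun ε => Continuous.aestronglyMeasurable ?_
      exact ((hχ.continuous.comp (by fun_prop)).mul (contDiff_phase α (z y)).continuous).mul
        (hf y).continuous
    · refine Eventually.of_forall fun ε => ae_of_all _ fun ξ => ?_
      rw [norm_mul, norm_mul, norm_phase, mul_one]
      exact mul_le_mul_of_nonneg_right (hA _) (norm_nonneg _)
    · refine ae_of_all _ fun ξ => ?_
      have h1 : Tendsto (fun ε : ℝ => χ (ε • ξ)) (𝓝[>] 0) (𝓝 (χ 0)) := by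
        have : Continuous fun ε : ℝ => χ (ε • ξ) := hχ.continuous.comp (by fun_prop)
        have h2 := this.tendsto 0
        rw [zero_smul] at h2
        exact h2.mono_left nhdsWithin_le_nhds
      have h3 := (h1.mul_const (phase α (z y) ξ)).mul_const (f y ξ)
      rwa [mul_assoc (χ 0)] at h3
  | succ m ih =>
    intro f hf hκ hm hl χ hχ hχc
    obtain ⟨κ, hκ0, hκ⟩ := hκ (Nat.succ_ne_zero m)
    have hle : ∀ l y ξ, ‖iteratedFDeriv ℝ l (partialDeriv i (f y)) ξ‖ₑ ≤
        ‖iteratedFDeriv ℝ (l + 1) (f y) ξ‖ₑ := fun l y ξ => by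
      rw [← ofReal_norm, ← ofReal_norm]
      exact ENNReal.ofReal_le_ofReal (norm_iteratedFDeriv_partialDeriv_le (hf y) i l ξ)
    have ih' := ih (fun y => partialDeriv i (f y)) (fun y => contDiff_partialDeriv (hf y) i)
      (fun _ => ⟨κ, hκ0, hκ⟩)
      (by
        obtain ⟨C, hC⟩ := hm
        exact ⟨C, fun y => (lintegral_mono fun ξ => hle m y ξ).trans (hC y)⟩)
      (fun l hlm => by
        obtain ⟨C, hC⟩ := hl (l + 1) (by omega)
        exact ⟨C, fun y => (lintegral_mono fun ξ => hle l y ξ).trans (hC y)⟩)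
    have hz : ∀ y, α * z y i ≠ 0 := fun y =>
      mul_ne_zero hα (abs_pos.1 (hκ0.trans_le (hκ y)))
    set c : Y → ℂ := fun y => Complex.I / ((α * z y i : ℝ) : ℂ) with hc
    have hcle : ∀ y, ‖c y‖ ≤ 1 / (|α| * κ) := fun y => by
      rw [hc]
      simp only [norm_div, Complex.norm_I, Complex.norm_real, Real.norm_eq_abs, abs_mul]
      have := abs_pos.2 hα
      gcongr
      exact hκ y
    have hrec : ∀ χ : E d → ℂ, ContDiff ℝ ∞ χ → HasCompactSupport χ → ∀ y, ∀ ε ≠ 0,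
        oscInt α (z y) χ (f y) ε = c y * (ε * oscInt α (z y) (partialDeriv i χ) (f y) ε +
          oscInt α (z y) χ (partialDeriv i (f y)) ε) := fun χ hχ hχc y ε hε =>
      oscInt_eq_mul_add hχ hχc (hf y) (hz y) hε
    -- the a priori bound by a power of `ε`
    have hapriori : ∃ N : ℕ, ∀ χ : E d → ℂ, ContDiff ℝ ∞ χ → HasCompactSupport χ →
        ∃ C : ℝ, ∀ y, ∀ ε ∈ Set.Ioc (0 : ℝ) 1, ‖oscInt α (z y) χ (f y) ε‖ * ε ^ N ≤ C := by
      obtain ⟨C, N, hC0, hC⟩ := exists_growth (m + 1) f hf hm hl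
      refine ⟨N, fun χ hχ hχc => ?_⟩
      obtain ⟨A, ρ, hρ1, hA, hρ⟩ := exists_bound_of_hasCompactSupport hχ hχc
      refine ⟨A * (C * ρ ^ N), fun y ε hε => ?_⟩
      have hε0 : 0 < ε := hε.1
      have hρ0 : 0 < ρ := by linarith
      have h1 : 1 ≤ ρ / ε := by rw [le_div_iff₀ hε0]; linarith [hε.2]
      have h2 := norm_oscInt_le hA hρ (by positivity) α (z y) hε0 (hC y _ h1)
      calc _ ≤ A * (C * (ρ / ε) ^ N) * ε ^ N := by gcongr
        _ = _ := by rw [div_pow]; field_simp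
    -- each integration by parts improves the exponent by one
    have hbdd : ∀ χ : E d → ℂ, ContDiff ℝ ∞ χ → HasCompactSupport χ →
        ∃ C : ℝ, ∀ y, ∀ ε ∈ Set.Ioc (0 : ℝ) 1, ‖oscInt α (z y) χ (f y) ε‖ ≤ C := by
      obtain ⟨N, hN⟩ := hapriori
      induction N with
      | zero => simpa using hN
      | succ N ihN =>
        refine ihN fun χ hχ hχc => ?_
        obtain ⟨C₁, hC₁⟩ := hN (partialDeriv i χ) (contDiff_partialDeriv hχ i)
          (hasCompactSupport_partialDeriv hχc i)
        obtain ⟨C₂, hC₂⟩ := (ih' χ hχ hχc).1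
        refine ⟨1 / (|α| * κ) * (C₁ + |C₂|), fun y ε hε => ?_⟩
        have hε0 : 0 < ε := hε.1
        have hα' := abs_pos.2 hα
        rw [hrec χ hχ hχc y ε hε0.ne', norm_mul, mul_assoc]
        have h1 : ‖(ε : ℂ) * oscInt α (z y) (partialDeriv i χ) (f y) ε +
            oscInt α (z y) χ (partialDeriv i (f y)) ε‖ * ε ^ N ≤ C₁ + |C₂| := by
          have h2 : ‖oscInt α (z y) χ (partialDeriv i (f y)) ε‖ * ε ^ N ≤ |C₂| :=
            (mul_le_of_le_one_right (norm_nonneg _) (pow_le_one₀ hε0.le hε.2)).trans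
              ((hC₂ y ε hε).trans (le_abs_self _))
          calc _ ≤ (ε * ‖oscInt α (z y) (partialDeriv i χ) (f y) ε‖ +
                ‖oscInt α (z y) χ (partialDeriv i (f y)) ε‖) * ε ^ N := by
                gcongr
                refine (norm_add_le _ _).trans ?_
                rw [norm_mul, Complex.norm_real, Real.norm_of_nonneg hε0.le]
            _ = ‖oscInt α (z y) (partialDeriv i χ) (f y) ε‖ * ε ^ (N + 1) +
                ‖oscInt α (z y) χ (partialDeriv i (f y)) ε‖ * ε ^ N := by ring
            _ ≤ _ := add_le_add (hC₁ y ε hε) h2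
        exact mul_le_mul (hcle y) h1 (by positivity) (by positivity)
    refine ⟨hbdd χ hχ hχc, fun y => ?_⟩
    obtain ⟨C₁, hC₁⟩ := hbdd (partialDeriv i χ) (contDiff_partialDeriv hχ i)
      (hasCompactSupport_partialDeriv hχc i)
    have hIoc : ∀ᶠ ε : ℝ in 𝓝[>] 0, ε ∈ Set.Ioc (0 : ℝ) 1 := Ioc_mem_nhdsGT one_pos
    have hε : Tendsto (fun ε : ℝ => ε) (𝓝[>] 0) (𝓝 0) := nhdsWithin_le_nhds
    have hlim1 : Tendsto (fun ε : ℝ => (ε : ℂ) * oscInt α (z y) (partialDeriv i χ) (f y) ε)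
        (𝓝[>] 0) (𝓝 0) := by
      rw [tendsto_zero_iff_norm_tendsto_zero]
      refine squeeze_zero' (g := fun ε => ε * C₁) (Eventually.of_forall fun _ => norm_nonneg _) ?_ ?_
      · filter_upwards [hIoc] with ε hε
        rw [norm_mul, Complex.norm_real, Real.norm_of_nonneg hε.1.le]
        exact mul_le_mul_of_nonneg_left (hC₁ y ε hε) hε.1.le
      · simpa using hε.mul_const C₁
    have hlim2 := ((hlim1.add ((ih' χ hχ hχc).2 y)).const_mul (c y))
    simp_rw [iteratedFDeriv_partialDeriv_apply (hf y) i m] at hlim2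
    rw [zero_add] at hlim2
    have heq : c y * (χ 0 * ((Complex.I / ((α * z y i : ℝ) : ℂ)) ^ m * ∫ ξ, phase α (z y) ξ *
          iteratedFDeriv ℝ (m + 1) (f y) ξ (fun _ => EuclideanSpace.single i 1))) =
        χ 0 * ((Complex.I / ((α * z y i : ℝ) : ℂ)) ^ (m + 1) * ∫ ξ, phase α (z y) ξ *
          iteratedFDeriv ℝ (m + 1) (f y) ξ (fun _ => EuclideanSpace.single i 1)) := by
      rw [hc]; ring
    rw [heq] at hlim2
    refine hlim2.congr' ?_
    filter_upwards [hIoc] with ε hε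
    exact (hrec χ hχ hχc y ε hε.1.ne').symm

/-! ### Values of the quantization -/

lemma exists_setLIntegral_iteratedFDeriv_le {a : E d → E d → ℂ}
    (ha : ContDiff ℝ ∞ (fun p : E d × E d => a p.1 p.2)) (l : ℕ) {K : Set (E d)}
    (hK : IsCompact K) : ∃ C : ℝ, ∀ w ∈ K, ∫⁻ ξ in Metric.closedBall (0 : E d) 1,
      ‖iteratedFDeriv ℝ l (a w) ξ‖ₑ ≤ ENNReal.ofReal C := by
  have hc := (contDiff_iteratedFDeriv_param ha l).continuous
  obtain ⟨C, hC⟩ := (hK.prod (isCompact_closedBall (0 : E d) 1)).exists_bound_of_continuousOn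
    hc.continuousOn
  refine ⟨|C| * (volume (Metric.closedBall (0 : E d) 1)).toReal, fun w hw => ?_⟩
  calc _ ≤ ∫⁻ ξ in Metric.closedBall (0 : E d) 1, ENNReal.ofReal |C| := by
        refine setLIntegral_mono' Metric.isClosed_closedBall.measurableSet fun ξ hξ => ?_
        rw [← ofReal_norm]
        exact ENNReal.ofReal_le_ofReal ((hC (w, ξ) ⟨hw, hξ⟩).trans (le_abs_self C))
    _ = _ := by
        rw [setLIntegral_const, ENNReal.ofReal_mul (abs_nonneg C),
          ENNReal.ofReal_toReal (isCompact_closedBall _ _).measure_lt_top.ne]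

lemma integrable_regularizedOp {a : E d → E d → ℂ}
    (ha : ContDiff ℝ ∞ (fun p : E d × E d => a p.1 p.2)) (α t : ℝ) {χ : E d → ℂ}
    (hχ : ContDiff ℝ ∞ χ) (hχc : HasCompactSupport χ) {ε : ℝ} (hε : 0 < ε) {v : E d → ℂ}
    (hv : Integrable v) {K : Set (E d)} (hK : IsCompact K) (hvK : ∀ y ∉ K, v y = 0) (x : E d) :
    Integrable fun p : E d × E d =>
      χ (ε • p.2) * phase α (x - p.1) p.2 * a ((1 - t) • x + t • p.1) p.2 * v p.1 := by
  obtain ⟨A, ρ, hρ1, hA, hρ⟩ := exists_bound_of_hasCompactSupport hχ hχc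
  have hcont : Continuous fun p : E d × E d =>
      χ (ε • p.2) * phase α (x - p.1) p.2 * a ((1 - t) • x + t • p.1) p.2 := by
    refine ((hχ.continuous.comp (by fun_prop)).mul ?_).mul ?_
    · exact (continuous_phase α).comp
        (f := fun p : E d × E d => (x - p.1, p.2)) (by fun_prop)
    · exact ha.continuous.comp
        (f := fun p : E d × E d => ((1 - t) • x + t • p.1, p.2)) (by fun_prop)
  obtain ⟨C, hC⟩ := (hK.prod (isCompact_closedBall (0 : E d) (ρ / ε))).exists_bound_of_continuousOn
    hcont.continuousOn
  have hB : Integrable ((Metric.closedBall (0 : E d) (ρ / ε)).indicator fun _ => (1 : ℝ)) :=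
    (integrable_indicator_iff Metric.isClosed_closedBall.measurableSet).2
      (integrableOn_const (isCompact_closedBall _ _).measure_lt_top.ne)
  refine ((hv.norm.mul_prod hB).const_mul |C|).mono'
    (hcont.aestronglyMeasurable.mul hv.aestronglyMeasurable.comp_fst) (ae_of_all _ fun p => ?_)
  by_cases hy : p.1 ∈ K
  · by_cases hξ : p.2 ∈ Metric.closedBall (0 : E d) (ρ / ε)
    · rw [Set.indicator_of_mem hξ, mul_one, norm_mul]
      exact mul_le_mul_of_nonneg_right ((hC p ⟨hy, hξ⟩).trans (le_abs_self C)) (norm_nonneg _)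
    · rw [Set.indicator_of_notMem hξ, mul_zero, mul_zero]
      have : χ (ε • p.2) = 0 := hρ _ (by
        rw [mem_closedBall_zero_iff, not_le, div_lt_iff₀ hε] at hξ
        rwa [norm_smul, Real.norm_of_nonneg hε.le, mul_comm])
      simp [this]
  · simp [hvK _ hy]

/-- The value of the quantization after `m` integrations by parts in the coordinate `ξ_i`. -/
theorem hasOpValue_of_iteratedFDeriv {a : E d → E d → ℂ}
    (ha : ContDiff ℝ ∞ (fun p : E d × E d => a p.1 p.2)) {α t : ℝ} (hα : α ≠ 0) {v : E d → ℂ}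
    (hv : Integrable v) {K : Set (E d)} (hK : IsCompact K) (hvK : ∀ y ∉ K, v y = 0) (x : E d)
    (i : Fin d) (m : ℕ) (hκ : m ≠ 0 → ∃ κ > 0, ∀ y, v y ≠ 0 → κ ≤ |x i - y i|)
    (hm : ∃ C : ℝ, ∀ w, ∫⁻ ξ, ‖iteratedFDeriv ℝ m (a w) ξ‖ₑ ≤ ENNReal.ofReal C) :
    HasOpValue α t a v x ((((α / (2 * Real.pi)) ^ d : ℝ) : ℂ) *
      ∫ y, ((Complex.I / ((α * (x i - y i) : ℝ) : ℂ)) ^ m * ∫ ξ, phase α (x - y) ξ *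
        iteratedFDeriv ℝ m (a ((1 - t) • x + t • y)) ξ (fun _ => EuclideanSpace.single i 1)) *
          v y) := by
  intro χ hχ hχc hχ0
  let Y := {y : E d // v y ≠ 0}
  have hYK : ∀ y : Y, y.1 ∈ K := fun y => by
    by_contra h
    exact y.2 (hvK _ h)
  have hsm : ∀ w, ContDiff ℝ ∞ (a w) := fun w => ha.comp (contDiff_const.prodMk contDiff_id)
  obtain ⟨⟨C, hC⟩, hlim⟩ := oscInt_bounded_and_tendsto hα i (fun y : Y => x - y.1) m
    (fun y : Y => a ((1 - t) • x + t • y.1)) (fun y => hsm _)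
    (fun h0 => by
      obtain ⟨κ, h1, h2⟩ := hκ h0
      exact ⟨κ, h1, fun y => h2 _ y.2⟩)
    (by
      obtain ⟨C, hC⟩ := hm
      exact ⟨C, fun y => hC _⟩)
    (fun l _ => by
      have hcont : Continuous fun y : E d => (1 - t) • x + t • y := by fun_prop
      obtain ⟨C, hC⟩ := exists_setLIntegral_iteratedFDeriv_le ha l (hK.image hcont)
      exact ⟨C, fun y => hC _ ⟨y.1, hYK y, rfl⟩⟩) χ hχ hχc
  have hreg : ∀ ε ∈ Set.Ioc (0 : ℝ) 1, regularizedOp α t a χ ε v x =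
      (((α / (2 * Real.pi)) ^ d : ℝ) : ℂ) *
        ∫ y, oscInt α (x - y) χ (a ((1 - t) • x + t • y)) ε * v y := by
    intro ε hε
    have hint := integrable_regularizedOp ha α t hχ hχc hε.1 hv hK hvK x
    rw [regularizedOp]
    congr 1
    refine (integral_prod _ hint).trans ?_
    refine integral_congr_ae (ae_of_all _ fun y => ?_)
    simp only [oscInt]
    rw [← integral_mul_const]
  have hIoc : ∀ᶠ ε : ℝ in 𝓝[>] 0, ε ∈ Set.Ioc (0 : ℝ) 1 := Ioc_mem_nhdsGT one_pos
  refine Tendsto.congr' (f₁ := fun ε => (((α / (2 * Real.pi)) ^ d : ℝ) : ℂ) *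
    ∫ y, oscInt α (x - y) χ (a ((1 - t) • x + t • y)) ε * v y) ?_ (Tendsto.const_mul _ ?_)
  · filter_upwards [hIoc] with ε hε
    exact (hreg ε hε).symm
  refine tendsto_integral_filter_of_dominated_convergence (fun y => C * ‖v y‖) ?_ ?_
    (hv.norm.const_mul C) ?_
  · filter_upwards [hIoc] with ε hε
    have hint := (integrable_regularizedOp ha α t hχ hχc hε.1 hv hK hvK x).integral_prod_left
    refine hint.aestronglyMeasurable.congr (ae_of_all _ fun y => ?_)
    simp only [oscInt]
    rw [← integral_mul_const]
  · filter_upwards [hIoc] with ε hε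
    refine ae_of_all _ fun y => ?_
    by_cases hy : v y = 0
    · simp [hy]
    · rw [norm_mul]
      exact mul_le_mul_of_nonneg_right (hC ⟨y, hy⟩ ε hε) (norm_nonneg _)
  · refine ae_of_all _ fun y => ?_
    by_cases hy : v y = 0
    · simp [hy]
    · have := (hlim ⟨y, hy⟩).mul_const (v y)
      simp only [hχ0, one_mul] at this
      exact this

lemma HasOpValue.sum {ι : Type*} (s : Finset ι) {α t : ℝ} {a : E d → E d → ℂ}
    (ha : ContDiff ℝ ∞ (fun p : E d × E d => a p.1 p.2)) {v : ι → E d → ℂ}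
    (hv : ∀ k ∈ s, Integrable (v k)) {K : Set (E d)} (hK : IsCompact K)
    (hvK : ∀ k ∈ s, ∀ y ∉ K, v k y = 0) {x : E d} {L : ι → ℂ}
    (h : ∀ k ∈ s, HasOpValue α t a (v k) x (L k)) :
    HasOpValue α t a (fun y => ∑ k ∈ s, v k y) x (∑ k ∈ s, L k) := by
  intro χ hχ hχc hχ0
  refine (tendsto_finsetSum s fun k hk => h k hk χ hχ hχc hχ0).congr' ?_
  filter_upwards [self_mem_nhdsWithin] with ε hε
  simp only [regularizedOp]
  rw [← Finset.mul_sum, ← integral_finsetSum]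
  · simp_rw [Finset.mul_sum]
  · exact fun k hk => integrable_regularizedOp ha α t hχ hχc hε (hv k hk) hK (hvK k hk) x

lemma hasOpValue_zero_of_ae_eq_zero {α t : ℝ} {a : E d → E d → ℂ} {v : E d → ℂ}
    (hv : v =ᵐ[volume] 0) (x : E d) : HasOpValue α t a v x 0 := by
  intro χ _ _ _
  have : ∀ ε, regularizedOp α t a χ ε v x = 0 := by
    intro ε
    rw [regularizedOp, integral_eq_zero_of_ae, mul_zero]
    have : ∀ᵐ p : E d × E d, v p.1 = 0 :=
      Measure.quasiMeasurePreserving_fst.ae hv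
    filter_upwards [this] with p hp
    simp [hp]
  simp_rw [this]
  exact tendsto_const_nhds

end Oscillatory

/-! ### Localized pieces of the operator -/

section Pieces

open FourierTransform

variable {d : ℕ}

lemma continuous_mixedDeriv {a : E d → E d → ℂ}
    (ha : ContDiff ℝ ∞ (fun p : E d × E d => a p.1 p.2)) (k l : ℕ) :
    Continuous fun p : E d × E d => mixedDeriv a k l p.1 p.2 := by
  have h1 := contDiff_iteratedFDeriv_param ha l
  have h2 : ContDiff ℝ ∞ (fun p : E d × E d => iteratedFDeriv ℝ l (a p.2) p.1) :=
    h1.comp (contDiff_snd.prodMk contDiff_fst)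
  have h3 := (contDiff_iteratedFDeriv_param (f := fun ξ w => iteratedFDeriv ℝ l (a w) ξ)
    h2 k).continuous
  exact (h3.comp (continuous_snd.prodMk continuous_fst)).norm

lemma measurable_ofReal_mixedDeriv {a : E d → E d → ℂ}
    (ha : ContDiff ℝ ∞ (fun p : E d × E d => a p.1 p.2)) (k l : ℕ) :
    Measurable fun p : E d × E d => ENNReal.ofReal (mixedDeriv a k l p.1 p.2) :=
  (continuous_mixedDeriv ha k l).measurable.ennreal_ofReal

lemma mixedDerivL1_eq_lintegral {a : E d → E d → ℂ}
    (ha : ContDiff ℝ ∞ (fun p : E d × E d => a p.1 p.2)) (k l : ℕ) :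
    mixedDerivL1 a k l = ∫⁻ ξ, ∫⁻ w, ENNReal.ofReal (mixedDeriv a k l w ξ) :=
  lintegral_prod_symm _ (measurable_ofReal_mixedDeriv ha k l).aemeasurable

/-- The derivatives of order `l` in `ξ` are integrable, uniformly in `w`. -/
lemma exists_lintegral_iteratedFDeriv_le {a : E d → E d → ℂ}
    (ha : ContDiff ℝ ∞ (fun p : E d × E d => a p.1 p.2)) (l : ℕ)
    (hfin : ∀ k < d + 2, mixedDerivL1 a k l < ⊤) :
    ∃ C : ℝ, ∀ w, ∫⁻ ξ, ‖iteratedFDeriv ℝ l (a w) ξ‖ₑ ≤ ENNReal.ofReal C := by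
  obtain ⟨C, hC0, hC⟩ := exists_enorm_le_lintegral_iteratedFDeriv d
  have hlt : ENNReal.ofReal C * ∑ k ∈ Finset.range (d + 2), mixedDerivL1 a k l < ⊤ :=
    ENNReal.mul_lt_top ENNReal.ofReal_lt_top
      (ENNReal.sum_lt_top.2 fun k hk => hfin k (Finset.mem_range.1 hk))
  refine ⟨(ENNReal.ofReal C * ∑ k ∈ Finset.range (d + 2), mixedDerivL1 a k l).toReal,
    fun w => ?_⟩
  rw [ENNReal.ofReal_toReal hlt.ne]
  have hsm : ∀ ξ, ContDiff ℝ ∞ fun w => iteratedFDeriv ℝ l (a w) ξ := fun ξ =>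
    (contDiff_iteratedFDeriv_param ha l).comp (contDiff_id.prodMk contDiff_const)
  calc ∫⁻ ξ, ‖iteratedFDeriv ℝ l (a w) ξ‖ₑ
      ≤ ∫⁻ ξ, ENNReal.ofReal C * ∑ k ∈ Finset.range (d + 2),
          ∫⁻ w, ENNReal.ofReal (mixedDeriv a k l w ξ) := by
        refine lintegral_mono fun ξ => ?_
        refine (hC _ (hsm ξ) w).trans (le_of_eq ?_)
        simp only [mixedDeriv, ofReal_norm]
    _ = _ := by
        rw [lintegral_const_mul' _ _ ENNReal.ofReal_ne_top, lintegral_finsetSum]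
        · simp_rw [mixedDerivL1_eq_lintegral ha]
        · exact fun k _ => (measurable_ofReal_mixedDeriv ha k l).lintegral_prod_left'

/-- The pure derivative `∂_{ξ_i}^m a(w, ξ)`. -/
noncomputable def pureDeriv (a : E d → E d → ℂ) (i : Fin d) (m : ℕ) (w ξ : E d) : ℂ :=
  iteratedFDeriv ℝ m (a w) ξ (fun _ => EuclideanSpace.single i 1)

lemma contDiff_pureDeriv {a : E d → E d → ℂ}
    (ha : ContDiff ℝ ∞ (fun p : E d × E d => a p.1 p.2)) (i : Fin d) (m : ℕ) :
    ContDiff ℝ ∞ fun p : E d × E d => pureDeriv a i m p.1 p.2 :=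
  (ContinuousMultilinearMap.apply ℝ (fun _ : Fin m => E d) ℂ
    (fun _ => EuclideanSpace.single i 1)).contDiff.comp (contDiff_iteratedFDeriv_param ha m)

lemma norm_iteratedFDeriv_pureDeriv_le {a : E d → E d → ℂ}
    (ha : ContDiff ℝ ∞ (fun p : E d × E d => a p.1 p.2)) (i : Fin d) (m k : ℕ) (w ξ : E d) :
    ‖iteratedFDeriv ℝ k (fun w => pureDeriv a i m w ξ) w‖ ≤ mixedDeriv a k m w ξ := by
  have hsm : ContDiff ℝ ∞ fun w => iteratedFDeriv ℝ m (a w) ξ :=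
    (contDiff_iteratedFDeriv_param ha m).comp (contDiff_id.prodMk contDiff_const)
  set L := ContinuousMultilinearMap.apply ℝ (fun _ : Fin m => E d) ℂ
    (fun _ => EuclideanSpace.single i 1)
  have hL : ‖L‖ ≤ 1 := by
    refine L.opNorm_le_bound zero_le_one fun T => ?_
    rw [one_mul]
    refine (T.le_opNorm _).trans (mul_le_of_le_one_right (norm_nonneg _) ?_)
    refine Finset.prod_le_one (fun _ _ => norm_nonneg _) fun _ _ => ?_
    rw [PiLp.norm_single, norm_one]
  refine (L.norm_iteratedFDeriv_comp_left (f := fun w => iteratedFDeriv ℝ m (a w) ξ)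
    (N := ∞) hsm.contDiffAt (by exact_mod_cast le_top)).trans ?_
  exact mul_le_of_le_one_left (norm_nonneg _) hL

/-- The Fourier coefficient in `w` of `∂_{ξ_i}^m a(w, ξ)` localized near `s`. -/
noncomputable def pieceCoeff (a : E d → E d → ℂ) (i : Fin d) (m : ℕ) (r : ℝ) (s : E d)
    (p : E d × E d) : ℂ :=
  𝓕 (fun w => cutoff r s w • pureDeriv a i m w p.1) p.2

/-- `∑_{k ≤ d+1} ∬ |∇_w^k ∇_ξ^m a(w, ξ)| dw dξ`, with `w` restricted to the ball of radius `2 r`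
around `s`. -/
noncomputable def localMass (a : E d → E d → ℂ) (m : ℕ) (r : ℝ) (s : E d) : ℝ≥0∞ :=
  ∑ k ∈ Finset.range (d + 2),
    ∫⁻ ξ, ∫⁻ w in Metric.closedBall s (2 * r), ENNReal.ofReal (mixedDeriv a k m w ξ)

lemma aestronglyMeasurable_pieceCoeff {a : E d → E d → ℂ}
    (ha : ContDiff ℝ ∞ (fun p : E d × E d => a p.1 p.2)) (i : Fin d) (m : ℕ) (r : ℝ) (s : E d) :
    AEStronglyMeasurable (pieceCoeff a i m r s) := by
  have h1 : pieceCoeff a i m r s = fun p => ∫ w, Complex.exp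
      (((-2 * Real.pi * inner ℝ w p.2 : ℝ) : ℂ) * Complex.I) •
        (cutoff r s w • pureDeriv a i m w p.1) := by
    ext p
    rw [pieceCoeff, Real.fourier_eq']
  rw [h1]
  have h2 : Continuous fun q : (E d × E d) × E d => Complex.exp
      (((-2 * Real.pi * inner ℝ q.2 q.1.2 : ℝ) : ℂ) * Complex.I) •
        (cutoff r s q.2 • pureDeriv a i m q.2 q.1.1) := by
    have h3 : Continuous fun q : (E d × E d) × E d => cutoff r s q.2 :=
      (contDiff_cutoff r s).continuous.comp continuous_snd
    have h4 : Continuous fun q : (E d × E d) × E d => pureDeriv a i m q.2 q.1.1 :=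
      (contDiff_pureDeriv ha i m).continuous.comp
        (f := fun q : (E d × E d) × E d => (q.2, q.1.1)) (by fun_prop)
    fun_prop
  exact (h2.stronglyMeasurable.integral_prod_right').aestronglyMeasurable

lemma exists_lintegral_pieceCoeff_le (d : ℕ) : ∃ C : ℝ, 0 ≤ C ∧ ∀ {a : E d → E d → ℂ},
    ContDiff ℝ ∞ (fun p : E d × E d => a p.1 p.2) → ∀ (i : Fin d) (m : ℕ) (r : ℝ), 1 ≤ r →
      ∀ s : E d, ∫⁻ p, ‖pieceCoeff a i m r s p‖ₑ ≤ ENNReal.ofReal C * localMass a m r s := by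
  obtain ⟨C, hC0, hC⟩ := exists_lintegral_fourier_cutoff_le d
  refine ⟨C, hC0, ?_⟩
  intro a ha i m r hr s
  have hsm : ∀ ξ, ContDiff ℝ ∞ fun w => pureDeriv a i m w ξ := fun ξ =>
    (contDiff_pureDeriv ha i m).comp (contDiff_id.prodMk contDiff_const)
  have h0 : ∫⁻ p, ‖pieceCoeff a i m r s p‖ₑ = ∫⁻ ξ, ∫⁻ θ, ‖pieceCoeff a i m r s (ξ, θ)‖ₑ :=
    lintegral_prod _ (aestronglyMeasurable_pieceCoeff ha i m r s).enorm
  rw [h0]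
  calc ∫⁻ ξ, ∫⁻ θ, ‖pieceCoeff a i m r s (ξ, θ)‖ₑ
      ≤ ∫⁻ ξ, ENNReal.ofReal C * ∑ k ∈ Finset.range (d + 2),
          ∫⁻ w in Metric.closedBall s (2 * r), ENNReal.ofReal (mixedDeriv a k m w ξ) := by
        refine lintegral_mono fun ξ => ?_
        refine ((hC _ (hsm ξ) r hr s).2).trans ?_
        gcongr with k hk w
        rw [← ofReal_norm]
        exact ENNReal.ofReal_le_ofReal (norm_iteratedFDeriv_pureDeriv_le ha i m k w ξ)
    _ = _ := by
        rw [lintegral_const_mul' _ _ ENNReal.ofReal_ne_top, lintegral_finsetSum]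
        · rfl
        · exact fun k _ => (measurable_ofReal_mixedDeriv ha k m).lintegral_prod_left'

lemma phase_add_left (α : ℝ) (z z' ξ : E d) :
    phase α (z + z') ξ = phase α z ξ * phase α z' ξ := by
  rw [phase, phase, phase, ← Complex.exp_add, inner_add_left]
  congr 1
  push_cast
  ring

lemma phase_smul_left (α c : ℝ) (z ξ : E d) : phase α (c • z) ξ = phase (α * c) z ξ := by
  rw [phase, phase, inner_smul_left]
  simp only [conj_trivial, mul_assoc]

/-- `T` is the part of `h₁ op_{α,t}(a) h₂` that maps functions on `S₂` to functions on `S₁`: it is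
an integral operator, and its integrals give the values of the quantization. -/
def IsPieceOp (h₁ h₂ : E d → ℂ) (α t : ℝ) (a : E d → E d → ℂ) (S₁ S₂ : Set (E d))
    (T : L2 d →L[ℂ] L2 d) : Prop :=
  ∃ G : E d → E d → ℂ,
    (∀ u : L2 d, ∀ᵐ x, T u x = S₁.indicator h₁ x * ∫ y, G x y * (S₂.indicator h₂ y * u y)) ∧
    ∀ φ : E d → ℂ, ContDiff ℝ ∞ φ → HasCompactSupport φ → ∀ᵐ x, x ∈ S₁ → h₁ x ≠ 0 →
      HasOpValue α t a (fun y => S₂.indicator h₂ y * φ y) x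
        (∫ y, G x y * (S₂.indicator h₂ y * φ y))

/-- The nuclear bound for a piece. On `S₁ × S₂` the kernel is
`(i / (α (x_i - y_i)))^m ∫ e^{iα(x-y)·ξ} ∂_{ξ_i}^m a(w, ξ) dξ` with `w = (1-t) x + t y`. The Fourier
expansion of `∂_{ξ_i}^m a(·, ξ)` near `s` separates the variables `x` and `y` in the integral; a
separation of the first factor is the datum `wt`, `A`, `B`. -/
theorem exists_pieceOp (d : ℕ) : ∃ C : ℝ, 0 ≤ C ∧
    ∀ {h₁ h₂ : E d → ℂ} {a : E d → E d → ℂ} {α t r : ℝ} {s : E d} {S₁ S₂ : Set (E d)} (i : Fin d)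
      (m : ℕ) (ν : Measure ℝ) [SFinite ν] {wt : ℝ → ℂ} {A B : ℝ → E d → ℂ},
      0 < α → 1 ≤ r → MemLp (S₁.indicator h₁) 2 volume → MemLp (S₂.indicator h₂) 2 volume →
      ContDiff ℝ ∞ (fun p : E d × E d => a p.1 p.2) →
      (∀ k < d + 2, mixedDerivL1 a k m < ⊤) →
      (∀ x ∈ S₁, ∀ y ∈ S₂, dist ((1 - t) • x + t • y) s ≤ r) →
      (m ≠ 0 → ∃ κ > 0, ∀ x ∈ S₁, ∀ y ∈ S₂, κ ≤ |x i - y i|) →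
      Integrable wt ν → Measurable (Function.uncurry A) → Measurable (Function.uncurry B) →
      (∀ l x, ‖A l x‖ ≤ 1) → (∀ l x, ‖B l x‖ ≤ 1) →
      (∀ x ∈ S₁, ∀ y ∈ S₂,
        ∫ l, wt l * A l x * B l y ∂ν = (Complex.I / ((α * (x i - y i) : ℝ) : ℂ)) ^ m) →
      ∃ T : L2 d →L[ℂ] L2 d, IsPieceOp h₁ h₂ α t a S₁ S₂ T ∧
        HasNuclearBound T (ENNReal.ofReal (C * α ^ d) * (∫⁻ l, ‖wt l‖ₑ ∂ν) * localMass a m r s *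
          eLpNorm (S₁.indicator h₁) 2 volume * eLpNorm (S₂.indicator h₂) 2 volume) := by
  obtain ⟨C, hC0, hC⟩ := exists_lintegral_pieceCoeff_le d
  refine ⟨C, hC0, ?_⟩
  intro h₁ h₂ a α t r s S₁ S₂ i m ν _ wt A B hα hr hp hq ha hfin hs hκ hwt hA hB hA1 hB1 hAB
  set K : ℂ := (((α / (2 * Real.pi)) ^ d : ℝ) : ℂ) with hK
  have hKle : ‖K‖ₑ ≤ ENNReal.ofReal (α ^ d) := by
    rw [hK, ← ofReal_norm, Complex.norm_real, Real.norm_of_nonneg (by positivity)]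
    refine ENNReal.ofReal_le_ofReal (pow_le_pow_left₀ (by positivity) ?_ d)
    refine div_le_self hα.le ?_
    linarith [Real.pi_gt_three]
  have hmass : localMass a m r s < ⊤ := by
    refine ENNReal.sum_lt_top.2 fun k hk => lt_of_le_of_lt ?_ (hfin k (Finset.mem_range.1 hk))
    rw [mixedDerivL1_eq_lintegral ha]
    exact lintegral_mono fun ξ => setLIntegral_le_lintegral _ _
  have hc : Integrable (pieceCoeff a i m r s) :=
    ⟨aestronglyMeasurable_pieceCoeff ha i m r s, (hC ha i m r hr s).trans_lt
      (ENNReal.mul_lt_top ENNReal.ofReal_lt_top hmass)⟩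
  set c : (E d × E d) × ℝ → ℂ := fun q => K * (pieceCoeff a i m r s q.1 * wt q.2) with hcdef
  have hcint : Integrable c ((volume : Measure (E d × E d)).prod ν) :=
    (hc.mul_prod hwt).const_mul K
  set A' : (E d × E d) × ℝ → E d → ℂ := fun q x =>
    phase α x q.1.1 * phase (2 * Real.pi * (1 - t)) x q.1.2 * A q.2 x with hA'
  set B' : (E d × E d) × ℝ → E d → ℂ := fun q y =>
    phase α (-y) q.1.1 * phase (2 * Real.pi * t) y q.1.2 * B q.2 y with hB'
  have hA'm : Measurable (Function.uncurry A') := by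
    refine (Measurable.mul ?_ ?_).mul ?_
    · exact ((continuous_phase α).comp (f := fun p : ((E d × E d) × ℝ) × E d => (p.2, p.1.1.1))
        (by fun_prop)).measurable
    · exact ((continuous_phase _).comp (f := fun p : ((E d × E d) × ℝ) × E d => (p.2, p.1.1.2))
        (by fun_prop)).measurable
    · exact hA.comp (g := Function.uncurry A)
        (f := fun p : ((E d × E d) × ℝ) × E d => (p.1.2, p.2)) (by fun_prop)
  have hB'm : Measurable (Function.uncurry B') := by
    refine (Measurable.mul ?_ ?_).mul ?_
    · exact ((continuous_phase α).comp (f := fun p : ((E d × E d) × ℝ) × E d => (-p.2, p.1.1.1))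
        (by fun_prop)).measurable
    · exact ((continuous_phase _).comp (f := fun p : ((E d × E d) × ℝ) × E d => (p.2, p.1.1.2))
        (by fun_prop)).measurable
    · exact hB.comp (g := Function.uncurry B)
        (f := fun p : ((E d × E d) × ℝ) × E d => (p.1.2, p.2)) (by fun_prop)
  have hA'1 : ∀ q x, ‖A' q x‖ ≤ 1 := fun q x => by
    simp only [hA', norm_mul, norm_phase, one_mul]; exact hA1 _ _
  have hB'1 : ∀ q x, ‖B' q x‖ ≤ 1 := fun q x => by
    simp only [hB', norm_mul, norm_phase, one_mul]; exact hB1 _ _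
  obtain ⟨T, hT1, hT2⟩ := exists_kernelOp hp hq hcint hA'm hB'm hA'1 hB'1
  have hsm : ∀ ξ, ContDiff ℝ ∞ fun w => pureDeriv a i m w ξ := fun ξ =>
    (contDiff_pureDeriv ha i m).comp (contDiff_id.prodMk contDiff_const)
  -- the kernel on `S₁ × S₂`
  have hG : ∀ x ∈ S₁, ∀ y ∈ S₂,
      ∫ q, c q * A' q x * B' q y ∂((volume : Measure (E d × E d)).prod ν) =
        K * ((Complex.I / ((α * (x i - y i) : ℝ) : ℂ)) ^ m *
          ∫ ξ, phase α (x - y) ξ * pureDeriv a i m ((1 - t) • x + t • y) ξ) := by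
    intro x hx y hy
    have hphase : ∀ p : E d × E d, phase α x p.1 * phase (2 * Real.pi * (1 - t)) x p.2 *
        (phase α (-y) p.1 * phase (2 * Real.pi * t) y p.2) =
        phase α (x - y) p.1 * phase (2 * Real.pi) ((1 - t) • x + t • y) p.2 := by
      intro p
      rw [sub_eq_add_neg x y, phase_add_left, phase_add_left, phase_smul_left, phase_smul_left]
      ring
    have h1 : ∀ q : (E d × E d) × ℝ, c q * A' q x * B' q y =
        (K * (phase α (x - y) q.1.1 * phase (2 * Real.pi) ((1 - t) • x + t • y) q.1.2 *
          pieceCoeff a i m r s q.1)) * (wt q.2 * A q.2 x * B q.2 y) := by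
      intro q
      rw [← hphase]
      simp only [hcdef, hA', hB']
      ring
    simp_rw [h1]
    rw [integral_prod_mul (μ := (volume : Measure (E d × E d))) (ν := ν)
      (fun p => K * (phase α (x - y) p.1 * phase (2 * Real.pi) ((1 - t) • x + t • y) p.2 *
          pieceCoeff a i m r s p)) (fun l => wt l * A l x * B l y), hAB x hx y hy,
      integral_const_mul]
    have hint : Integrable fun p : E d × E d => phase α (x - y) p.1 *
        phase (2 * Real.pi) ((1 - t) • x + t • y) p.2 * pieceCoeff a i m r s p := by
      refine hc.bdd_mul (c := 1) (Continuous.aestronglyMeasurable ?_) (ae_of_all _ fun p => ?_)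
      · exact ((continuous_phase α).comp (f := fun p : E d × E d => (x - y, p.1))
          (by fun_prop)).mul ((continuous_phase _).comp
            (f := fun p : E d × E d => ((1 - t) • x + t • y, p.2)) (by fun_prop))
      · rw [norm_mul, norm_phase, norm_phase, one_mul]
    have h2 : ∫ p : E d × E d, phase α (x - y) p.1 *
        phase (2 * Real.pi) ((1 - t) • x + t • y) p.2 * pieceCoeff a i m r s p =
        ∫ ξ, phase α (x - y) ξ * pureDeriv a i m ((1 - t) • x + t • y) ξ := by
      refine (integral_prod _ hint).trans ?_
      refine integral_congr_ae (ae_of_all _ fun ξ => ?_)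
      simp only [mul_assoc]
      rw [integral_const_mul, ← integral_fourier_cutoff_eq (hsm ξ) hr (hs x hx y hy)]
      congr 1
      refine integral_congr_ae (ae_of_all _ fun θ => ?_)
      simp only [pieceCoeff, phase, smul_eq_mul]
      rw [real_inner_comm, mul_comm Complex.I]
    rw [h2]
    ring
  refine ⟨T, ⟨_, hT1, fun φ hφ hφc => ae_of_all _ fun x hx _ => ?_⟩, hT2.mono ?_⟩
  · have hv : Integrable (fun y => S₂.indicator h₂ y * φ y) :=
      hq.integrable_mul (q := 2) (hφ.continuous.memLp_of_hasCompactSupport hφc)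
    have hval := hasOpValue_of_iteratedFDeriv ha (t := t) hα.ne' hv hφc.isCompact
      (fun y hy => by rw [image_eq_zero_of_notMem_tsupport hy, mul_zero]) x i m
      (fun hm0 => by
        obtain ⟨κ, hκ0, hκ⟩ := hκ hm0
        refine ⟨κ, hκ0, fun y hy => hκ x hx y ?_⟩
        by_contra h
        rw [Set.indicator_of_notMem h, zero_mul] at hy
        exact hy rfl)
      (exists_lintegral_iteratedFDeriv_le ha m hfin)
    have heq : K * ∫ y, ((Complex.I / ((α * (x i - y i) : ℝ) : ℂ)) ^ m *
        ∫ ξ, phase α (x - y) ξ * iteratedFDeriv ℝ m (a ((1 - t) • x + t • y)) ξ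
          (fun _ => EuclideanSpace.single i 1)) * (S₂.indicator h₂ y * φ y) =
        ∫ y, (∫ q, c q * A' q x * B' q y ∂((volume : Measure (E d × E d)).prod ν)) *
          (S₂.indicator h₂ y * φ y) := by
      rw [← integral_const_mul]
      refine integral_congr_ae (ae_of_all _ fun y => ?_)
      by_cases hy : y ∈ S₂
      · simp only []
        rw [hG x hx y hy]
        simp only [pureDeriv]
        ring
      · simp [Set.indicator_of_notMem hy]
    rw [← heq]
    exact hval
  · have h1 : ∫⁻ q, ‖c q‖ₑ ∂((volume : Measure (E d × E d)).prod ν) ≤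
        ENNReal.ofReal (α ^ d) * ((ENNReal.ofReal C * localMass a m r s) * ∫⁻ l, ‖wt l‖ₑ ∂ν) := by
      simp only [hcdef, enorm_mul]
      rw [lintegral_const_mul' _ _ enorm_ne_top, lintegral_prod_mul hc.aestronglyMeasurable.enorm
        hwt.aestronglyMeasurable.enorm]
      gcongr
      exact hC ha i m r hr s
    gcongr
    refine h1.trans (le_of_eq ?_)
    rw [ENNReal.ofReal_mul hC0]
    ring

end Pieces

/-! ### Partition into cells -/

section Cells

variable {d : ℕ}

/-- The index of the lattice cell of side `ρ` that contains `x`. -/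
noncomputable def cellIndex (ρ : ℝ) (x : E d) (i : Fin d) : ℤ := ⌊x i / ρ⌋

/-- The half-open cube of side `ρ` with lower corner `ρ j`. -/
def cell (ρ : ℝ) (j : Fin d → ℤ) : Set (E d) := {x | cellIndex ρ x = j}

lemma measurable_cellIndex (ρ : ℝ) : Measurable (cellIndex ρ : E d → Fin d → ℤ) := by
  refine measurable_pi_lambda _ fun i => Int.measurable_floor.comp ?_
  fun_prop

lemma measurableSet_cell (ρ : ℝ) (j : Fin d → ℤ) : MeasurableSet (cell ρ j : Set (E d)) :=
  measurable_cellIndex ρ (measurableSet_singleton j)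

lemma mem_cell_cellIndex (ρ : ℝ) (x : E d) : x ∈ cell ρ (cellIndex ρ x) := rfl

/-- A compact set meets only finitely many cells. -/
lemma exists_finset_cellIndex {ρ : ℝ} (hρ : 0 < ρ) {K : Set (E d)} (hK : IsCompact K) :
    ∃ s : Finset (Fin d → ℤ), ∀ x ∈ K, cellIndex ρ x ∈ s := by
  obtain ⟨R, hR⟩ := hK.isBounded.subset_closedBall 0
  refine ⟨Fintype.piFinset fun _ => Finset.Icc ⌊-R / ρ⌋ ⌊R / ρ⌋, fun x hx => ?_⟩
  rw [Fintype.mem_piFinset]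
  intro i
  have h1 : |x i| ≤ R :=
    (PiLp.norm_apply_le x i).trans (mem_closedBall_zero_iff.1 (hR hx))
  rw [Finset.mem_Icc]
  rw [abs_le] at h1
  constructor <;> refine Int.floor_le_floor (div_le_div_of_nonneg_right ?_ hρ.le)
  · exact h1.1
  · exact h1.2

lemma sum_indicator_cell {ρ : ℝ} {s : Finset (Fin d → ℤ)} {f : E d → ℂ} {y : E d}
    (hy : cellIndex ρ y ∈ s) : ∑ k ∈ s, (cell ρ k).indicator f y = f y := by
  rw [Finset.sum_eq_single_of_mem _ hy, Set.indicator_of_mem (mem_cell_cellIndex ρ y)]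
  intro k _ hk
  refine Set.indicator_of_notMem ?_ _
  exact fun h => hk h.symm

/-- Summation of the pieces: over each cell only the pieces of one row are non-zero, and on a test
function only finitely many of these, so that the sum acts as the quantization does. -/
theorem exists_isWeightedOp_of_pieces {h₁ h₂ : E d → ℂ} {α t ρ : ℝ} {a : E d → E d → ℂ}
    (hρ : 0 < ρ) (ha : ContDiff ℝ ∞ (fun p : E d × E d => a p.1 p.2))
    (hh₂ : ∀ k, MemLp ((cell ρ k).indicator h₂) 2 volume)
    {T : (Fin d → ℤ) × (Fin d → ℤ) → L2 d →L[ℂ] L2 d} {M : (Fin d → ℤ) × (Fin d → ℤ) → ℝ≥0∞}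
    (hT : ∀ p, IsPieceOp h₁ h₂ α t a (cell ρ p.1) (cell ρ p.2) (T p))
    (hM : ∀ p, HasNuclearBound (T p) (M p)) (hsum : ∑' p, M p < ⊤) :
    ∃ S : L2 d →L[ℂ] L2 d, IsWeightedOp h₁ h₂ α t a S ∧ IsTraceClass S ∧
      traceNorm S ≤ 4 * ∑' p, M p := by
  have hsummable : Summable T := by
    have h1 : ∑' p, ‖T p‖ₑ ≠ ⊤ :=
      ((ENNReal.tsum_le_tsum fun p => (hM p).enorm_le).trans_lt hsum).ne
    refine Summable.of_norm ?_
    simpa only [toReal_enorm] using ENNReal.summable_toReal h1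
  obtain ⟨S, hS⟩ := hsummable
  have hnuc : HasNuclearBound S (∑' p, M p) := .of_hasSum hM hS
  refine ⟨S, ?_, isTraceClass_of_traceNorm_lt_top (hnuc.traceNorm_le.trans_lt
    (ENNReal.mul_lt_top (by simp) hsum)), hnuc.traceNorm_le⟩
  intro u φ hφ hφc hu
  obtain ⟨s, hs⟩ := exists_finset_cellIndex hρ hφc.isCompact
  choose G hG hGφ using hT
  have hsupp : ∀ y, φ y ≠ 0 → cellIndex ρ y ∈ s := fun y hy => hs y (subset_tsupport φ hy)
  have hpt : ∀ p, ∀ᵐ x, T p u x = (cell ρ p.1).indicator h₁ x *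
      ∫ y, G p x y * ((cell ρ p.2).indicator h₂ y * φ y) := by
    intro p
    filter_upwards [hG p u] with x hx
    rw [hx]
    congr 1
    refine integral_congr_ae ?_
    filter_upwards [hu] with y hy
    rw [hy]
  -- Only the finitely many columns that meet the support of the test function contribute.
  have hzero : ∀ p, p.2 ∉ s → T p u = 0 := by
    intro p hp
    refine Lp.ext ?_
    filter_upwards [hpt p, Lp.coeFn_zero ℂ 2 (volume : Measure (E d))] with x hx hx0
    rw [hx, hx0, integral_eq_zero_of_ae, mul_zero, Pi.zero_apply]
    refine ae_of_all _ fun y => ?_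
    by_cases hy : φ y = 0
    · simp [hy]
    · have : y ∉ cell ρ p.2 := fun h => hp (by
        have h' : cellIndex ρ y = p.2 := h
        rw [← h']; exact hsupp y hy)
      simp [Set.indicator_of_notMem this]
  -- Restriction to a cell is continuous and kills all rows but one.
  have hrow : ∀ j, ∀ᵐ x, x ∈ cell ρ j → S u x = ∑ k ∈ s, T (j, k) u x := by
    intro j
    set R := LpToLpRestrictCLM (E d) ℂ ℂ volume 2 (cell ρ j)
    have h1 : HasSum (fun p => R (T p u)) (R (S u)) :=
      ((R.comp (ContinuousLinearMap.apply ℂ (L2 d) u)).hasSum hS)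
    have h2 : ∀ p ∉ ({j} : Finset (Fin d → ℤ)) ×ˢ s, R (T p u) = 0 := by
      intro p hp
      rw [Finset.mem_product, Finset.mem_singleton, not_and_or] at hp
      rcases hp with hp | hp
      · refine Lp.ext ?_
        filter_upwards [LpToLpRestrictCLM_coeFn ℂ (cell ρ j) (T p u),
          Lp.coeFn_zero ℂ 2 (volume.restrict (cell ρ j)), ae_restrict_of_ae (hpt p),
          ae_restrict_mem (measurableSet_cell ρ j)] with x hx hx0 hxp hxj
        rw [hx, hx0, hxp, Set.indicator_of_notMem, zero_mul, Pi.zero_apply]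
        intro h
        exact hp (h.symm.trans hxj)
      · rw [hzero p hp, map_zero]
    have h3 : R (S u) = R (∑ k ∈ s, T (j, k) u) := by
      rw [h1.unique (hasSum_sum_of_ne_finset_zero h2), Finset.sum_product, Finset.sum_singleton,
        map_sum]
    rw [← ae_restrict_iff' (measurableSet_cell ρ j)]
    have h4 := Lp.coeFn_finsetSum (p := 2) (μ := (volume : Measure (E d))) s (fun k => T (j, k) u)
    filter_upwards [LpToLpRestrictCLM_coeFn ℂ (cell ρ j) (S u),
      LpToLpRestrictCLM_coeFn ℂ (cell ρ j) (∑ k ∈ s, T (j, k) u), ae_restrict_of_ae h4]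
      with x hx hx' hx4
    rw [← hx, h3, hx', hx4]
    simp
  have hint : ∀ k, Integrable (fun y => (cell ρ k).indicator h₂ y * φ y) := fun k =>
    (hh₂ k).integrable_mul (q := 2) (hφ.continuous.memLp_of_hasCompactSupport hφc)
  filter_upwards [ae_all_iff.2 hrow, ae_all_iff.2 hpt,
    ae_all_iff.2 fun p => hGφ p φ hφ hφc] with x hx1 hx2 hx3
  set j := cellIndex ρ x with hj
  have hxj : x ∈ cell ρ j := rfl
  refine ⟨∑ k ∈ s, ∫ y, G (j, k) x y * ((cell ρ k).indicator h₂ y * φ y), fun hh₁ => ?_, ?_⟩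
  · have h5 := HasOpValue.sum s ha (fun k _ => hint k) hφc.isCompact
      (fun k _ y hy => by rw [image_eq_zero_of_notMem_tsupport hy, mul_zero])
      (fun k _ => hx3 (j, k) hxj hh₁)
    have h6 : (fun y => ∑ k ∈ s, (cell ρ k).indicator h₂ y * φ y) = fun y => h₂ y * φ y := by
      ext y
      by_cases hy : φ y = 0
      · simp [hy]
      · rw [← Finset.sum_mul, sum_indicator_cell (hsupp y hy)]
    rwa [h6] at h5
  · rw [hx1 j hxj, Finset.mul_sum]
    refine Finset.sum_congr rfl fun k _ => ?_
    rw [hx2 (j, k), Set.indicator_of_mem hxj]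

lemma norm_le_of_forall_abs_le {x : E d} {c : ℝ} (hc : 0 ≤ c) (hx : ∀ i, |x i| ≤ c) :
    ‖x‖ ≤ d * c := by
  rw [EuclideanSpace.norm_eq]
  refine Real.sqrt_le_iff.2 ⟨by positivity, ?_⟩
  calc ∑ i, ‖x i‖ ^ 2 ≤ ∑ _i : Fin d, c ^ 2 := by
        gcongr with i
        exact hx i
    _ = d * c ^ 2 := by simp
    _ ≤ (d : ℝ) ^ 2 * c ^ 2 := by
        gcongr
        exact_mod_cast Nat.le_self_pow two_ne_zero d
    _ = _ := by ring

/-- The centre of a cell. -/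
noncomputable def cellCenter (ρ : ℝ) (j : Fin d → ℤ) : E d :=
  WithLp.toLp 2 fun i => ρ * (j i + 1 / 2)

@[simp] lemma cellCenter_apply (ρ : ℝ) (j : Fin d → ℤ) (i : Fin d) :
    cellCenter ρ j i = ρ * (j i + 1 / 2) := rfl

lemma abs_sub_cellCenter_le {ρ : ℝ} (hρ : 0 < ρ) {j : Fin d → ℤ} {x : E d} (hx : x ∈ cell ρ j)
    (i : Fin d) : |x i - cellCenter ρ j i| ≤ ρ / 2 := by
  have h1 : ⌊x i / ρ⌋ = j i := congrFun hx i
  have h2 := Int.floor_le (x i / ρ)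
  have h3 := Int.lt_floor_add_one (x i / ρ)
  rw [h1] at h2 h3
  rw [le_div_iff₀ hρ] at h2
  rw [div_lt_iff₀ hρ] at h3
  rw [cellCenter_apply, abs_le]
  constructor <;> nlinarith

lemma dist_cellCenter_le {ρ : ℝ} (hρ : 0 < ρ) {j : Fin d → ℤ} {x : E d} (hx : x ∈ cell ρ j) :
    ‖x - cellCenter ρ j‖ ≤ d * (ρ / 2) :=
  norm_le_of_forall_abs_le (by positivity) fun i => abs_sub_cellCenter_le hρ hx i

/-! ### The lattice norm and cells -/

lemma measurableSet_setOf_abs_sub_le {c : ℝ} :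
    MeasurableSet {p : E d × E d | ∀ i, |p.1 i - p.2 i| ≤ c} := by
  rw [Set.ofPred_forall]
  refine MeasurableSet.iInter fun i => measurableSet_le ?_ measurable_const
  fun_prop

lemma volume_setOf_abs_sub_le (x : E d) {c : ℝ} (hc : 0 ≤ c) :
    volume {u : E d | ∀ i, |u i - x i| ≤ c} = ENNReal.ofReal ((2 * c) ^ d) := by
  have h1 : {u : E d | ∀ i, |u i - x i| ≤ c} = (WithLp.ofLp) ⁻¹'
      Set.Icc (fun i => x i - c) (fun i => x i + c) := by
    ext u
    simp only [Set.mem_ofPred_eq, Set.mem_preimage, Set.mem_Icc, Pi.le_def, abs_le, ← forall_and]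
    refine forall_congr' fun i => ?_
    constructor <;> rintro ⟨h1, h2⟩ <;> constructor <;> linarith
  rw [h1, (PiLp.volume_preserving_ofLp (Fin d)).measure_preimage measurableSet_Icc.nullMeasurableSet,
    Real.volume_Icc_pi]
  have h2 : ∀ i : Fin d, x i + c - (x i - c) = 2 * c := fun i => by ring
  simp_rw [h2]
  rw [Finset.prod_const, Finset.card_univ, Fintype.card_fin, ENNReal.ofReal_pow (by positivity)]

lemma lintegral_unitCube_le (h : E d → ℂ) (u : E d) :
    ∫⁻ x in unitCube u, ‖h x‖ₑ ^ 2 ≤ latticeNorm h ^ 2 := by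
  have h1 : (∫⁻ x in unitCube u, ‖h x‖ₑ ^ 2) ^ (1 / 2 : ℝ) ≤ latticeNorm h :=
    le_iSup (fun u : E d => (∫⁻ x in unitCube u, ‖h x‖ₑ ^ 2) ^ (1 / 2 : ℝ)) u
  calc ∫⁻ x in unitCube u, ‖h x‖ₑ ^ 2
      = ((∫⁻ x in unitCube u, ‖h x‖ₑ ^ 2) ^ (1 / 2 : ℝ)) ^ 2 := by
        rw [← ENNReal.rpow_natCast, ← ENNReal.rpow_mul]
        norm_num
    _ ≤ _ := by gcongr

/-- Average over the unit cubes that meet the cell. -/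
lemma setLIntegral_cell_le {h : E d → ℂ} (hh : AEStronglyMeasurable h volume) {ρ : ℝ} (hρ : 0 < ρ)
    (j : Fin d → ℤ) :
    ∫⁻ x in cell ρ j, ‖h x‖ₑ ^ 2 ≤ ENNReal.ofReal ((ρ + 1) ^ d) * latticeNorm h ^ 2 := by
  set D : Set (E d × E d) := {p | ∀ i, |p.1 i - p.2 i| ≤ 1 / 2} with hD
  have hDm : MeasurableSet D := measurableSet_setOf_abs_sub_le
  set g : E d × E d → ℝ≥0∞ := D.indicator fun _ => 1
  have hg : Measurable g := measurable_const.indicator hDm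
  set B : Set (E d) := {u | ∀ i, |u i - cellCenter ρ j i| ≤ (ρ + 1) / 2} with hB
  have hBm : MeasurableSet B := by
    rw [hB, Set.ofPred_forall]
    refine MeasurableSet.iInter fun i => measurableSet_le ?_ measurable_const
    fun_prop
  have hhm : AEMeasurable (fun x => ‖h x‖ₑ ^ 2) (volume.restrict (cell ρ j)) :=
    (hh.enorm.pow_const 2).restrict
  have h1 : ∀ x, ∫⁻ u, g (x, u) = 1 := by
    intro x
    have h2 : ∀ u, g (x, u) = {u : E d | ∀ i, |u i - x i| ≤ 1 / 2}.indicator (fun _ => 1) u := by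
      intro u
      by_cases hu : (x, u) ∈ D
      · rw [show g (x, u) = 1 from Set.indicator_of_mem hu _, Set.indicator_of_mem]
        intro i
        rw [abs_sub_comm]
        exact hu i
      · rw [show g (x, u) = 0 from Set.indicator_of_notMem hu _, Set.indicator_of_notMem]
        intro hu'
        refine hu fun i => ?_
        rw [abs_sub_comm]
        exact hu' i
    simp_rw [h2]
    have h3 : MeasurableSet {u : E d | ∀ i, |u i - x i| ≤ 1 / 2} := by
      rw [Set.ofPred_forall]
      refine MeasurableSet.iInter fun i => measurableSet_le ?_ measurable_const
      fun_prop
    rw [lintegral_indicator_const h3, volume_setOf_abs_sub_le x (by norm_num)]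
    norm_num
  calc ∫⁻ x in cell ρ j, ‖h x‖ₑ ^ 2 = ∫⁻ x in cell ρ j, ∫⁻ u, ‖h x‖ₑ ^ 2 * g (x, u) := by
        refine lintegral_congr fun x => ?_
        rw [lintegral_const_mul (f := fun u => g (x, u)) _ (hg.comp measurable_prodMk_left), h1, mul_one]
    _ = ∫⁻ u, ∫⁻ x in cell ρ j, ‖h x‖ₑ ^ 2 * g (x, u) := by
        refine lintegral_lintegral_swap ?_
        exact (hhm.comp_quasiMeasurePreserving Measure.quasiMeasurePreserving_fst).mul
          hg.aemeasurable
    _ ≤ ∫⁻ u, B.indicator (fun _ => latticeNorm h ^ 2) u := by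
        refine lintegral_mono fun u => ?_
        by_cases hu : u ∈ B
        · rw [Set.indicator_of_mem hu]
          refine le_trans ?_ (lintegral_unitCube_le h u)
          have hcube : MeasurableSet (unitCube u) := by
            rw [unitCube, Set.ofPred_forall]
            refine MeasurableSet.iInter fun i => measurableSet_le ?_ measurable_const
            fun_prop
          rw [← lintegral_indicator hcube]
          refine (setLIntegral_le_lintegral _ _).trans (lintegral_mono fun x => ?_)
          by_cases hx : x ∈ unitCube u
          · rw [Set.indicator_of_mem hx]
            exact mul_le_of_le_one_right bot_le (Set.indicator_le_self' (by simp) _)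
          · have : (x, u) ∉ D := hx
            rw [show g (x, u) = 0 from Set.indicator_of_notMem this _, mul_zero]
            exact bot_le
        · rw [Set.indicator_of_notMem hu, nonpos_iff_eq_zero,
            setLIntegral_congr_fun (g := fun _ => 0) (measurableSet_cell ρ j), lintegral_zero]
          intro x hx
          have : (x, u) ∉ D := by
            intro hxu
            refine hu fun i => ?_
            have h4 := abs_sub_cellCenter_le hρ hx i
            have h5 : |x i - u i| ≤ 1 / 2 := hxu i
            rw [abs_le] at h4 h5 ⊢
            constructor <;> linarith [h4.1, h4.2, h5.1, h5.2]
          change ‖h x‖ₑ ^ 2 * g (x, u) = 0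
          rw [show g (x, u) = 0 from Set.indicator_of_notMem this _, mul_zero]
    _ = _ := by
        rw [lintegral_indicator_const hBm, volume_setOf_abs_sub_le _ (by positivity), mul_comm]
        congr 3
        ring

lemma eLpNorm_indicator_cell_le {h : E d → ℂ} (hh : AEStronglyMeasurable h volume) {ρ : ℝ}
    (hρ : 0 < ρ) (j : Fin d → ℤ) : eLpNorm ((cell ρ j).indicator h) 2 volume ≤
      ENNReal.ofReal ((ρ + 1) ^ d) ^ (1 / 2 : ℝ) * latticeNorm h := by
  rw [eLpNorm_indicator_eq_eLpNorm_restrict (measurableSet_cell ρ j),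
    eLpNorm_eq_lintegral_rpow_enorm_toReal two_ne_zero ENNReal.ofNat_ne_top]
  have h2 : ∀ x, ‖h x‖ₑ ^ (2 : ℝ≥0∞).toReal = ‖h x‖ₑ ^ 2 := fun x => by
    rw [ENNReal.toReal_ofNat, ← ENNReal.rpow_natCast]; norm_num
  simp_rw [h2, ENNReal.toReal_ofNat]
  calc _ ≤ (ENNReal.ofReal ((ρ + 1) ^ d) * latticeNorm h ^ 2) ^ (1 / 2 : ℝ) := by
        gcongr
        exact setLIntegral_cell_le hh hρ j
    _ = _ := by
        rw [ENNReal.mul_rpow_of_nonneg _ _ (by norm_num), ← ENNReal.rpow_natCast,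
          ← ENNReal.rpow_mul]
        norm_num

lemma memLp_indicator_cell {h : E d → ℂ} (hh : MemLatticeL2 h) {ρ : ℝ} (hρ : 0 < ρ)
    (j : Fin d → ℤ) : MemLp ((cell ρ j).indicator h) 2 volume :=
  ⟨hh.1.indicator (measurableSet_cell ρ j), (eLpNorm_indicator_cell_le hh.1 hρ j).trans_lt
    (ENNReal.mul_lt_top (ENNReal.rpow_lt_top_of_nonneg (by norm_num) ENNReal.ofReal_ne_top) hh.2)⟩

/-! ### Lattice sums -/

/-- The weight `∑_{p ≠ 0} |p|^{-m}` of the lattice `ℤ^d` with the supremum norm (the term `p = 0`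
vanishes by the convention on inverses). -/
noncomputable def latticeSum (d m : ℕ) : ℝ≥0∞ := ∑' p : Fin d → ℤ, ENNReal.ofReal ((‖p‖⁻¹) ^ m)

lemma latticeSum_lt_top {m : ℕ} (hm : d + 1 ≤ m) : latticeSum d m < ⊤ := by
  set b := Pi.basisFun ℝ (Fin d)
  set Λ : Submodule ℤ (Fin d → ℝ) := Submodule.span ℤ (Set.range b) with hΛ
  have hmem : ∀ p : Fin d → ℤ, (fun i => (p i : ℝ)) ∈ Λ := by
    intro p
    have h1 : (fun i => (p i : ℝ)) = ∑ i, p i • b i := by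
      ext i
      simp [b, Finset.sum_apply, Pi.single_apply]
    rw [h1]
    exact Submodule.sum_mem _ fun i _ => Submodule.smul_mem _ _ (Submodule.subset_span ⟨i, rfl⟩)
  have hrank : Module.finrank ℤ Λ = d := by
    rw [ZLattice.rank ℝ Λ]; simp
  have hs := ZLattice.summable_norm_rpow Λ (-(m : ℝ)) (by
    rw [hrank, neg_lt_neg_iff]; exact_mod_cast hm)
  have hinj : Function.Injective fun p : Fin d → ℤ => (⟨_, hmem p⟩ : Λ) := by
    intro p q hpq
    ext i
    have h1 : (p i : ℝ) = q i := congrFun (Subtype.ext_iff.1 hpq) i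
    exact_mod_cast h1
  have hs2 := hs.comp_injective hinj
  have hnorm : ∀ p : Fin d → ℤ, ‖(⟨_, hmem p⟩ : Λ)‖ = ‖p‖ := by
    intro p
    rw [Submodule.coe_norm, Pi.norm_def, Pi.norm_def]
    congr 2
  have hs3 : Summable fun p : Fin d → ℤ => (‖p‖⁻¹) ^ m := by
    refine hs2.congr fun p => ?_
    simp only [Function.comp_apply]
    rw [hnorm, Real.rpow_neg (norm_nonneg _), Real.rpow_natCast, inv_pow]
  exact hs3.tsum_ofReal_lt_top

lemma tsum_setLIntegral_le {ι X : Type*} [Countable ι] [MeasurableSpace X] {μ : Measure X}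
    {B : ι → Set X} (hB : ∀ j, MeasurableSet (B j)) {N : ℝ≥0∞} (hN : ∀ w,
      ∑' j, (B j).indicator (fun _ => (1 : ℝ≥0∞)) w ≤ N) {f : X → ℝ≥0∞} (hf : Measurable f) :
    ∑' j, ∫⁻ w in B j, f w ∂μ ≤ N * ∫⁻ w, f w ∂μ := by
  simp_rw [← lintegral_indicator (hB _)]
  rw [← lintegral_tsum fun j => (hf.indicator (hB j)).aemeasurable, ← lintegral_const_mul _ hf]
  refine lintegral_mono fun w => ?_
  refine le_trans (le_of_eq ?_) (mul_le_mul_left (hN w) (f w))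
  rw [← ENNReal.tsum_mul_right]
  refine tsum_congr fun j => ?_
  by_cases hj : w ∈ B j
  · simp [hj]
  · simp [hj]

/-- The balls of radius `2 r` around the points of a lattice of mesh `r / n` overlap boundedly. -/
lemma tsum_indicator_closedBall_le {n : ℕ} (hn : n ≠ 0) {r : ℝ} (hr : 0 < r)
    {s : (Fin d → ℤ) → E d} {v : E d} (hs : ∀ j i, s j i = r / n * j i + v i) (w : E d) :
    ∑' j, (Metric.closedBall (s j) (2 * r)).indicator (fun _ => (1 : ℝ≥0∞)) w ≤
      ((4 * n + 1) ^ d : ℕ) := by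
  have hn0 : (0 : ℝ) < n := by positivity
  set c : Fin d → ℝ := fun i => (w i - v i) / (r / n)
  set J : Finset (Fin d → ℤ) :=
    Fintype.piFinset fun i => Finset.Icc ⌈c i - 2 * n⌉ ⌊c i + 2 * n⌋ with hJ
  have h1 : ∀ j ∉ J, (Metric.closedBall (s j) (2 * r)).indicator (fun _ => (1 : ℝ≥0∞)) w = 0 := by
    intro j hj
    refine Set.indicator_of_notMem (fun hw => hj ?_) _
    rw [hJ, Fintype.mem_piFinset]
    intro i
    have h2 : |w i - s j i| ≤ 2 * r := by
      have := PiLp.norm_apply_le (w - s j) i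
      rw [Metric.mem_closedBall, dist_eq_norm] at hw
      exact this.trans hw
    have hrn : 0 < r / n := by positivity
    have h3 : c i - j i = (w i - s j i) / (r / n) := by
      rw [hs]
      simp only [c]
      field_simp
      ring
    have h4 : |c i - j i| ≤ 2 * n := by
      rw [h3, abs_div, abs_of_pos hrn, div_le_iff₀ hrn]
      refine h2.trans (le_of_eq ?_)
      field_simp
    rw [abs_le] at h4
    rw [Finset.mem_Icc, Int.ceil_le, Int.le_floor]
    constructor <;> linarith [h4.1, h4.2]
  rw [tsum_eq_sum h1]
  calc ∑ j ∈ J, (Metric.closedBall (s j) (2 * r)).indicator (fun _ => (1 : ℝ≥0∞)) w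
      ≤ ∑ _j ∈ J, (1 : ℝ≥0∞) :=
        Finset.sum_le_sum fun j _ => Set.indicator_apply_le' (fun _ => le_rfl) fun _ => zero_le_one
    _ = (J.card : ℝ≥0∞) := by simp
    _ ≤ (((4 * n + 1) ^ d : ℕ) : ℝ≥0∞) := by
        refine Nat.cast_le.2 ?_
        rw [hJ, Fintype.card_piFinset]
        calc _ ≤ ∏ _i : Fin d, (4 * n + 1) := by
              refine Finset.prod_le_prod' fun i _ => ?_
              rw [Int.card_Icc]
              have h5 : (⌊c i + 2 * n⌋ : ℝ) ≤ c i + 2 * n := Int.floor_le _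
              have h6 : c i - 2 * n ≤ (⌈c i - 2 * n⌉ : ℝ) := Int.le_ceil _
              have h7 : ((⌊c i + 2 * n⌋ - ⌈c i - 2 * n⌉ : ℤ) : ℝ) ≤ ((4 * n : ℤ) : ℝ) := by
                push_cast
                linarith
              have h8 : ⌊c i + 2 * n⌋ - ⌈c i - 2 * n⌉ ≤ (4 * n : ℤ) := by exact_mod_cast h7
              omega
          _ = _ := by simp

lemma tsum_localMass_le {a : E d → E d → ℂ}
    (ha : ContDiff ℝ ∞ (fun p : E d × E d => a p.1 p.2)) (m : ℕ) {n : ℕ} (hn : n ≠ 0) {r : ℝ}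
    (hr : 0 < r) {s : (Fin d → ℤ) → E d} {v : E d} (hs : ∀ j i, s j i = r / n * j i + v i) :
    ∑' j, localMass a m r (s j) ≤
      ((4 * n + 1) ^ d : ℕ) * ∑ k ∈ Finset.range (d + 2), mixedDerivL1 a k m := by
  simp only [localMass]
  rw [Summable.tsum_finsetSum fun _ _ => ENNReal.summable, Finset.mul_sum]
  refine Finset.sum_le_sum fun k _ => ?_
  have hm := measurable_ofReal_mixedDeriv ha k m
  rw [mixedDerivL1_eq_lintegral ha, ← lintegral_tsum fun j =>
      (hm.lintegral_prod_left' (μ := volume.restrict _)).aemeasurable,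
    ← lintegral_const_mul _ hm.lintegral_prod_left']
  refine lintegral_mono fun ξ => ?_
  exact tsum_setLIntegral_le (fun j => Metric.isClosed_closedBall.measurableSet)
    (tsum_indicator_closedBall_le hn hr hs) (hm.comp (measurable_id.prodMk measurable_const))

/-! ### Separation of `(x_i - y_i)^{-m}` -/

/-- For `x_i` and `y_i` in intervals of length `ρ` whose centres are at a distance at least `2 ρ`,
the Laplace transform `z^{-m} = Γ(m)⁻¹ ∫_0^∞ l^{m-1} e^{-l z} dl` separates the variables. The
maxima with `0` make the factors bounded everywhere and are inactive on these intervals. -/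
lemma exists_separation {m : ℕ} (hm : m ≠ 0) {α ρ c c' : ℝ} (hα : 0 < α) (hρ : 0 < ρ)
    (hc : 2 * ρ ≤ |c - c'|) (i : Fin d) :
    ∃ (wt : ℝ → ℂ) (A B : ℝ → E d → ℂ), Integrable wt (volume.restrict (Set.Ioi 0)) ∧
      Measurable (Function.uncurry A) ∧ Measurable (Function.uncurry B) ∧
      (∀ l x, ‖A l x‖ ≤ 1) ∧ (∀ l x, ‖B l x‖ ≤ 1) ∧
      ∫⁻ l in Set.Ioi 0, ‖wt l‖ₑ ≤ ENNReal.ofReal ((2 / (α * |c - c'|)) ^ m) ∧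
      ∀ x y : E d, |x i - c| ≤ ρ / 2 → |y i - c'| ≤ ρ / 2 →
        ∫ l in Set.Ioi 0, wt l * A l x * B l y =
          (Complex.I / ((α * (x i - y i) : ℝ) : ℂ)) ^ m := by
  set q : ℝ := |c - c'| with hq
  have hq0 : 0 < q := by linarith
  obtain ⟨σ, hσ1, hσq⟩ : ∃ σ : ℝ, |σ| = 1 ∧ σ * (c - c') = q := by
    rcases le_total 0 (c - c') with h | h
    · exact ⟨1, by simp, by rw [hq, abs_of_nonneg h, one_mul]⟩
    · exact ⟨-1, by simp, by rw [hq, abs_of_nonpos h]; ring⟩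
  have hσσ : σ * σ = 1 := by rw [← abs_mul_abs_self, hσ1, one_mul]
  have hm0 : (0 : ℝ) < m := by positivity
  have hΓ : 0 < Real.Gamma m := Real.Gamma_pos_of_pos hm0
  have hint : ∀ {z : ℝ}, 0 < z →
      IntegrableOn (fun l : ℝ => l ^ ((m : ℝ) - 1) * Real.exp (-(z * l))) (Set.Ioi 0) := by
    intro z hz
    by_contra h
    have h1 := Real.integral_rpow_mul_exp_neg_mul_Ioi hm0 hz
    rw [integral_undef h] at h1
    have : 0 < (1 / z) ^ (m : ℝ) * Real.Gamma m := by positivity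
    linarith
  set κ : ℂ := (Complex.I * σ / α) ^ m / Real.Gamma m with hκ
  have hκn : ‖κ‖ = (1 / α) ^ m / Real.Gamma m := by
    rw [hκ, norm_div, norm_pow, norm_div, norm_mul, Complex.norm_I, one_mul, Complex.norm_real,
      Complex.norm_real, Complex.norm_real, Real.norm_eq_abs, hσ1, Real.norm_of_nonneg hα.le,
      Real.norm_of_nonneg hΓ.le]
  have hqρ : 0 < q - ρ := by linarith
  refine ⟨fun l => κ * ((l ^ ((m : ℝ) - 1) * Real.exp (-((q - ρ) * l)) : ℝ) : ℂ),
    fun l x => ((Real.exp (-max 0 (l * (ρ / 2 + σ * (x i - c)))) : ℝ) : ℂ),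
    fun l y => ((Real.exp (-max 0 (l * (ρ / 2 - σ * (y i - c')))) : ℝ) : ℂ),
    (hint hqρ).ofReal.const_mul κ, ?_, ?_, ?_, ?_, ?_, ?_⟩
  · refine Continuous.measurable ?_
    simp only [Function.uncurry_def]
    fun_prop
  · refine Continuous.measurable ?_
    simp only [Function.uncurry_def]
    fun_prop
  · intro l x
    rw [Complex.norm_real, Real.norm_of_nonneg (Real.exp_nonneg _), Real.exp_le_one_iff]
    exact neg_nonpos.2 (le_max_left _ _)
  · intro l x
    rw [Complex.norm_real, Real.norm_of_nonneg (Real.exp_nonneg _), Real.exp_le_one_iff]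
    exact neg_nonpos.2 (le_max_left _ _)
  · have hI : Integrable (fun l : ℝ =>
        κ * ((l ^ ((m : ℝ) - 1) * Real.exp (-((q - ρ) * l)) : ℝ) : ℂ))
        (volume.restrict (Set.Ioi 0)) := (hint hqρ).ofReal.const_mul κ
    rw [← ofReal_integral_norm_eq_lintegral_enorm hI]
    refine ENNReal.ofReal_le_ofReal ?_
    have h1 : ∫ l in Set.Ioi (0 : ℝ),
        ‖κ * ((l ^ ((m : ℝ) - 1) * Real.exp (-((q - ρ) * l)) : ℝ) : ℂ)‖ =
        ‖κ‖ * ((1 / (q - ρ)) ^ (m : ℝ) * Real.Gamma m) := by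
      rw [← Real.integral_rpow_mul_exp_neg_mul_Ioi hm0 hqρ, ← integral_const_mul]
      refine setIntegral_congr_fun measurableSet_Ioi fun l hl => ?_
      have hl0 : (0 : ℝ) < l := hl
      rw [norm_mul, Complex.norm_real, Real.norm_of_nonneg (by positivity)]
    rw [h1, hκn, Real.rpow_natCast]
    calc (1 / α) ^ m / Real.Gamma m * ((1 / (q - ρ)) ^ m * Real.Gamma m)
        = (1 / α * (1 / (q - ρ))) ^ m := by rw [mul_pow]; field_simp
      _ ≤ _ := by
          refine pow_le_pow_left₀ (by positivity) ?_ m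
          rw [one_div_mul_one_div, div_le_div_iff₀ (by positivity) (by positivity)]
          nlinarith
  · intro x y hx hy
    have hu : |σ * (x i - c)| ≤ ρ / 2 := by rw [abs_mul, hσ1, one_mul]; exact hx
    have hv : |σ * (y i - c')| ≤ ρ / 2 := by rw [abs_mul, hσ1, one_mul]; exact hy
    rw [abs_le] at hu hv
    have hzeq : σ * (x i - y i) = q + σ * (x i - c) - σ * (y i - c') := by rw [← hσq]; ring
    set z : ℝ := σ * (x i - y i) with hz
    have hz0 : 0 < z := by rw [hzeq]; linarith [hu.1, hv.2]
    have hxy : x i - y i = σ * z := by rw [hz, ← mul_assoc, hσσ, one_mul]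
    have h1 : ∀ l ∈ Set.Ioi (0 : ℝ), κ * ((l ^ ((m : ℝ) - 1) * Real.exp (-((q - ρ) * l)) : ℝ) : ℂ) *
        ((Real.exp (-max 0 (l * (ρ / 2 + σ * (x i - c)))) : ℝ) : ℂ) *
        ((Real.exp (-max 0 (l * (ρ / 2 - σ * (y i - c')))) : ℝ) : ℂ) =
        κ * ((l ^ ((m : ℝ) - 1) * Real.exp (-(z * l)) : ℝ) : ℂ) := by
      intro l hl
      have hl0 : (0 : ℝ) < l := hl
      rw [max_eq_right (mul_nonneg hl0.le (by linarith [hu.1])),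
        max_eq_right (mul_nonneg hl0.le (by linarith [hv.2])), mul_assoc, mul_assoc,
        ← Complex.ofReal_mul, ← Complex.ofReal_mul, mul_assoc, ← Real.exp_add, ← Real.exp_add]
      congr 5
      rw [hzeq]
      ring
    rw [setIntegral_congr_fun measurableSet_Ioi h1, integral_const_mul, integral_complex_ofReal,
      Real.integral_rpow_mul_exp_neg_mul_Ioi hm0 hz0, Real.rpow_natCast, hκ, hxy]
    have hΓ' : ((Real.Gamma m : ℝ) : ℂ) ≠ 0 := by exact_mod_cast hΓ.ne'
    have hz' : (z : ℂ) ≠ 0 := by exact_mod_cast hz0.ne'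
    have hα' : (α : ℂ) ≠ 0 := by exact_mod_cast hα.ne'
    have hσ' : (σ : ℂ) ≠ 0 := by
      intro h
      have : σ = 0 := by exact_mod_cast h
      rw [this] at hσ1
      simp at hσ1
    have hσσ' : (σ : ℂ) * σ = 1 := by exact_mod_cast hσσ
    have h2 : Complex.I / ((α * (σ * z) : ℝ) : ℂ) = Complex.I * σ / α * (1 / z) := by
      push_cast
      field_simp
      rw [pow_two, hσσ']
    rw [h2, mul_pow]
    push_cast
    field_simp

end Cells

section Assembly

variable {d : ℕ}

/-! ### Pieces for pairs of cells -/

/-- The reference point for `(1 - t) x + t y` with `x`, `y` in the cells `p.1`, `p.2`. -/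
noncomputable def pairCenter (ρ t : ℝ) (p : (Fin d → ℤ) × (Fin d → ℤ)) : E d :=
  (1 - t) • cellCenter ρ p.1 + t • cellCenter ρ p.2

lemma dist_pairCenter_le {ρ t : ℝ} (hρ : 0 < ρ) (ht : t ∈ Set.Icc (0 : ℝ) 1)
    {p : (Fin d → ℤ) × (Fin d → ℤ)} {x y : E d} (hx : x ∈ cell ρ p.1) (hy : y ∈ cell ρ p.2) :
    dist ((1 - t) • x + t • y) (pairCenter ρ t p) ≤ d * (ρ / 2) := by
  have h1 : (1 - t) • x + t • y - pairCenter ρ t p =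
      (1 - t) • (x - cellCenter ρ p.1) + t • (y - cellCenter ρ p.2) := by
    rw [pairCenter, smul_sub, smul_sub]
    abel
  rw [dist_eq_norm, h1]
  have h2 := dist_cellCenter_le hρ hx
  have h3 := dist_cellCenter_le hρ hy
  calc _ ≤ ‖(1 - t) • (x - cellCenter ρ p.1)‖ + ‖t • (y - cellCenter ρ p.2)‖ := norm_add_le _ _
    _ = (1 - t) * ‖x - cellCenter ρ p.1‖ + t * ‖y - cellCenter ρ p.2‖ := by
        rw [norm_smul, norm_smul, Real.norm_of_nonneg (by linarith [ht.2]),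
          Real.norm_of_nonneg ht.1]
    _ ≤ (1 - t) * (d * (ρ / 2)) + t * (d * (ρ / 2)) := by
        have := ht.2
        have := ht.1
        gcongr
    _ = _ := by ring

/-- A pair of cells whose indices differ by `q`, `|q| ≥ 2`, is separated in some coordinate, which
yields the weight `(α ρ |q| / 2)^{-m}`. -/
lemma exists_pieceOp_of_two_le (d : ℕ) : ∃ C : ℝ, 0 ≤ C ∧
    ∀ {h₁ h₂ : E d → ℂ} {a : E d → E d → ℂ} {α t r ρ : ℝ} {p : (Fin d → ℤ) × (Fin d → ℤ)} {m : ℕ},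
      m ≠ 0 → 0 < α → 1 ≤ r → 0 < ρ → d * (ρ / 2) ≤ r → t ∈ Set.Icc (0 : ℝ) 1 →
      MemLatticeL2 h₁ → MemLatticeL2 h₂ →
      ContDiff ℝ ∞ (fun p : E d × E d => a p.1 p.2) →
      (∀ k < d + 2, mixedDerivL1 a k m < ⊤) → 2 ≤ ‖p.2 - p.1‖ →
      ∃ T : L2 d →L[ℂ] L2 d, IsPieceOp h₁ h₂ α t a (cell ρ p.1) (cell ρ p.2) T ∧
        HasNuclearBound T (ENNReal.ofReal (C * α ^ d) *
          ENNReal.ofReal ((2 / (α * (ρ * ‖p.2 - p.1‖))) ^ m) * localMass a m r (pairCenter ρ t p) *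
          eLpNorm ((cell ρ p.1).indicator h₁) 2 volume *
          eLpNorm ((cell ρ p.2).indicator h₂) 2 volume) := by
  obtain ⟨C, hC0, hC⟩ := exists_pieceOp d
  refine ⟨C, hC0, ?_⟩
  intro h₁ h₂ a α t r ρ p m hm hα hr hρ hdρ ht hh₁ hh₂ ha hfin hp
  obtain ⟨i, hi⟩ : ∃ i, ‖p.2 - p.1‖ ≤ ‖(p.2 - p.1) i‖ := by
    by_contra! h
    exact lt_irrefl _ ((pi_norm_lt_iff (by linarith)).2 h)
  have hpi : |(p.1 i : ℝ) - p.2 i| = ‖p.2 - p.1‖ := by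
    refine le_antisymm ?_ ?_
    · refine le_trans (le_of_eq ?_) (norm_le_pi_norm _ i)
      rw [Pi.sub_apply, Int.norm_eq_abs, abs_sub_comm]
      push_cast
      rfl
    · refine hi.trans (le_of_eq ?_)
      rw [Pi.sub_apply, Int.norm_eq_abs, abs_sub_comm]
      push_cast
      rfl
  have hcc : |cellCenter ρ p.1 i - cellCenter ρ p.2 i| = ρ * ‖p.2 - p.1‖ := by
    rw [cellCenter_apply, cellCenter_apply, ← hpi, ← mul_sub, abs_mul, abs_of_pos hρ]
    congr 2
    ring
  have hsep : 2 * ρ ≤ |cellCenter ρ p.1 i - cellCenter ρ p.2 i| := by rw [hcc]; nlinarith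
  obtain ⟨wt, A, B, hwt, hA, hB, hA1, hB1, hwle, hAB⟩ := exists_separation hm hα hρ hsep i
  obtain ⟨T, hT, hTb⟩ := hC i m (volume.restrict (Set.Ioi 0)) hα hr (memLp_indicator_cell hh₁ hρ p.1)
    (memLp_indicator_cell hh₂ hρ p.2) ha hfin
    (fun x hx y hy => (dist_pairCenter_le hρ ht hx hy).trans hdρ)
    (fun _ => ⟨ρ, hρ, fun x hx y hy => by
      have h1 := abs_sub_cellCenter_le hρ hx i
      have h2 := abs_sub_cellCenter_le hρ hy i
      have h3 := abs_sub_le (cellCenter ρ p.1 i) (x i) (cellCenter ρ p.2 i)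
      have h4 := abs_sub_le (x i) (y i) (cellCenter ρ p.2 i)
      rw [abs_sub_comm] at h1
      linarith⟩)
    hwt hA hB hA1 hB1
    (fun x hx y hy => hAB x y (abs_sub_cellCenter_le hρ hx i) (abs_sub_cellCenter_le hρ hy i))
  refine ⟨T, hT, hTb.mono ?_⟩
  rw [hcc] at hwle
  gcongr

/-- The piece of any pair of cells, estimated without use of the oscillations. -/
lemma exists_pieceOp_zero (d : ℕ) (hd : 1 ≤ d) : ∃ C : ℝ, 0 ≤ C ∧
    ∀ {h₁ h₂ : E d → ℂ} {a : E d → E d → ℂ} {α t r ρ : ℝ} {p : (Fin d → ℤ) × (Fin d → ℤ)},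
      0 < α → 1 ≤ r → 0 < ρ → d * (ρ / 2) ≤ r → t ∈ Set.Icc (0 : ℝ) 1 →
      MemLatticeL2 h₁ → MemLatticeL2 h₂ →
      ContDiff ℝ ∞ (fun p : E d × E d => a p.1 p.2) →
      (∀ k < d + 2, mixedDerivL1 a k 0 < ⊤) →
      ∃ T : L2 d →L[ℂ] L2 d, IsPieceOp h₁ h₂ α t a (cell ρ p.1) (cell ρ p.2) T ∧
        HasNuclearBound T (ENNReal.ofReal (C * α ^ d) * localMass a 0 r (pairCenter ρ t p) *
          eLpNorm ((cell ρ p.1).indicator h₁) 2 volume *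
          eLpNorm ((cell ρ p.2).indicator h₂) 2 volume) := by
  obtain ⟨C, hC0, hC⟩ := exists_pieceOp d
  refine ⟨C, hC0, ?_⟩
  intro h₁ h₂ a α t r ρ p hα hr hρ hdρ ht hh₁ hh₂ ha hfin
  obtain ⟨T, hT, hTb⟩ := hC (wt := fun _ => 1) (A := fun _ _ => 1) (B := fun _ _ => 1) ⟨0, hd⟩ 0
    (Measure.dirac 0) hα hr (memLp_indicator_cell hh₁ hρ p.1) (memLp_indicator_cell hh₂ hρ p.2) ha
    hfin (fun x hx y hy => (dist_pairCenter_le hρ ht hx hy).trans hdρ) (fun h => absurd rfl h)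
    (integrable_const _) measurable_const measurable_const (fun _ _ => by simp) (fun _ _ => by simp)
    (fun x _ y _ => by simp)
  refine ⟨T, hT, hTb.mono (le_of_eq ?_)⟩
  simp

/-- A function vanishes almost everywhere outside its essential support. -/
lemma ae_mem_essSupport (h : E d → ℂ) : ∀ᵐ x, h x ≠ 0 → x ∈ essSupport h := by
  rw [ae_iff]
  refine measure_null_of_locally_null _ fun x hx => ?_
  obtain ⟨-, hx⟩ := Classical.not_imp.1 hx
  simp only [essSupport, Set.mem_ofPred_eq, not_forall] at hx
  obtain ⟨U, hU, hU0⟩ := hx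
  refine ⟨U ∩ {y | h y ≠ 0}, inter_mem (mem_nhdsWithin_of_mem_nhds hU) ?_, by simpa using hU0⟩
  exact mem_of_superset self_mem_nhdsWithin fun y hy => (Classical.not_imp.1 hy).1

/-- The piece of a pair of cells without points at distance `r` or more vanishes if the essential
supports are that far apart. -/
lemma isPieceOp_zero {h₁ h₂ : E d → ℂ} {α t r : ℝ} {a : E d → E d → ℂ} {S₁ S₂ : Set (E d)}
    (hsupp : ∀ x ∈ essSupport h₁, ∀ y ∈ essSupport h₂, r ≤ dist x y)
    (hS : ∀ x ∈ S₁, ∀ y ∈ S₂, dist x y < r) : IsPieceOp h₁ h₂ α t a S₁ S₂ 0 := by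
  refine ⟨fun _ _ => 0, fun u => ?_, fun φ _ _ => ?_⟩
  · exact Eventually.of_forall fun x => by simp
  · filter_upwards [ae_mem_essSupport h₁] with x hx hxS hx0
    simp only [zero_mul, integral_zero]
    refine hasOpValue_zero_of_ae_eq_zero ?_ x
    filter_upwards [ae_mem_essSupport h₂] with y hy
    by_cases hyS : y ∈ S₂
    · by_cases hy0 : h₂ y = 0
      · simp [hyS, hy0]
      · exact absurd (hsupp x (hx hx0) y (hy hy0)) (not_le.2 (hS x hxS y hyS))
    · simp [hyS]

lemma dist_lt_of_norm_sub_lt_two {ρ r : ℝ} (hρ : 0 < ρ) (hr : d * (2 * ρ) < r)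
    {p : (Fin d → ℤ) × (Fin d → ℤ)} (hp : ‖p.2 - p.1‖ < 2) {x y : E d} (hx : x ∈ cell ρ p.1)
    (hy : y ∈ cell ρ p.2) : dist x y < r := by
  rw [dist_eq_norm]
  refine (norm_le_of_forall_abs_le (by positivity) fun i => ?_).trans_lt hr
  have h1 := abs_sub_cellCenter_le hρ hx i
  have h2 := abs_sub_cellCenter_le hρ hy i
  have h3 : |(p.2 i - p.1 i : ℤ)| < 2 := by
    have h4 := (norm_le_pi_norm (p.2 - p.1) i).trans_lt hp
    rw [Pi.sub_apply, Int.norm_eq_abs] at h4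
    exact_mod_cast h4
  have h5 : |(p.2 i : ℝ) - p.1 i| ≤ 1 := by
    have : |(p.2 i - p.1 i : ℤ)| ≤ 1 := by omega
    exact_mod_cast this
  rw [cellCenter_apply] at h1 h2
  rw [PiLp.sub_apply]
  rw [abs_le] at h1 h2 h5 ⊢
  constructor <;> nlinarith [h1.1, h1.2, h2.1, h2.2, h5.1, h5.2]

/-! ### Summation over the pairs of cells -/

/-- Summation along the diagonals. -/
lemma tsum_pair_eq {G : Type*} [AddGroup G] (f : G × G → ℝ≥0∞) :
    ∑' p, f p = ∑' q, ∑' j, f (j, j + q) := by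
  rw [← (Equiv.prodShear (Equiv.refl G) fun j => Equiv.addLeft j).tsum_eq f, ENNReal.tsum_prod',
    ENNReal.tsum_comm]
  rfl

/-- Pieces that are bounded by local masses, with weights that depend on the difference `q` of the
cell indices only, sum up to a trace class operator: for fixed `q` the local masses overlap
boundedly. -/
lemma exists_isWeightedOp_of_weights {h₁ h₂ : E d → ℂ} {α t r : ℝ} {a : E d → E d → ℂ} {n : ℕ}
    (hn : n ≠ 0) (hr : 0 < r) (hh₁ : MemLatticeL2 h₁) (hh₂ : MemLatticeL2 h₂)
    (ha : ContDiff ℝ ∞ (fun p : E d × E d => a p.1 p.2)) {K : ℝ≥0∞} (hK : K ≠ ⊤)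
    {W : (Fin d → ℤ) → ℝ≥0∞} {m : (Fin d → ℤ) → ℕ}
    (hW : ∑' q, W q * ∑ k ∈ Finset.range (d + 2), mixedDerivL1 a k (m q) < ⊤)
    (hT : ∀ p : (Fin d → ℤ) × (Fin d → ℤ), ∃ T : L2 d →L[ℂ] L2 d,
      IsPieceOp h₁ h₂ α t a (cell (r / n) p.1) (cell (r / n) p.2) T ∧
        HasNuclearBound T (K * W (p.2 - p.1) *
          localMass a (m (p.2 - p.1)) r (pairCenter (r / n) t p) *
          eLpNorm ((cell (r / n) p.1).indicator h₁) 2 volume *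
          eLpNorm ((cell (r / n) p.2).indicator h₂) 2 volume)) :
    ∃ S : L2 d →L[ℂ] L2 d, IsWeightedOp h₁ h₂ α t a S ∧ IsTraceClass S ∧
      traceNorm S ≤ 4 * K * ((4 * n + 1) ^ d : ℕ) * ENNReal.ofReal ((r / n + 1) ^ d) *
        latticeNorm h₁ * latticeNorm h₂ *
          ∑' q, W q * ∑ k ∈ Finset.range (d + 2), mixedDerivL1 a k (m q) := by
  set ρ : ℝ := r / n with hρdef
  have hρ : 0 < ρ := by positivity
  choose T hT hTb using hT
  set N : ℝ≥0∞ := (((4 * n + 1) ^ d : ℕ) : ℝ≥0∞) with hN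
  set R : ℝ≥0∞ := ENNReal.ofReal ((ρ + 1) ^ d) with hR
  set Θ : ℝ≥0∞ := ∑' q, W q * ∑ k ∈ Finset.range (d + 2), mixedDerivL1 a k (m q) with hΘ
  have hRR : R ^ (1 / 2 : ℝ) * R ^ (1 / 2 : ℝ) = R := by
    rw [← ENNReal.rpow_add_of_nonneg _ _ (by norm_num) (by norm_num)]
    norm_num
  have hsum : ∑' p : (Fin d → ℤ) × (Fin d → ℤ), K * W (p.2 - p.1) *
      localMass a (m (p.2 - p.1)) r (pairCenter ρ t p) *
      eLpNorm ((cell ρ p.1).indicator h₁) 2 volume *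
      eLpNorm ((cell ρ p.2).indicator h₂) 2 volume ≤
      K * N * R * latticeNorm h₁ * latticeNorm h₂ * Θ := by
    calc _ ≤ ∑' p : (Fin d → ℤ) × (Fin d → ℤ), K * R * latticeNorm h₁ * latticeNorm h₂ *
          (W (p.2 - p.1) * localMass a (m (p.2 - p.1)) r (pairCenter ρ t p)) := by
          refine ENNReal.tsum_le_tsum fun p => ?_
          calc _ ≤ K * W (p.2 - p.1) * localMass a (m (p.2 - p.1)) r (pairCenter ρ t p) *
                (R ^ (1 / 2 : ℝ) * latticeNorm h₁) * (R ^ (1 / 2 : ℝ) * latticeNorm h₂) := by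
                gcongr
                · exact eLpNorm_indicator_cell_le hh₁.1 hρ _
                · exact eLpNorm_indicator_cell_le hh₂.1 hρ _
            _ = K * (R ^ (1 / 2 : ℝ) * R ^ (1 / 2 : ℝ)) * latticeNorm h₁ * latticeNorm h₂ *
                (W (p.2 - p.1) * localMass a (m (p.2 - p.1)) r (pairCenter ρ t p)) := by ring
            _ = _ := by rw [hRR]
      _ = K * R * latticeNorm h₁ * latticeNorm h₂ *
          ∑' q, W q * ∑' j, localMass a (m q) r (pairCenter ρ t (j, j + q)) := by
          rw [ENNReal.tsum_mul_left, tsum_pair_eq]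
          simp only [add_sub_cancel_left, ENNReal.tsum_mul_left]
      _ ≤ K * R * latticeNorm h₁ * latticeNorm h₂ *
          ∑' q, W q * (N * ∑ k ∈ Finset.range (d + 2), mixedDerivL1 a k (m q)) := by
          gcongr with q
          -- For a fixed difference `q` the reference points form a translated lattice of mesh `ρ`.
          refine tsum_localMass_le ha (m q) hn hr
            (v := WithLp.toLp 2 fun i => ρ / 2 + t * ρ * q i) fun j i => ?_
          simp only [pairCenter, PiLp.add_apply, PiLp.smul_apply, cellCenter_apply, smul_eq_mul,
            Pi.add_apply]
          push_cast
          ring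
      _ = _ := by
          simp_rw [mul_left_comm _ N]
          rw [ENNReal.tsum_mul_left]
          ring
  have hfin : K * N * R * latticeNorm h₁ * latticeNorm h₂ * Θ < ⊤ := by
    refine ENNReal.mul_lt_top (ENNReal.mul_lt_top (ENNReal.mul_lt_top (ENNReal.mul_lt_top
      (ENNReal.mul_lt_top hK.lt_top ?_) ENNReal.ofReal_lt_top) hh₁.2) hh₂.2) hW
    exact ENNReal.natCast_lt_top _
  obtain ⟨S, hS, hS1, hS2⟩ := exists_isWeightedOp_of_pieces hρ ha
    (fun k => memLp_indicator_cell hh₂ hρ k) hT hTb (hsum.trans_lt hfin)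
  refine ⟨S, hS, hS1, hS2.trans ?_⟩
  calc _ ≤ 4 * (K * N * R * latticeNorm h₁ * latticeNorm h₂ * Θ) := by gcongr
    _ = _ := by ring

lemma mixedDerivL1_lt_top {a : E d → E d → ℂ} {n m : ℕ}
    (h : Integrable (fun p : E d × E d => symbolFCirc n m a p.1 p.2)) {k : ℕ} (hk : k < n + 1) :
    mixedDerivL1 a k m < ⊤ := by
  refine lt_of_le_of_lt (lintegral_mono fun p => ENNReal.ofReal_le_ofReal ?_) h.lintegral_lt_top
  exact Finset.single_le_sum (f := fun k => mixedDeriv a k m p.1 p.2) (fun _ _ => norm_nonneg _)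
    (Finset.mem_range.2 hk)

lemma mixedDerivL1_lt_top_of_symbolF {a : E d → E d → ℂ} {n m : ℕ}
    (h : Integrable (fun p : E d × E d => symbolF n m a p.1 p.2)) {k l : ℕ} (hk : k < n + 1)
    (hl : l < m + 1) : mixedDerivL1 a k l < ⊤ := by
  refine lt_of_le_of_lt (lintegral_mono fun p => ENNReal.ofReal_le_ofReal ?_) h.lintegral_lt_top
  refine le_trans ?_ (Finset.single_le_sum (f := fun l => symbolFCirc n l a p.1 p.2)
    (fun _ _ => Finset.sum_nonneg fun _ _ => norm_nonneg _) (Finset.mem_range.2 hl))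
  exact Finset.single_le_sum (f := fun k => mixedDeriv a k l p.1 p.2) (fun _ _ => norm_nonneg _)
    (Finset.mem_range.2 hk)

/-- With cells of side `1 / (3 d)` the weights `1` near the diagonal and `(6 d / |q|)^{d+1}` away from
it are summable. -/
theorem exists_traceNorm_le (d : ℕ) (hd : 1 ≤ d) : ∃ C : ℝ, 0 < C ∧
    ∀ (h₁ h₂ : E d → ℂ) (a : E d → E d → ℂ) (α t : ℝ),
      MemLatticeL2 h₁ → MemLatticeL2 h₂ →
      ContDiff ℝ ∞ (fun p : E d × E d => a p.1 p.2) →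
      1 ≤ α → t ∈ Set.Icc (0 : ℝ) 1 →
      Integrable (fun p : E d × E d => symbolF (d + 1) (d + 1) a p.1 p.2) →
      ∃ T : L2 d →L[ℂ] L2 d, IsWeightedOp h₁ h₂ α t a T ∧ IsTraceClass T ∧
        traceNorm T ≤ ENNReal.ofReal (C * α ^ d) * latticeNorm h₁ * latticeNorm h₂ *
          ∑ k ∈ Finset.range (d + 2), ∑ l ∈ Finset.range (d + 2), mixedDerivL1 a k l := by
  obtain ⟨C₁, hC₁, hfar⟩ := exists_pieceOp_of_two_le d
  obtain ⟨C₀, hC₀, hnear⟩ := exists_pieceOp_zero d hd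
  set C : ℝ := max C₁ C₀ with hC
  have hC0 : 0 ≤ C := hC₁.trans (le_max_left _ _)
  set n : ℕ := 3 * d with hn
  have hn0 : n ≠ 0 := by omega
  have hd0 : (1 : ℝ) ≤ d := by exact_mod_cast hd
  have hnd : (n : ℝ) = 3 * d := by rw [hn]; push_cast; rfl
  set Λ : ℝ := (latticeSum d (d + 1)).toReal with hΛ
  have hΛe : latticeSum d (d + 1) = ENNReal.ofReal Λ :=
    (ENNReal.ofReal_toReal (latticeSum_lt_top le_rfl).ne).symm
  have hΛ0 : 0 ≤ Λ := ENNReal.toReal_nonneg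
  set N : ℕ := (4 * n + 1) ^ d with hN
  set D : ℝ := 4 * C * N * 2 ^ d * (1 + (6 * d) ^ (d + 1) * Λ) with hD
  have hD0 : 0 ≤ D := by positivity
  refine ⟨D + 1, by positivity, ?_⟩
  intro h₁ h₂ a α t hh₁ hh₂ ha hα ht hint
  have hα0 : 0 < α := by linarith
  set Φ : ℝ≥0∞ := ∑ k ∈ Finset.range (d + 2), ∑ l ∈ Finset.range (d + 2), mixedDerivL1 a k l
    with hS
  have hfin : ∀ {k l}, k < d + 2 → l < d + 2 → mixedDerivL1 a k l < ⊤ := fun hk hl =>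
    mixedDerivL1_lt_top_of_symbolF hint hk hl
  have hΦfin : Φ < ⊤ := ENNReal.sum_lt_top.2 fun k hk => ENNReal.sum_lt_top.2 fun l hl =>
    hfin (Finset.mem_range.1 hk) (Finset.mem_range.1 hl)
  have hρ : (0 : ℝ) < 1 / n := by positivity
  have hdρ : (d : ℝ) * (1 / n / 2) ≤ 1 := by
    rw [hnd]
    field_simp
    norm_num
  set W : (Fin d → ℤ) → ℝ≥0∞ := fun q =>
    if ‖q‖ < 2 then 1 else ENNReal.ofReal ((2 / (α * (1 / n * ‖q‖))) ^ (d + 1)) with hWdef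
  set m : (Fin d → ℤ) → ℕ := fun q => if ‖q‖ < 2 then 0 else d + 1 with hm
  have hmq : ∀ q, ∑ k ∈ Finset.range (d + 2), mixedDerivL1 a k (m q) ≤ Φ := by
    intro q
    refine Finset.sum_le_sum fun k _ => ?_
    refine Finset.single_le_sum (f := fun l => mixedDerivL1 a k l) (fun _ _ => zero_le) ?_
    rw [Finset.mem_range, hm]
    dsimp only
    split_ifs <;> omega
  have hWq : ∀ q, W q ≤ (if q = 0 then 1 else 0) +
      ENNReal.ofReal ((6 * d) ^ (d + 1)) * ENNReal.ofReal ((‖q‖⁻¹) ^ (d + 1)) := by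
    intro q
    rw [← ENNReal.ofReal_mul (by positivity), ← mul_pow]
    by_cases hq0 : q = 0
    · simp [hWdef, hq0]
    have hq : 0 < ‖q‖ := norm_pos_iff.2 hq0
    rw [if_neg hq0, zero_add, hWdef]
    dsimp only
    split_ifs with hq2
    · rw [← ENNReal.ofReal_one]
      refine ENNReal.ofReal_le_ofReal (one_le_pow₀ ?_)
      rw [← div_eq_mul_inv, one_le_div hq]
      linarith
    · refine ENNReal.ofReal_le_ofReal (pow_le_pow_left₀ (by positivity) ?_ _)
      calc 2 / (α * (1 / n * ‖q‖)) ≤ 2 / (1 * (1 / n * ‖q‖)) := by gcongr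
        _ = _ := by
          rw [hnd]
          field_simp
          norm_num
  have hW : ∑' q, W q * ∑ k ∈ Finset.range (d + 2), mixedDerivL1 a k (m q) ≤
      ENNReal.ofReal (1 + (6 * d) ^ (d + 1) * Λ) * Φ := by
    calc _ ≤ ∑' q, ((if q = 0 then 1 else 0) + ENNReal.ofReal ((6 * d) ^ (d + 1)) *
          ENNReal.ofReal ((‖q‖⁻¹) ^ (d + 1))) * Φ :=
          ENNReal.tsum_le_tsum fun q => mul_le_mul' (hWq q) (hmq q)
      _ = _ := by
          rw [ENNReal.tsum_mul_right, ENNReal.tsum_add, tsum_ite_eq, ENNReal.tsum_mul_left,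
            ← latticeSum, hΛe, ← ENNReal.ofReal_mul (by positivity), ← ENNReal.ofReal_one,
            ← ENNReal.ofReal_add (by positivity) (by positivity)]
  obtain ⟨S, hS1, hS2, hS3⟩ := exists_isWeightedOp_of_weights (α := α) (t := t) (r := 1) (W := W)
    (m := m) (K := ENNReal.ofReal (C * α ^ d)) hn0 one_pos hh₁ hh₂ ha ENNReal.ofReal_ne_top
    (hW.trans_lt (ENNReal.mul_lt_top ENNReal.ofReal_lt_top hΦfin)) (fun p => by
      by_cases hp : ‖p.2 - p.1‖ < 2
      · obtain ⟨T, hT, hTb⟩ := hnear (p := p) hα0 le_rfl hρ hdρ ht hh₁ hh₂ ha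
          fun k hk => hfin hk (by omega)
        refine ⟨T, hT, hTb.mono ?_⟩
        have h1 : W (p.2 - p.1) = 1 := if_pos hp
        have h2 : m (p.2 - p.1) = 0 := if_pos hp
        rw [h1, h2, mul_one]
        gcongr
        exact le_max_right _ _
      · obtain ⟨T, hT, hTb⟩ := hfar (p := p) (m := d + 1) (by omega) hα0 le_rfl hρ hdρ ht hh₁ hh₂
          ha (fun k hk => hfin hk (by omega)) (not_lt.1 hp)
        refine ⟨T, hT, hTb.mono ?_⟩
        have h1 : W (p.2 - p.1) =
          ENNReal.ofReal ((2 / (α * (1 / n * ‖p.2 - p.1‖))) ^ (d + 1)) := if_neg hp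
        have h2 : m (p.2 - p.1) = d + 1 := if_neg hp
        rw [h1, h2]
        gcongr
        exact le_max_left _ _)
  refine ⟨S, hS1, hS2, hS3.trans ?_⟩
  have h2d : ((1 : ℝ) / n + 1) ^ d ≤ 2 ^ d := by
    gcongr
    have : (1 : ℝ) / n ≤ 1 := by rw [hnd, div_le_one (by positivity)]; linarith
    linarith
  calc _ ≤ 4 * ENNReal.ofReal (C * α ^ d) * (N : ℝ≥0∞) * ENNReal.ofReal (2 ^ d) * latticeNorm h₁ *
        latticeNorm h₂ * (ENNReal.ofReal (1 + (6 * d) ^ (d + 1) * Λ) * Φ) := by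
        gcongr
    _ = ENNReal.ofReal (D * α ^ d) * latticeNorm h₁ * latticeNorm h₂ * Φ := by
        have h4 : (4 : ℝ≥0∞) = ENNReal.ofReal 4 := by simp
        have hDe : ENNReal.ofReal (D * α ^ d) = 4 * ENNReal.ofReal (C * α ^ d) * (N : ℝ≥0∞) *
            ENNReal.ofReal (2 ^ d) * ENNReal.ofReal (1 + (6 * d) ^ (d + 1) * Λ) := by
          rw [h4, ← ENNReal.ofReal_natCast, ← ENNReal.ofReal_mul (by positivity),
            ← ENNReal.ofReal_mul (by positivity), ← ENNReal.ofReal_mul (by positivity),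
            ← ENNReal.ofReal_mul (by positivity)]
          congr 1
          rw [hD]
          ring
        rw [hDe]
        ring
    _ ≤ _ := by
        gcongr
        linarith

/-- With cells of side `r / (3 d)` the points of two cells whose indices differ by at most `1` are at
a distance at most `2 r / 3`, so that the pieces near the diagonal vanish. The other ones carry the
weights `(6 d / (α r |q|))^m`. -/
theorem exists_traceNorm_le_of_le_dist (d : ℕ) (hd : 1 ≤ d) (m : ℕ) (hm : d + 1 ≤ m) :
    ∃ C : ℝ, 0 < C ∧ ∀ (h₁ h₂ : E d → ℂ) (a : E d → E d → ℂ) (α t r : ℝ),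
      MemLatticeL2 h₁ → MemLatticeL2 h₂ →
      ContDiff ℝ ∞ (fun p : E d × E d => a p.1 p.2) →
      1 ≤ α → t ∈ Set.Icc (0 : ℝ) 1 → 1 ≤ r →
      (∀ x ∈ essSupport h₁, ∀ y ∈ essSupport h₂, r ≤ dist x y) →
      Integrable (fun p : E d × E d => symbolFCirc (d + 1) m a p.1 p.2) →
      ∃ T : L2 d →L[ℂ] L2 d, IsWeightedOp h₁ h₂ α t a T ∧ IsTraceClass T ∧
        traceNorm T ≤ ENNReal.ofReal (C * (α * r) ^ ((d : ℤ) - (m : ℤ))) *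
          latticeNorm h₁ * latticeNorm h₂ * ∑ k ∈ Finset.range (d + 2), mixedDerivL1 a k m := by
  obtain ⟨C, hC0, hfar⟩ := exists_pieceOp_of_two_le d
  set n : ℕ := 3 * d with hn
  have hn0 : n ≠ 0 := by omega
  have hd0 : (1 : ℝ) ≤ d := by exact_mod_cast hd
  have hnd : (n : ℝ) = 3 * d := by rw [hn]; push_cast; rfl
  set Λ : ℝ := (latticeSum d m).toReal with hΛ
  have hΛe : latticeSum d m = ENNReal.ofReal Λ :=
    (ENNReal.ofReal_toReal (latticeSum_lt_top hm).ne).symm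
  have hΛ0 : 0 ≤ Λ := ENNReal.toReal_nonneg
  set N : ℕ := (4 * n + 1) ^ d with hN
  set D : ℝ := 4 * C * N * 2 ^ d * ((6 * d) ^ m * Λ) with hD
  have hD0 : 0 ≤ D := by positivity
  refine ⟨D + 1, by positivity, ?_⟩
  intro h₁ h₂ a α t r hh₁ hh₂ ha hα ht hr hsupp hint
  have hα0 : 0 < α := by linarith
  have hr0 : 0 < r := by linarith
  have hαr : 0 < α * r := by positivity
  set Φ : ℝ≥0∞ := ∑ k ∈ Finset.range (d + 2), mixedDerivL1 a k m with hS
  have hfin : ∀ k < d + 2, mixedDerivL1 a k m < ⊤ := fun k hk => mixedDerivL1_lt_top hint hk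
  have hΦfin : Φ < ⊤ := ENNReal.sum_lt_top.2 fun k hk => hfin k (Finset.mem_range.1 hk)
  have hρ : 0 < r / n := by positivity
  have hdρ : (d : ℝ) * (r / n / 2) ≤ r := by
    rw [hnd]
    field_simp
    norm_num
  have hdρ2 : (d : ℝ) * (2 * (r / n)) < r := by
    rw [hnd]
    field_simp
    norm_num
  have hWq : ∀ q : Fin d → ℤ, ENNReal.ofReal ((2 / (α * (r / n * ‖q‖))) ^ m) =
      ENNReal.ofReal ((6 * d / (α * r)) ^ m) * ENNReal.ofReal ((‖q‖⁻¹) ^ m) := by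
    intro q
    rw [← ENNReal.ofReal_mul (by positivity), ← mul_pow]
    congr 2
    rw [hnd, ← div_eq_mul_inv, div_div]
    field_simp
    norm_num
  have hW : ∑' q : Fin d → ℤ, ENNReal.ofReal ((2 / (α * (r / n * ‖q‖))) ^ m) *
      ∑ k ∈ Finset.range (d + 2), mixedDerivL1 a k m =
      ENNReal.ofReal ((6 * d / (α * r)) ^ m * Λ) * Φ := by
    simp_rw [hWq]
    rw [ENNReal.tsum_mul_right, ENNReal.tsum_mul_left, ← latticeSum, hΛe,
      ← ENNReal.ofReal_mul (by positivity)]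
  obtain ⟨S, hS1, hS2, hS3⟩ := exists_isWeightedOp_of_weights (α := α) (t := t) (r := r)
    (W := fun q => ENNReal.ofReal ((2 / (α * (r / n * ‖q‖))) ^ m))
    (m := fun _ => m) (K := ENNReal.ofReal (C * α ^ d)) hn0 hr0 hh₁ hh₂ ha ENNReal.ofReal_ne_top
    (hW.trans_lt (ENNReal.mul_lt_top ENNReal.ofReal_lt_top hΦfin)) (fun p => by
      by_cases hp : ‖p.2 - p.1‖ < 2
      · exact ⟨0, isPieceOp_zero hsupp fun x hx y hy => dist_lt_of_norm_sub_lt_two hρ hdρ2 hp hx hy,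
          hasNuclearBound_zero.mono (zero_le)⟩
      · exact hfar (by omega) hα0 hr hρ hdρ ht hh₁ hh₂ ha hfin (not_lt.1 hp))
  refine ⟨S, hS1, hS2, hS3.trans ?_⟩
  have h2d : (r / n + 1) ^ d ≤ (2 * r) ^ d := by
    gcongr
    have : r / n ≤ r := div_le_self hr0.le (by rw [hnd]; linarith)
    linarith
  rw [hW]
  calc _ ≤ 4 * ENNReal.ofReal (C * α ^ d) * (N : ℝ≥0∞) * ENNReal.ofReal ((2 * r) ^ d) *
        latticeNorm h₁ * latticeNorm h₂ * (ENNReal.ofReal ((6 * d / (α * r)) ^ m * Λ) * Φ) := by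
        gcongr
    _ = ENNReal.ofReal (D * (α * r) ^ ((d : ℤ) - (m : ℤ))) * latticeNorm h₁ * latticeNorm h₂ *
        Φ := by
        have h4 : (4 : ℝ≥0∞) = ENNReal.ofReal 4 := by simp
        have hDe : ENNReal.ofReal (D * (α * r) ^ ((d : ℤ) - (m : ℤ))) =
            4 * ENNReal.ofReal (C * α ^ d) * (N : ℝ≥0∞) * ENNReal.ofReal ((2 * r) ^ d) *
              ENNReal.ofReal ((6 * d / (α * r)) ^ m * Λ) := by
          rw [h4, ← ENNReal.ofReal_natCast, ← ENNReal.ofReal_mul (by positivity),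
            ← ENNReal.ofReal_mul (by positivity), ← ENNReal.ofReal_mul (by positivity),
            ← ENNReal.ofReal_mul (by positivity)]
          congr 1
          rw [hD, zpow_sub₀ hαr.ne', zpow_natCast, zpow_natCast, div_pow, mul_pow α r d,
            mul_pow 2 r d]
          ring
        rw [hDe]
        ring
    _ ≤ _ := by
        gcongr
        linarith

end Assembly

end TraceClassPDO

open TraceClassPDO in
theorem mainTheorem11 (d : ℕ) (hd : 1 ≤ d) :
    (∃ C : ℝ, 0 < C ∧
      ∀ (h₁ h₂ : E d → ℂ) (a : E d → E d → ℂ) (α t : ℝ),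
        MemLatticeL2 h₁ → MemLatticeL2 h₂ →
        ContDiff ℝ ∞ (fun p : E d × E d => a p.1 p.2) →
        1 ≤ α → t ∈ Set.Icc (0 : ℝ) 1 →
        Integrable (fun p : E d × E d => symbolF (d + 1) (d + 1) a p.1 p.2) →
        ∃ T : L2 d →L[ℂ] L2 d, IsWeightedOp h₁ h₂ α t a T ∧ IsTraceClass T ∧
          traceNorm T ≤ ENNReal.ofReal (C * α ^ d) * latticeNorm h₁ * latticeNorm h₂ *
            ∑ k ∈ Finset.range (d + 2), ∑ l ∈ Finset.range (d + 2), mixedDerivL1 a k l) ∧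
    (∀ m : ℕ, d + 1 ≤ m → ∃ C : ℝ, 0 < C ∧
      ∀ (h₁ h₂ : E d → ℂ) (a : E d → E d → ℂ) (α t r : ℝ),
        MemLatticeL2 h₁ → MemLatticeL2 h₂ →
        ContDiff ℝ ∞ (fun p : E d × E d => a p.1 p.2) →
        1 ≤ α → t ∈ Set.Icc (0 : ℝ) 1 → 1 ≤ r →
        (∀ x ∈ essSupport h₁, ∀ y ∈ essSupport h₂, r ≤ dist x y) →
        Integrable (fun p : E d × E d => symbolFCirc (d + 1) m a p.1 p.2) →
        ∃ T : L2 d →L[ℂ] L2 d, IsWeightedOp h₁ h₂ α t a T ∧ IsTraceClass T ∧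
          traceNorm T ≤ ENNReal.ofReal (C * (α * r) ^ ((d : ℤ) - (m : ℤ))) *
            latticeNorm h₁ * latticeNorm h₂ *
              ∑ k ∈ Finset.range (d + 2), mixedDerivL1 a k m) :=
  ⟨exists_traceNorm_le d hd, exists_traceNorm_le_of_le_dist d hd⟩
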